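/- Let $L=(L(t))_{t\ge 0}$ be a subordinator, i.e. a càdlàg Lévy process with $L(0)=0$ and nonnegative increments. Let $\lambda$ be its Lévy measure: the measure on $(0,\infty)$ with $\int\min\{x,1\}\,\lambda(dx)<\infty$ such that, for some drift $d\ge 0$, $\mathbf E[e^{-\omega L(t)}]=\exp\{-t(d\,\omega+\int_0^\infty(1-e^{-\omega x})\,\lambda(dx))\}$ for all $t,\omega\ge 0$. Let $\Lambda(x)=\lambda((x,\infty))$, $x>0$, be its flight tail, and let $X_n(t)$ be the $n$-th largest jump of $L$ (counted with multiplicity) during $[0,t]$, with $X_n(t)=0$ if there are fewer than $n$ jumps. Suppose that $\Lambda(x)\sim x^{-\alpha}$ as $x\to\infty$ for some $\alpha>0$. Then for every $t>0$ the sequence of random variables $\big(c^{-1}X_n(c^\alpha t)\big)_{n\ge 1}$ converges in law in $\mathbb R^{\mathbb N}$ (product topology), as $c\to\infty$, to a sequence $(X_n^{(\infty)}(t))_{n\ge1}$ which almost surely satisfies $X_1^{(\infty)}(t)>X_2^{(\infty)}(t)>\cdots>0$. For all $K\ge 1$ and $\infty>b_1>a_1>b_2>a_2>\cdots>b_K>a_K=0$,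 $$\mathbf P\big(a_k<X_k^{(\infty)}(t)<b_k;\ k=1,\dots,K\big)=e^{-t\,b_K^{-\alpha}}\;t^{K-1}\prod_{k=1}^{K-1}\big(a_k^{-\alpha}-b_k^{-\alpha}\big).$$ Moreover the limit sequence has the following hierarchy, for every $\alpha>0$. Write $B_{p,q}$ for the cumulative distribution function of the $\mathrm{Beta}(p,q)$ distribution. (i) For integers $1\le n_1<\dots<n_{K+1}$ and $u_1,\dots,u_K\in[0,1]$, $$\mathbf P\Big(\frac{X^{(\infty)}_{n_{k+1}}(t)}{X^{(\infty)}_{n_k}(t)}\le u_k;\ k=1,\dots,K\Big)=\prod_{k=1}^K B_{n_k,\,n_{k+1}-n_k}(u_k^\alpha).$$ (ii) For integers $n,m\ge 1$ and real $p>0$, $$\mathbf E\Big[\Big(\frac{X^{(\infty)}_{n+m}(t)}{X^{(\infty)}_{n}(t)}\Big)^p\Big]=\prod_{k=n}^{n+m-1}\frac{k}{k+p/\alpha}.$$ (iii) For $K\ge 1$ and $1\ge a_1>\dots>a_K>a_{K+1}=0$, $$\mathbf P\Big(a_{k+1}<\frac{X^{(\infty)}_{k+1}(t)}{X^{(\infty)}_1(t)}<a_k;\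 k=1,\dots,K\Big)=\Gamma(K)\,a_K^{\alpha K}\prod_{k=1}^{K-1}\big(a_{k+1}^{-\alpha}-a_k^{-\alpha}\big).$$ -/

import Mathlib

open MeasureTheory ProbabilityTheory Filter Set
open scoped Topology NNReal ENNReal

/-- `L` is a subordinator (one-sided Lévy process) under `P`: it starts at `0`, has independent,
stationary and nonnegative increments, is continuous in probability, and has càdlàg paths
(almost surely). -/
structure IsSubordinator {Ω : Type*} [MeasurableSpace Ω] (P : Measure Ω) (L : ℝ≥0 → Ω → ℝ) :
    Prop where
  measurable : ∀ t, Measurable (L t)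
  start_zero : ∀ᵐ ω ∂P, L 0 ω = 0
  indep_increments : HasIndepIncrements L P
  stationary_increments : ∀ s h : ℝ≥0,
    IdentDistrib (fun ω ↦ L (s + h) ω - L s ω) (fun ω ↦ L h ω - L 0 ω) P P
  nonneg_increments : ∀ s t : ℝ≥0, s ≤ t → ∀ᵐ ω ∂P, 0 ≤ L t ω - L s ω
  continuous_in_probability : ∀ t, TendstoInMeasure P L (𝓝 t) (L t)
  cadlag : ∀ᵐ ω ∂P, ∀ t : ℝ≥0, ContinuousWithinAt (fun s ↦ L s ω) (Ici t) t ∧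
    ∃ l : ℝ, Tendsto (fun s ↦ L s ω) (𝓝[<] t) (𝓝 l)

/-- `ν` is the Lévy measure of the subordinator `L`, in the sense of the Lévy–Khinchin formula:
`ν` is carried by `(0, ∞)`, `∫ min (x, 1) ν(dx) < ∞`, and for some drift `d ≥ 0`
`E[exp (-u L(t))] = exp (-t (d u + ∫ (1 - exp (-u x)) ν(dx)))` for all `t, u ≥ 0`. -/
def IsLevyMeasureOf {Ω : Type*} [MeasurableSpace Ω] (ν : Measure ℝ) (P : Measure Ω)
    (L : ℝ≥0 → Ω → ℝ) : Prop :=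
  ν (Iic 0) = 0 ∧ ∫⁻ x, ENNReal.ofReal (min x 1) ∂ν < ∞ ∧
    ∃ d : ℝ, 0 ≤ d ∧ ∀ (t : ℝ≥0) (u : ℝ), 0 ≤ u →
      ∫ ω, Real.exp (-(u * L t ω)) ∂P =
        Real.exp (-(t * (d * u + ∫ x, (1 - Real.exp (-(u * x))) ∂ν)))

/-- The flight tail `Λ(x) = ν((x, ∞))`, used for `x > 0`. -/
noncomputable def flightTail (ν : Measure ℝ) (x : ℝ) : ℝ := ν.real (Ioi x)

/-- The jump (flight) `f(s) - f(s-)` of a path at time `s` (it is `0` at `s = 0`). -/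
noncomputable def flight (f : ℝ≥0 → ℝ) (s : ℝ≥0) : ℝ := f s - Function.leftLim f s

/-- The `n`-th largest flight (`n ≥ 1`, counted with multiplicity) of the path `f` during `[0, t]`:
the largest `x > 0` such that at least `n` flights up to time `t` have size at least `x`.
It is `0` if there are fewer than `n` (positive) flights up to time `t`. -/
noncomputable def orderFlight (f : ℝ≥0 → ℝ) (n : ℕ) (t : ℝ≥0) : ℝ :=
  sSup {x : ℝ | 0 < x ∧ (n : ℕ∞) ≤ {s : ℝ≥0 | s ≤ t ∧ x ≤ flight f s}.encard}

/-- The scaled order sequence `X_n^{(c)}(t) = c⁻¹ X_n(c^α t)`, `n = 1, 2, …`; the entry with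
index `i : ℕ` is the one of order `n = i + 1`. -/
noncomputable def scaledOrderSeq {Ω : Type*} (L : ℝ≥0 → Ω → ℝ) (α : ℝ) (t c : ℝ≥0) (ω : Ω) :
    ℕ → ℝ :=
  fun i ↦ (c : ℝ)⁻¹ * orderFlight (fun s ↦ L s ω) (i + 1) (c ^ α * t)

/-- The Beta`(p, q)` cumulative distribution function `B_{p,q}`, for `p, q > 0`. -/
noncomputable def betaCDF (p q x : ℝ) : ℝ := (betaMeasure p q).real (Iic x)

/-! The limit is explicit: if `Γ_1 < Γ_2 < ⋯` are the arrival times of a unit-rate Poisson process,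
its `i`-th entry is `(Γ_i / t)^(-1/α)`. The map `y ↦ (y / t)^(-1/α)` is decreasing, so every event
of the theorem becomes an event about sums of independent standard exponentials. The ratio of two
entries is a power of the ratio of two arrival times, in which `t` cancels. By the beta–gamma
algebra such a ratio is a beta variable independent of the later arrival time, so consecutive ratios
are independent; this gives (i) and (ii). For (iii) one conditions on `Γ_1`: the later arrivals are
`Γ_1` plus the arrivals of a fresh process.

Convergence in law is reduced to order boxes: events in which the first `K` entries lie in separated
intervals and the next one lies below all of them (`tendsto_of_tendsto_orderBox`). These boxes form
a π-system and are a neighbourhood base at each positive, strictly decreasing sequence, hence at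
almost every point for the limit law.

The box probabilities of the flights are found without the Lévy–Itô decomposition. Cut `[0, T]` into
`n` equal intervals. For a monotone right-continuous path and large `n`, the large grid increments
correspond to the large flights, up to an arbitrarily small change of the levels. The increments are
i.i.d., so the probability that exactly one lies in each cell and the others lie below the last
level is an explicit product (`measure_exists_embedding`). Its limit requires the tails of `n` times
the increment law. The Lévy–Khinchin formula gives the limits of the Laplace exponents, and
polynomial approximation in `exp (-x)` turns these into bounds by the tail of `T • ν` at nearby
levels (`eventually_real_Ici_le_and_le_real_Ioi`).

At a fixed level these rescaled tails need not be known to converge, since `ν` may have atoms. So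
limits are taken along an ultrafilter, and box probabilities are only bounded above and below by the
Poisson expression at shifted levels. After scaling, `c^α t ν((c x, ∞))` tends to `t / x^α`, which
is continuous in `x`. Hence the shifts can be sent to `0` after `c → ∞`, and the bounds close up. -/

/-! ### Beta–gamma algebra. -/

/-- The two densities entering the beta–gamma algebra match pointwise. -/
lemma gammaPDF_mul_gammaPDF_eq {a b s u : ℝ} (ha : 0 < a) (hb : 0 < b) (hs : 0 < s)
    (hu0 : u ≠ 0) (hu1 : u ≠ 1) :
    ENNReal.ofReal s * (gammaPDF a 1 (s * u) * gammaPDF b 1 (s - s * u)) =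
      betaPDF a b u * gammaPDF (a + b) 1 s := by
  by_cases hu : 0 < u ∧ u < 1
  · have h1 : 0 < s * u := mul_pos hs hu.1
    have h2' : 0 < 1 - u := by linarith [hu.2]
    have h2 : 0 < s - s * u := by nlinarith
    rw [gammaPDF_of_nonneg h1.le, gammaPDF_of_nonneg h2.le, gammaPDF_of_nonneg hs.le,
      betaPDF_of_pos_lt_one hu.1 hu.2]
    have g1 := Real.Gamma_pos_of_pos ha
    have g2 := Real.Gamma_pos_of_pos hb
    have g3 := Real.Gamma_pos_of_pos (add_pos ha hb)
    have hbe := beta_pos ha hb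
    have p1 := Real.rpow_pos_of_pos hu.1 (a - 1)
    have p2 := Real.rpow_pos_of_pos h2' (b - 1)
    rw [← ENNReal.ofReal_mul (by positivity), ← ENNReal.ofReal_mul hs.le,
      ← ENNReal.ofReal_mul (by positivity)]
    congr 1
    have e1 : s - s * u = s * (1 - u) := by ring
    rw [e1, Real.mul_rpow hs.le hu.1.le, Real.mul_rpow hs.le h2'.le, beta]
    have e2 : s ^ (a + b - 1) = s * (s ^ (a - 1) * s ^ (b - 1)) := by
      conv_rhs => rw [← Real.rpow_add hs]
      nth_rewrite 2 [← Real.rpow_one s]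
      rw [← Real.rpow_add hs]
      ring_nf
    have e3 : Real.exp (-(1 * s)) = Real.exp (-(1 * (s * u))) * Real.exp (-(1 * (s * (1 - u)))) := by
      rw [← Real.exp_add]; ring_nf
    rw [e2, e3]
    simp only [Real.one_rpow]
    field_simp
  · have : betaPDF a b u = 0 := by
      rw [betaPDF_eq, if_neg hu]; simp
    rw [this, zero_mul]
    rcases lt_or_gt_of_ne hu0 with h | h
    · rw [gammaPDF_of_neg (mul_neg_of_pos_of_neg hs h)]; simp
    · have : s - s * u < 0 := by
        have : 1 < u := by
          rcases lt_or_gt_of_ne hu1 with h' | h'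
          · exact absurd ⟨h, h'⟩ hu
          · exact h'
        nlinarith
      rw [gammaPDF_of_neg this]; simp

lemma measurable_gammaPDF (a r : ℝ) : Measurable (gammaPDF a r) :=
  (measurable_gammaPDFReal a r).ennreal_ofReal

lemma measurable_betaPDF (a b : ℝ) : Measurable (betaPDF a b) :=
  (measurable_betaPDFReal a b).ennreal_ofReal

lemma lintegral_comp_mul_left_of_pos {s : ℝ} (hs : 0 < s) {f : ℝ → ℝ≥0∞} (hf : Measurable f) :
    ∫⁻ x, f x = ENNReal.ofReal s * ∫⁻ u, f (s * u) := by
  have h := Real.smul_map_volume_mul_left hs.ne'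
  conv_lhs => rw [← h]
  rw [lintegral_smul_measure, lintegral_map hf (measurable_const_mul s), abs_of_pos hs]
  rfl

/-- Beta–gamma algebra: if `X`, `Y` are independent `Gamma(a)`, `Gamma(b)`, then `X / (X + Y)` and
`X + Y` are independent `Beta(a, b)`, `Gamma(a + b)`. -/
lemma map_div_add_gammaMeasure_prod {a b : ℝ} (ha : 0 < a) (hb : 0 < b) :
    ((gammaMeasure a 1).prod (gammaMeasure b 1)).map (fun p : ℝ × ℝ ↦ (p.1 / (p.1 + p.2), p.1 + p.2))
      = (betaMeasure a b).prod (gammaMeasure (a + b) 1) := by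
  have := isProbabilityMeasure_gammaMeasure ha one_pos
  have := isProbabilityMeasure_gammaMeasure hb one_pos
  have := isProbabilityMeasure_gammaMeasure (add_pos ha hb) one_pos
  have := isProbabilityMeasureBeta ha hb
  have mA := measurable_gammaPDF a 1
  have mB := measurable_gammaPDF b 1
  have mC := measurable_gammaPDF (a + b) 1
  have mD := measurable_betaPDF a b
  refine Measure.ext_of_lintegral _ fun f hf ↦ ?_
  rw [lintegral_map hf (by fun_prop), lintegral_prod _ (by fun_prop),
    lintegral_prod_symm' _ hf]
  -- Substitution `s = x + y`, so that the sum becomes the outer variable after the swap below.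
  have hL : ∀ x, ∫⁻ y, f (x / (x + y), x + y) ∂gammaMeasure b 1 =
      ∫⁻ s, gammaPDF b 1 (s - x) * f (x / s, s) := by
    intro x
    rw [gammaMeasure, lintegral_withDensity_eq_lintegral_mul _ mB (by fun_prop),
      ← lintegral_add_right_eq_self _ (-x)]
    refine lintegral_congr fun s ↦ ?_
    simp [sub_eq_add_neg]
  simp_rw [hL]
  rw [gammaMeasure, lintegral_withDensity_eq_lintegral_mul _ mA
    (Measurable.lintegral_prod_right (by fun_prop))]
  simp only [Pi.mul_apply]
  have : ∀ x, gammaPDF a 1 x * ∫⁻ s, gammaPDF b 1 (s - x) * f (x / s, s) =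
      ∫⁻ s, gammaPDF a 1 x * (gammaPDF b 1 (s - x) * f (x / s, s)) := fun x ↦
    (lintegral_const_mul _ (by fun_prop)).symm
  simp_rw [this]
  rw [lintegral_lintegral_swap (by fun_prop), gammaMeasure,
    lintegral_withDensity_eq_lintegral_mul _ mC (hf.lintegral_prod_left')]
  have h0 : ∀ᵐ s : ℝ, s ≠ 0 := by simp [ae_iff]
  refine lintegral_congr_ae (h0.mono fun s hs0 ↦ ?_)
  simp only [Pi.mul_apply]
  rcases lt_or_gt_of_ne hs0 with hs | hs
  · rw [gammaPDF_of_neg hs, zero_mul]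
    rw [lintegral_eq_zero_iff (by fun_prop)]
    refine ae_of_all _ fun x ↦ ?_
    simp only [Pi.zero_apply]
    rcases lt_or_ge x 0 with hx | hx
    · rw [gammaPDF_of_neg hx, zero_mul]
    · rw [gammaPDF_of_neg (show s - x < 0 by linarith), zero_mul, mul_zero]
  -- Substitution `x = s u`; its Jacobian `s` is the extra factor in `gammaPDF_mul_gammaPDF_eq`. The
  -- points `u = 0` and `u = 1` are discarded because the conventions for the densities disagree
  -- there.
  · rw [lintegral_comp_mul_left_of_pos hs (by fun_prop), betaMeasure,
      lintegral_withDensity_eq_lintegral_mul _ mD (by fun_prop),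
      ← lintegral_const_mul _ (by fun_prop), ← lintegral_const_mul _ (by fun_prop)]
    have h1 : ∀ᵐ u : ℝ, u ≠ 0 := by simp [ae_iff]
    have h2 : ∀ᵐ u : ℝ, u ≠ 1 := by simp [ae_iff]
    refine lintegral_congr_ae ?_
    filter_upwards [h1, h2] with u hu0 hu1
    have := gammaPDF_mul_gammaPDF_eq ha hb hs hu0 hu1
    rw [mul_div_cancel_left₀ _ hs.ne', Pi.mul_apply, ← mul_assoc (gammaPDF a 1 (s * u)), ← mul_assoc,
      this]
    ring

lemma map_add_gammaMeasure_prod {a b : ℝ} (ha : 0 < a) (hb : 0 < b) :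
    ((gammaMeasure a 1).prod (gammaMeasure b 1)).map (fun p : ℝ × ℝ ↦ p.1 + p.2)
      = gammaMeasure (a + b) 1 := by
  have := isProbabilityMeasureBeta ha hb
  have := isProbabilityMeasure_gammaMeasure (add_pos ha hb) one_pos
  have h := congrArg (Measure.map Prod.snd) (map_div_add_gammaMeasure_prod ha hb)
  rwa [Measure.map_map (by fun_prop) (by fun_prop), Measure.map_snd_prod, measure_univ,
    one_smul] at h

/-- Moments of the beta distribution. -/
lemma lintegral_rpow_betaMeasure {a b q : ℝ} (ha : 0 < a) (hb : 0 < b) (hq : 0 ≤ q) :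
    ∫⁻ x, ENNReal.ofReal (x ^ q) ∂betaMeasure a b =
      ENNReal.ofReal (beta (a + q) b / beta a b) := by
  have haq : 0 < a + q := by linarith
  rw [betaMeasure, lintegral_withDensity_eq_lintegral_mul _ (measurable_betaPDF a b) (by fun_prop)]
  -- Multiplying the density by `x ^ q` turns it into a multiple of the `Beta(a + q, b)` density, so
  -- the constant on the right is spread over that density.
  rw [← mul_one (ENNReal.ofReal _), ← lintegral_betaPDF_eq_one haq hb,
    ← lintegral_const_mul _ (measurable_betaPDF _ b)]
  refine lintegral_congr fun x ↦ ?_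
  have h1 := beta_pos ha hb
  have h2 := beta_pos haq hb
  by_cases hx : 0 < x ∧ x < 1
  · rw [Pi.mul_apply, betaPDF_of_pos_lt_one hx.1 hx.2, betaPDF_of_pos_lt_one hx.1 hx.2,
      ← ENNReal.ofReal_mul' (by have := hx.1; positivity), ← ENNReal.ofReal_mul (by positivity)]
    congr 1
    have : x ^ (a + q - 1) = x ^ (a - 1) * x ^ q := by
      rw [← Real.rpow_add hx.1]; ring_nf
    rw [this]
    field_simp
  · rw [Pi.mul_apply, betaPDF_eq, betaPDF_eq, if_neg hx, if_neg hx]; simp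

/-- `Γ(s + 1) = s Γ(s)` makes the quotient telescope. The induction on `m` uses the cross-multiplied
identity of gamma values, which is also valid at `m = 0`. -/
lemma beta_add_div_beta_eq_prod (n m : ℕ) {q : ℝ} (hq : 0 < q) (hm : 1 ≤ m) :
    beta ((n : ℝ) + 1 + q) m / beta ((n : ℝ) + 1) m =
      ∏ k ∈ Finset.Icc (n + 1) (n + m), ((k : ℝ) / (k + q)) := by
  have key : ∀ m : ℕ, Real.Gamma (n + 1 + q) * Real.Gamma (n + 1 + m) =
      Real.Gamma (n + 1 + q + m) * Real.Gamma (n + 1) *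
      ∏ k ∈ Finset.Icc (n + 1) (n + m), ((k : ℝ) / (k + q)) := by
    intro m
    induction m with
    | zero => simp
    | succ m ih =>
      rw [← add_assoc n m 1, Finset.prod_Icc_succ_top (by omega)]
      have e1 : (n : ℝ) + 1 + (m + 1 : ℕ) = (n + 1 + m) + 1 := by push_cast; ring
      have e2 : (n : ℝ) + 1 + q + (m + 1 : ℕ) = (n + 1 + q + m) + 1 := by push_cast; ring
      rw [e1, e2, Real.Gamma_add_one (by positivity), Real.Gamma_add_one (by positivity)]
      push_cast
      have : (n : ℝ) + m + 1 + q ≠ 0 := by positivity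
      have e3 : (n : ℝ) + 1 + q + m = n + m + 1 + q := by ring
      field_simp
      rw [e3] at ih ⊢
      linear_combination (n + m + 1 + q) * (n + 1 + m : ℝ) * ih
  have h1 : 0 < Real.Gamma (n + 1) := Real.Gamma_pos_of_pos (by positivity)
  have h2 : 0 < Real.Gamma (n + 1 + q) := Real.Gamma_pos_of_pos (by positivity)
  have hm' : (0 : ℝ) < m := by exact_mod_cast hm
  have h3 : 0 < Real.Gamma m := Real.Gamma_pos_of_pos hm'
  have h4 : 0 < Real.Gamma (n + 1 + m) := Real.Gamma_pos_of_pos (by positivity)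
  have h5 : 0 < Real.Gamma (n + 1 + q + m) := Real.Gamma_pos_of_pos (by positivity)
  have := key m
  rw [beta, beta]
  field_simp
  linear_combination this

/-! ### Exponential waiting times and their arrival times. -/

instance isProbabilityMeasure_expMeasure_one : IsProbabilityMeasure (expMeasure 1) :=
  isProbabilityMeasure_expMeasure one_pos

/-- The law of a sequence of independent standard exponential random variables. -/
noncomputable def expSeq : Measure (ℕ → ℝ) := Measure.infinitePi (fun _ : ℕ ↦ expMeasure 1)

instance isProbabilityMeasure_expSeq : IsProbabilityMeasure expSeq := by
  unfold expSeq; infer_instance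

/-- The σ-algebra generated by the coordinates with index in `s`. -/
@[reducible] def coordSigma (s : Set ℕ) : MeasurableSpace (ℕ → ℝ) :=
  ⨆ i ∈ s, MeasurableSpace.comap (fun ω : ℕ → ℝ ↦ ω i) inferInstance

lemma coordSigma_le (s : Set ℕ) : coordSigma s ≤ MeasurableSpace.pi :=
  iSup₂_le fun i _ ↦ (measurable_pi_apply i).comap_le

lemma measurable_coord_coordSigma {s : Set ℕ} {i : ℕ} (hi : i ∈ s) :
    Measurable[coordSigma s] (fun ω : ℕ → ℝ ↦ ω i) :=
  measurable_iff_comap_le.2 (le_iSup₂_of_le i hi le_rfl)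

lemma measurable_sum_coordSigma {s : Set ℕ} {u : Finset ℕ} (hu : ∀ i ∈ u, i ∈ s) :
    Measurable[coordSigma s] (fun ω : ℕ → ℝ ↦ ∑ i ∈ u, ω i) :=
  Finset.measurable_fun_sum u fun i hi ↦ measurable_coord_coordSigma (hu i hi)

lemma indep_coordSigma {s u : Set ℕ} (h : Disjoint s u) :
    Indep (coordSigma s) (coordSigma u) expSeq :=
  indep_iSup_of_disjoint (fun i ↦ (measurable_pi_apply i).comap_le)
    (iIndepFun_infinitePi (P := fun _ : ℕ ↦ expMeasure 1) (X := fun _ x ↦ x)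
      (fun _ ↦ measurable_id)) h

lemma map_coord_expSeq (i : ℕ) : expSeq.map (fun ω ↦ ω i) = expMeasure 1 :=
  Measure.infinitePi_map_eval _ i

/-- Restricting to an event known to `m₁` does not disturb what is independent of `m₁`. This drives
the inductions over arrival times: `D` records the past, `Z` is the current arrival time, and `G` is
the next waiting time or sum of waiting times. -/
lemma map_prod_restrict_of_indep {Ω β γ : Type*} [MeasurableSpace β] [MeasurableSpace γ]
    {m₁ m₂ mΩ : MeasurableSpace Ω} {Q : Measure Ω} [IsFiniteMeasure Q] (h₁ : m₁ ≤ mΩ) (h₂ : m₂ ≤ mΩ) (hI : Indep m₁ m₂ Q) {D : Set Ω} (hD : MeasurableSet[m₁] D)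
    {Z : Ω → β} {G : Ω → γ} (hZ : Measurable[m₁] Z) (hG : Measurable[m₂] G) :
    (Q.restrict D).map (fun ω ↦ (Z ω, G ω)) = ((Q.restrict D).map Z).prod (Q.map G) := by
  have hZ' : Measurable Z := hZ.mono h₁ le_rfl
  have hG' : Measurable G := hG.mono h₂ le_rfl
  have hD' : MeasurableSet D := h₁ _ hD
  have hprod := (Indep_iff m₁ m₂ Q).1 hI
  refine (Measure.prod_eq fun A B hA hB ↦ ?_).symm
  rw [Measure.map_apply (hZ'.prodMk hG') (hA.prod hB), Measure.restrict_apply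
    ((hZ'.prodMk hG') (hA.prod hB)), Measure.map_apply hZ' hA, Measure.restrict_apply (hZ' hA),
    Measure.map_apply hG' hB, ← hprod _ _ ((hZ hA).inter hD) (hG hB)]
  congr 1
  ext ω
  simp only [mem_inter_iff, mem_preimage, mem_prod]
  tauto

lemma disjoint_Iio_Ici_nat (n : ℕ) : Disjoint (Iio n) (Ici n) :=
  disjoint_left.2 fun i hi hi' ↦ by simp only [mem_Iio, mem_Ici] at hi hi'; omega

/-- Sums of `m` independent standard exponentials are `Gamma(m)` distributed. -/
lemma map_sum_expSeq (n m : ℕ) :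
    expSeq.map (fun ω ↦ ∑ i ∈ Finset.Ico n (n + (m + 1)), ω i) =
      gammaMeasure ((m : ℝ) + 1) 1 := by
  induction m with
  | zero => simpa [expMeasure] using map_coord_expSeq n
  | succ m ih =>
    have hI := indep_coordSigma (disjoint_Iio_Ici_nat (n + (m + 1)))
    have h := map_prod_restrict_of_indep (coordSigma_le _) (coordSigma_le _) hI
      (@MeasurableSet.univ _ (coordSigma _))
      (measurable_sum_coordSigma (u := Finset.Ico n (n + (m + 1))) (by simp))
      (measurable_coord_coordSigma (i := n + (m + 1)) (by simp))
    rw [Measure.restrict_univ, ih, map_coord_expSeq] at h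
    have h' := congrArg (Measure.map (fun p : ℝ × ℝ ↦ p.1 + p.2)) h
    rw [expMeasure, map_add_gammaMeasure_prod (by positivity) one_pos,
      Measure.map_map (by fun_prop) (by fun_prop)] at h'
    push_cast
    rw [← h']
    congr 1
    ext ω
    simp only [Function.comp]
    rw [← add_assoc n (m + 1) 1, Finset.sum_Ico_succ_top (by omega)]

lemma ae_pos_gammaMeasure {a : ℝ} : ∀ᵐ x ∂gammaMeasure a 1, 0 < x := by
  have h0 : gammaMeasure a 1 (Iic 0) = 0 := by
    rw [gammaMeasure, withDensity_apply _ measurableSet_Iic, setLIntegral_congr Iio_ae_eq_Iic.symm,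
      setLIntegral_eq_zero measurableSet_Iio fun x hx ↦ gammaPDF_of_neg hx]
  rw [ae_iff]
  simpa [Iic] using h0

lemma ae_pos_expSeq : ∀ᵐ ω ∂expSeq, ∀ i, 0 < ω i := by
  refine ae_all_iff.2 fun i ↦ ?_
  have h : ∀ᵐ x ∂expMeasure 1, 0 < x := ae_pos_gammaMeasure
  rw [← map_coord_expSeq i] at h
  exact ae_of_ae_map (measurable_pi_apply i).aemeasurable h

/-- The `k`-th partial sum of a sequence (the `k`-th arrival time if the entries are
waiting times). -/
def arrival (ω : ℕ → ℝ) (k : ℕ) : ℝ := ∑ i ∈ Finset.range k, ω i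

lemma measurable_arrival_coordSigma {k n : ℕ} (h : k ≤ n) :
    Measurable[coordSigma (Iio n)] (fun ω ↦ arrival ω k) :=
  measurable_sum_coordSigma fun i hi ↦ by simp at hi ⊢; omega

@[fun_prop]
lemma measurable_arrival (k : ℕ) : Measurable (fun ω ↦ arrival ω k) := by
  unfold arrival; fun_prop

/-- The ratios of arrival times are independent beta variables, independent of the last arrival
time. -/
lemma map_arrival_restrict_ratio {n : ℕ → ℕ} (hn : StrictMono n) (v : ℕ → ℝ) (K : ℕ) :
    (expSeq.restrict {ω | ∀ k < K, arrival ω (n k + 1) / arrival ω (n (k + 1) + 1) ≤ v k}).map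
      (fun ω ↦ arrival ω (n K + 1)) =
    (∏ k ∈ Finset.range K, betaMeasure ((n k : ℝ) + 1) ((n (k + 1) : ℝ) - n k) (Iic (v k))) •
      gammaMeasure ((n K : ℝ) + 1) 1 := by
  induction K with
  | zero =>
    have := map_sum_expSeq 0 (n 0)
    simpa [arrival] using this
  | succ K ih =>
    obtain ⟨m, hm⟩ := Nat.exists_eq_add_of_lt (hn (Nat.lt_succ_self K))
    rw [Nat.succ_eq_add_one] at hm
    have hb : 0 < (n (K + 1) : ℝ) - n K := by rw [hm]; push_cast; linarith
    have ha : 0 < (n K : ℝ) + 1 := by positivity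
    have := isProbabilityMeasureBeta ha hb
    have := isProbabilityMeasure_gammaMeasure hb one_pos
    have := isProbabilityMeasure_gammaMeasure ha one_pos
    have := isProbabilityMeasure_gammaMeasure (add_pos ha hb) one_pos
    have hDm : MeasurableSet[coordSigma (Iio (n K + 1))]
        {ω | ∀ k < K, arrival ω (n k + 1) / arrival ω (n (k + 1) + 1) ≤ v k} := by
      have : {ω | ∀ k < K, arrival ω (n k + 1) / arrival ω (n (k + 1) + 1) ≤ v k} =
          ⋂ k ∈ Iio K, {ω | arrival ω (n k + 1) / arrival ω (n (k + 1) + 1) ≤ v k} := by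
        ext; simp
      rw [this]
      refine MeasurableSet.biInter (to_countable _) fun k hk ↦ ?_
      have h1 : n (k + 1) ≤ n K := hn.monotone (by simp at hk; omega)
      have h2 : n k ≤ n (k + 1) := hn.monotone (by omega)
      have h3 : Measurable[coordSigma (Iio (n K + 1))]
          (fun ω ↦ arrival ω (n k + 1) / arrival ω (n (k + 1) + 1)) :=
        (measurable_arrival_coordSigma (by omega)).div (measurable_arrival_coordSigma (by omega))
      exact h3 measurableSet_Iic
    have hG := measurable_sum_coordSigma (s := Ici (n K + 1))
      (u := Finset.Ico (n K + 1) (n K + 1 + (m + 1))) (by simp; omega)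
    have h := map_prod_restrict_of_indep (coordSigma_le _) (coordSigma_le _)
      (indep_coordSigma (disjoint_Iio_Ici_nat (n K + 1))) hDm
      (measurable_arrival_coordSigma le_rfl) hG
    rw [ih, map_sum_expSeq] at h
    have hS : ∀ ω, arrival ω (n (K + 1) + 1) =
        arrival ω (n K + 1) + ∑ i ∈ Finset.Ico (n K + 1) (n K + 1 + (m + 1)), ω i := by
      intro ω
      rw [arrival, arrival, Finset.sum_range_add_sum_Ico _ (by omega)]
      congr 2; omega
    have hm' : (m : ℝ) + 1 = (n (K + 1) : ℝ) - n K := by rw [hm]; push_cast; ring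
    have hsum : (n K : ℝ) + 1 + ((n (K + 1) : ℝ) - n K) = (n (K + 1) : ℝ) + 1 := by ring
    rw [hm'] at h
    -- On the event fixing the earlier ratios, the current arrival time is still a multiple of a
    -- gamma law and is independent of the next block. The beta–gamma map therefore produces a new
    -- ratio independent of the new arrival time.
    have h' := congrArg (Measure.map (fun p : ℝ × ℝ ↦ (p.1 / (p.1 + p.2), p.1 + p.2))) h
    rw [Measure.prod_smul_left, Measure.map_smul, map_div_add_gammaMeasure_prod ha hb,
      Measure.map_map (by fun_prop) (by unfold arrival; fun_prop)] at h'
    ext B hB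
    have h'' := congrArg (fun ρ ↦ ρ (Iic (v K) ×ˢ B)) h'
    simp only [Measure.smul_apply, Measure.prod_prod, smul_eq_mul] at h''
    rw [Measure.map_apply (by fun_prop) (measurableSet_Iic.prod hB), Measure.restrict_apply
      (by
        refine MeasurableSet.preimage (measurableSet_Iic.prod hB) ?_
        unfold arrival; fun_prop)] at h''
    rw [Measure.map_apply (by fun_prop) hB, Measure.restrict_apply (measurable_arrival _ hB),
      Measure.smul_apply, smul_eq_mul, Finset.prod_range_succ, mul_assoc, ← hsum, ← h'']
    congr 1
    ext ω
    simp only [mem_inter_iff, mem_preimage, mem_ofPred_eq, mem_prod, Function.comp, mem_Iic, ← hS,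
      Nat.forall_lt_succ_right]
    tauto

/-- The density at `y > x` of an exponential variable shifted by `x` is `exp x * exp (-y)`. Since
`B` lies to the right of `x`, the starting point enters only through the factor `exp x`. -/
lemma expMeasure_preimage_const_add {x : ℝ} {B : Set ℝ} (hB : MeasurableSet B) (hx : B ⊆ Ioi x) :
    expMeasure 1 ((fun e ↦ x + e) ⁻¹' B) =
      ENNReal.ofReal (Real.exp x) * ∫⁻ y in B, ENNReal.ofReal (Real.exp (-y)) := by
  have hm := measurable_gammaPDF 1 1
  rw [expMeasure, gammaMeasure, withDensity_apply _ (hB.preimage (by fun_prop)),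
    ← lintegral_indicator (hB.preimage (by fun_prop)), ← lintegral_add_right_eq_self _ (-x),
    ← lintegral_const_mul _ (by fun_prop), ← lintegral_indicator hB]
  refine lintegral_congr fun y ↦ ?_
  by_cases hy : y ∈ B
  · rw [indicator_of_mem (by simpa using hy), indicator_of_mem hy, gammaPDF_of_nonneg
      (by have := hx hy; simp at this; linarith), ← ENNReal.ofReal_mul (by positivity),
      ← Real.exp_add]
    congr 1
    simp
  · rw [indicator_of_notMem (by simpa using hy), indicator_of_notMem hy]

/-- Probability that the first `k` arrival times fall in given ordered disjoint intervals, and that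
the next one falls in a set further to the right. -/
lemma expSeq_arrival_boxes {l r : ℕ → ℝ} (h0 : 0 ≤ l 0) (k : ℕ)
    (hlr : ∀ j < k, r j ≤ l (j + 1)) {B : Set ℝ} (hB : MeasurableSet B) (hBl : B ⊆ Ioi (l k)) :
    expSeq {ω | (∀ j < k, arrival ω (j + 1) ∈ Ioo (l j) (r j)) ∧ arrival ω (k + 1) ∈ B} =
      (∏ j ∈ Finset.range k, ENNReal.ofReal (r j - l j)) *
        ∫⁻ y in B, ENNReal.ofReal (Real.exp (-y)) := by
  induction k generalizing B with
  | zero =>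
    have h := expMeasure_preimage_const_add (x := 0) hB
      (hBl.trans (Ioi_subset_Ioi h0))
    simp only [zero_add, preimage_id', Real.exp_zero, ENNReal.ofReal_one, one_mul] at h
    rw [Finset.prod_range_zero, one_mul, ← h, ← map_coord_expSeq 0,
      Measure.map_apply (by fun_prop) hB]
    congr 1
    ext ω; simp [arrival]
  | succ k ih =>
    replace ih {B : Set ℝ} := ih (B := B) fun j hj ↦ hlr j (by omega)
    set D : Set (ℕ → ℝ) := {ω | ∀ j < k, arrival ω (j + 1) ∈ Ioo (l j) (r j)} with hD
    have hDm : MeasurableSet[coordSigma (Iio (k + 1))] D := by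
      have : D = ⋂ j ∈ Iio k, (fun ω ↦ arrival ω (j + 1)) ⁻¹' Ioo (l j) (r j) := by
        ext; simp [hD]
      rw [this]
      refine MeasurableSet.biInter (to_countable _) fun j hj ↦ ?_
      simp only [mem_Iio] at hj
      exact measurable_arrival_coordSigma (by omega) measurableSet_Ioo
    have h := map_prod_restrict_of_indep (coordSigma_le _) (coordSigma_le _)
      (indep_coordSigma (disjoint_Iio_Ici_nat (k + 1))) hDm
      (measurable_arrival_coordSigma le_rfl)
      (measurable_coord_coordSigma (i := k + 1) (by simp))
    rw [map_coord_expSeq] at h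
    set C := ∏ j ∈ Finset.range k, ENNReal.ofReal (r j - l j) with hC
    -- The induction hypothesis holds for every `B` to the right of `l k`. So there, on `D`, the
    -- current arrival time has density `C * exp (-y)`.
    have hm : ((expSeq.restrict D).map (fun ω ↦ arrival ω (k + 1))).restrict (Ioi (l k)) =
        C • (volume.withDensity (fun y ↦ ENNReal.ofReal (Real.exp (-y)))).restrict (Ioi (l k)) := by
      ext A hA
      rw [Measure.restrict_apply hA, Measure.smul_apply, Measure.restrict_apply hA,
        Measure.map_apply (by fun_prop) (hA.inter measurableSet_Ioi),
        Measure.restrict_apply (measurable_arrival _ (hA.inter measurableSet_Ioi)),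
        withDensity_apply _ (hA.inter measurableSet_Ioi), smul_eq_mul,
        ← ih (hA.inter measurableSet_Ioi) inter_subset_right]
      congr 1
      ext ω
      simp only [hD, mem_inter_iff, mem_preimage, mem_ofPred_eq]
      tauto
    have hR : MeasurableSet {p : ℝ × ℝ | p.1 ∈ Ioo (l k) (r k) ∧ p.1 + p.2 ∈ B} :=
      (measurable_fst measurableSet_Ioo).inter ((measurable_fst.add measurable_snd) hB)
    have h' := congrArg (fun ρ ↦ ρ {p : ℝ × ℝ | p.1 ∈ Ioo (l k) (r k) ∧ p.1 + p.2 ∈ B}) h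
    have hpm : Measurable (fun ω : ℕ → ℝ ↦ (arrival ω (k + 1), ω (k + 1))) := by
      unfold arrival; fun_prop
    rw [Measure.map_apply hpm hR, Measure.restrict_apply (hpm hR), Measure.prod_apply hR] at h'
    have hset : {ω | (∀ j < k + 1, arrival ω (j + 1) ∈ Ioo (l j) (r j)) ∧
        arrival ω (k + 1 + 1) ∈ B} = (fun ω : ℕ → ℝ ↦ (arrival ω (k + 1), ω (k + 1))) ⁻¹'
        {p : ℝ × ℝ | p.1 ∈ Ioo (l k) (r k) ∧ p.1 + p.2 ∈ B} ∩ D := by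
      ext ω
      have : arrival ω (k + 1 + 1) = arrival ω (k + 1) + ω (k + 1) := Finset.sum_range_succ _ _
      simp only [hD, mem_inter_iff, mem_preimage, mem_ofPred_eq, this, Nat.forall_lt_succ_right]
      tauto
    rw [hset, h']
    have hint : ∀ x, expMeasure 1 (Prod.mk x ⁻¹' {p : ℝ × ℝ | p.1 ∈ Ioo (l k) (r k) ∧ p.1 + p.2 ∈ B})
        = (Ioo (l k) (r k)).indicator (fun x ↦ ENNReal.ofReal (Real.exp x) *
          ∫⁻ y in B, ENNReal.ofReal (Real.exp (-y))) x := by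
      intro x
      by_cases hx : x ∈ Ioo (l k) (r k)
      · rw [indicator_of_mem hx, ← expMeasure_preimage_const_add hB
          (hBl.trans (Ioi_subset_Ioi (hx.2.le.trans (hlr k k.lt_succ_self))))]
        congr 1
        ext e
        simp only [mem_preimage, mem_ofPred_eq, hx, true_and]
      · rw [indicator_of_notMem hx]
        convert measure_empty (μ := expMeasure 1)
        ext e
        simp only [mem_preimage, mem_ofPred_eq, hx, false_and, mem_empty_iff_false]
    simp_rw [hint]
    have hsub : Ioo (l k) (r k) ⊆ Ioi (l k) := Ioo_subset_Ioi_self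
    rw [lintegral_indicator measurableSet_Ioo, ← Measure.restrict_restrict_of_subset hsub, hm, Measure.restrict_smul,
      lintegral_smul_measure, Measure.restrict_restrict_of_subset hsub,
      lintegral_mul_const _ (by fun_prop), restrict_withDensity measurableSet_Ioo,
      lintegral_withDensity_eq_lintegral_mul _ (by fun_prop) (by fun_prop)]
    -- The density `exp (-y)` of the current arrival cancels the factor `exp y` contributed by the
    -- next one, so the cell contributes just its length.
    have : ∀ y : ℝ, ((fun y ↦ ENNReal.ofReal (Real.exp (-y))) * fun x ↦
        ENNReal.ofReal (Real.exp x)) y = 1 := by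
      intro y
      rw [Pi.mul_apply, ← ENNReal.ofReal_mul (by positivity), ← Real.exp_add]
      simp
    simp_rw [this]
    rw [lintegral_one, Measure.restrict_apply_univ, Real.volume_Ioo, Finset.prod_range_succ,
      smul_eq_mul, mul_assoc]

lemma lintegral_exp_neg_Ioi (x : ℝ) :
    ∫⁻ y in Ioi x, ENNReal.ofReal (Real.exp (-y)) = ENNReal.ofReal (Real.exp (-x)) := by
  rw [← ofReal_integral_eq_lintegral_ofReal (integrableOn_exp_neg_Ioi x)
    (ae_of_all _ fun y ↦ (Real.exp_pos _).le), integral_exp_neg_Ioi]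

/-! ### The limit law: boxes, ratios and moments. -/

/-- The limiting order sequence, as a function of the waiting times `ω`. -/
noncomputable def limitSeq (α : ℝ) (t : ℝ≥0) (ω : ℕ → ℝ) (i : ℕ) : ℝ :=
  (arrival ω (i + 1) / t) ^ (-(1 / α))

@[fun_prop]
lemma measurable_limitSeq (α : ℝ) (t : ℝ≥0) : Measurable (limitSeq α t) := by
  refine measurable_pi_lambda _ fun i ↦ ?_
  unfold limitSeq; fun_prop

/-- The law of the limiting order sequence. -/
noncomputable def limitLaw (α : ℝ) (t : ℝ≥0) : ProbabilityMeasure (ℕ → ℝ) :=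
  ⟨expSeq.map (limitSeq α t), Measure.isProbabilityMeasure_map (by fun_prop)⟩

lemma coe_limitLaw (α : ℝ) (t : ℝ≥0) :
    (limitLaw α t : Measure (ℕ → ℝ)) = expSeq.map (limitSeq α t) := rfl

lemma arrival_succ_pos {ω : ℕ → ℝ} (h : ∀ i, 0 < ω i) (k : ℕ) : 0 < arrival ω (k + 1) :=
  Finset.sum_pos (fun i _ ↦ h i) (by simp)

lemma strictMono_arrival {ω : ℕ → ℝ} (h : ∀ i, 0 < ω i) : StrictMono (arrival ω) :=
  strictMono_nat_of_lt_succ fun n ↦ by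
    rw [arrival, arrival, Finset.sum_range_succ]; linarith [h n]

section
variable {α : ℝ} {t : ℝ≥0} {ω : ℕ → ℝ}

lemma limitSeq_pos (ht : 0 < t) (h : ∀ i, 0 < ω i) (i : ℕ) : 0 < limitSeq α t ω i :=
  Real.rpow_pos_of_pos (div_pos (arrival_succ_pos h i) (by exact_mod_cast ht)) _

lemma limitSeq_strictAnti (hα : 0 < α) (ht : 0 < t) (h : ∀ i, 0 < ω i) :
    StrictAnti (limitSeq α t ω) := fun i j hij ↦ by
  have ht' : (0 : ℝ) < t := by exact_mod_cast ht
  refine Real.rpow_lt_rpow_of_neg (div_pos (arrival_succ_pos h i) ht') ?_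
    (neg_lt_zero.2 (one_div_pos.2 hα))
  exact div_lt_div_of_pos_right (strictMono_arrival h (by omega)) ht'

lemma limitSeq_lt_iff (hα : 0 < α) (ht : 0 < t) (h : ∀ i, 0 < ω i) {b : ℝ} (hb : 0 < b) (i : ℕ) :
    limitSeq α t ω i < b ↔ (t : ℝ) / b ^ α < arrival ω (i + 1) := by
  have ht' : (0 : ℝ) < t := by exact_mod_cast ht
  have hA := arrival_succ_pos h i
  rw [limitSeq, Real.rpow_neg (by positivity), inv_lt_comm₀ (by positivity) hb,
    ← Real.rpow_lt_rpow_iff (by positivity) (by positivity) hα, ← Real.rpow_mul (by positivity),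
    one_div_mul_cancel hα.ne', Real.rpow_one, Real.inv_rpow hb.le, lt_div_iff₀ ht', div_eq_inv_mul]

lemma lt_limitSeq_iff (hα : 0 < α) (ht : 0 < t) (h : ∀ i, 0 < ω i) {a : ℝ} (ha : 0 < a) (i : ℕ) :
    a < limitSeq α t ω i ↔ arrival ω (i + 1) < (t : ℝ) / a ^ α := by
  have ht' : (0 : ℝ) < t := by exact_mod_cast ht
  have hA := arrival_succ_pos h i
  rw [limitSeq, Real.rpow_neg (by positivity), lt_inv_comm₀ ha (by positivity),
    ← Real.rpow_lt_rpow_iff (by positivity) (by positivity) hα, ← Real.rpow_mul (by positivity),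
    one_div_mul_cancel hα.ne', Real.rpow_one, Real.inv_rpow ha.le, div_lt_iff₀ ht', div_eq_inv_mul]

/-- The time `t` cancels, and the quotient is inverted because the entries are a negative power of
the arrival times. -/
lemma limitSeq_div (ht : 0 < t) (h : ∀ i, 0 < ω i) (i j : ℕ) :
    limitSeq α t ω j / limitSeq α t ω i = (arrival ω (i + 1) / arrival ω (j + 1)) ^ (1 / α) := by
  have ht' : (0 : ℝ) < t := by exact_mod_cast ht
  have hi := arrival_succ_pos h i
  have hj := arrival_succ_pos h j
  rw [limitSeq, limitSeq, ← Real.div_rpow (by positivity) (by positivity), Real.rpow_neg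
    (by positivity), ← Real.inv_rpow (by positivity)]
  congr 1
  field_simp

lemma ae_limitLaw (hα : 0 < α) (ht : 0 < t) :
    ∀ᵐ x ∂(limitLaw α t : Measure (ℕ → ℝ)), StrictAnti x ∧ ∀ i, 0 < x i := by
  have hm : MeasurableSet {x : ℕ → ℝ | StrictAnti x ∧ ∀ i, 0 < x i} := by
    have : {x : ℕ → ℝ | StrictAnti x ∧ ∀ i, 0 < x i} =
        (⋂ i, {x : ℕ → ℝ | x (i + 1) < x i}) ∩ ⋂ i, {x : ℕ → ℝ | 0 < x i} := by
      ext x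
      simp only [mem_ofPred_eq, mem_inter_iff, mem_iInter]
      exact and_congr_left fun _ ↦ ⟨fun h i ↦ h i.lt_succ_self, strictAnti_nat_of_succ_lt⟩
    rw [this]
    exact (MeasurableSet.iInter fun i ↦ measurableSet_lt (by fun_prop) (by fun_prop)).inter
      (MeasurableSet.iInter fun i ↦ measurableSet_lt (by fun_prop) (by fun_prop))
  rw [coe_limitLaw, ae_map_iff (by fun_prop) hm]
  filter_upwards [ae_pos_expSeq] with ω hω using
    ⟨limitSeq_strictAnti hα ht hω, limitSeq_pos ht hω⟩

lemma limitLaw_apply_eq {s : Set (ℕ → ℝ)} (hs : MeasurableSet s) {u : Set (ℕ → ℝ)}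
    (h : ∀ ω, (∀ i, 0 < ω i) → (limitSeq α t ω ∈ s ↔ ω ∈ u)) :
    (limitLaw α t : Measure (ℕ → ℝ)) s = expSeq u := by
  rw [coe_limitLaw, Measure.map_apply (by fun_prop) hs]
  refine measure_congr ?_
  filter_upwards [ae_pos_expSeq] with ω hω
  exact propext (h ω hω)

/-- Box probabilities of the limit law. -/
lemma limitLaw_box (hα : 0 < α) (ht : 0 < t) {a b : ℕ → ℝ} {K : ℕ} (hab : ∀ k < K, a k < b k)
    (hba : ∀ k < K, b (k + 1) < a k) (hpos : ∀ k ≤ K, 0 < b k) :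
    (limitLaw α t : Measure (ℕ → ℝ)).real {x | (∀ k < K, a k < x k ∧ x k < b k) ∧ x K < b K} =
      Real.exp (-(t : ℝ) / b K ^ α) * (t : ℝ) ^ K *
        ∏ k ∈ Finset.range K, (1 / a k ^ α - 1 / b k ^ α) := by
  have ht' : (0 : ℝ) < t := by exact_mod_cast ht
  have hapos : ∀ k < K, 0 < a k := fun k hk ↦ (hpos (k + 1) hk).trans (hba k hk)
  have hms : MeasurableSet {x : ℕ → ℝ | (∀ k < K, a k < x k ∧ x k < b k) ∧ x K < b K} := by
    have : {x : ℕ → ℝ | (∀ k < K, a k < x k ∧ x k < b k) ∧ x K < b K} =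
        (⋂ k ∈ Iio K, {x : ℕ → ℝ | x k ∈ Ioo (a k) (b k)}) ∩ {x | x K < b K} := by
      ext; simp
    rw [this]
    exact (MeasurableSet.biInter (to_countable _) fun k _ ↦
      measurable_pi_apply k measurableSet_Ioo).inter (measurable_pi_apply K measurableSet_Iio)
  have hr : ∀ j < K, (t : ℝ) / a j ^ α ≤ t / b (j + 1) ^ α := fun j hj ↦ by
    have h1 := hpos (j + 1) hj
    have h2 := Real.rpow_le_rpow h1.le (hba j hj).le hα.le
    gcongr
  rw [Measure.real, limitLaw_apply_eq hms (u := {ω | (∀ j < K, arrival ω (j + 1) ∈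
      Ioo ((t : ℝ) / b j ^ α) (t / a j ^ α)) ∧ arrival ω (K + 1) ∈ Ioi ((t : ℝ) / b K ^ α)}),
    expSeq_arrival_boxes (by have := hpos 0 K.zero_le; positivity) K hr measurableSet_Ioi
      Subset.rfl, lintegral_exp_neg_Ioi, ENNReal.toReal_mul, ENNReal.toReal_prod,
      ENNReal.toReal_ofReal (Real.exp_pos _).le, mul_comm, mul_assoc, neg_div]
  · congr 1
    rw [← Finset.card_range K, ← Finset.prod_const, Finset.card_range, ← Finset.prod_mul_distrib]
    refine Finset.prod_congr rfl fun k hk ↦ ?_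
    have hk' := Finset.mem_range.1 hk
    have h1 := hapos k hk'
    have h2 := Real.rpow_le_rpow h1.le (hab k hk').le hα.le
    rw [ENNReal.toReal_ofReal]
    · ring
    · rw [sub_nonneg]; gcongr
  · intro ω hω
    simp only [mem_ofPred_eq, mem_Ioo, mem_Ioi]
    refine and_congr (forall₂_congr fun k hk ↦ ?_) (limitSeq_lt_iff hα ht hω (hpos K le_rfl) K)
    rw [limitSeq_lt_iff hα ht hω (hpos k hk.le), lt_limitSeq_iff hα ht hω (hapos k hk), and_comm]

/-- Joint law of the ratios of the limit law. -/
lemma limitLaw_ratio (hα : 0 < α) (ht : 0 < t) {n : ℕ → ℕ} (hn : StrictMono n) (K : ℕ) {u : ℕ → ℝ}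
    (hu : ∀ k < K, 0 ≤ u k) :
    (limitLaw α t : Measure (ℕ → ℝ)).real {x | ∀ k < K, x (n (k + 1)) / x (n k) ≤ u k} =
      ∏ k ∈ Finset.range K, betaCDF ((n k : ℝ) + 1) ((n (k + 1) : ℝ) - n k) (u k ^ α) := by
  have hms : MeasurableSet {x : ℕ → ℝ | ∀ k < K, x (n (k + 1)) / x (n k) ≤ u k} := by
    have : {x : ℕ → ℝ | ∀ k < K, x (n (k + 1)) / x (n k) ≤ u k} =
        ⋂ k ∈ Iio K, {x : ℕ → ℝ | x (n (k + 1)) / x (n k) ≤ u k} := by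
      ext; simp
    rw [this]
    exact MeasurableSet.biInter (to_countable _) fun k _ ↦
      measurableSet_le (by fun_prop) (by fun_prop)
  -- The total mass of the restricted law is the probability of the event on the ratios.
  have h := congrArg (fun ρ ↦ ρ univ) (map_arrival_restrict_ratio hn (fun k ↦ u k ^ α) K)
  have := isProbabilityMeasure_gammaMeasure (a := (n K : ℝ) + 1) (r := 1) (by positivity) one_pos
  rw [Measure.map_apply (by fun_prop) MeasurableSet.univ, preimage_univ,
    Measure.restrict_apply_univ, Measure.smul_apply, measure_univ, smul_eq_mul, mul_one] at h
  rw [Measure.real, limitLaw_apply_eq hms (u := {ω | ∀ k < K,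
    arrival ω (n k + 1) / arrival ω (n (k + 1) + 1) ≤ u k ^ α}), h, ENNReal.toReal_prod]
  · rfl
  · intro ω hω
    simp only [mem_ofPred_eq]
    refine forall₂_congr fun k hk ↦ ?_
    have h1 := arrival_succ_pos hω (n k)
    have h2 := arrival_succ_pos hω (n (k + 1))
    rw [limitSeq_div ht hω, ← Real.rpow_le_rpow_iff (z := α) (by positivity) (hu k hk) hα,
      ← Real.rpow_mul (by positivity), one_div_mul_cancel hα.ne', Real.rpow_one]

/-- Case of one ratio in `map_arrival_restrict_ratio`. The indices `n + k * (m + 1)` are merely some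
strictly increasing sequence starting with `n`, `n + (m + 1)`. -/
lemma limitLaw_map_ratio (n m : ℕ) :
    expSeq.map (fun ω ↦ arrival ω (n + 1) / arrival ω (n + (m + 1) + 1)) =
      betaMeasure ((n : ℝ) + 1) ((m : ℝ) + 1) := by
  have hb : 0 < (m : ℝ) + 1 := by positivity
  have ha : 0 < (n : ℝ) + 1 := by positivity
  have := isProbabilityMeasureBeta ha hb
  have := Measure.isProbabilityMeasure_map (μ := expSeq)
    (f := fun ω ↦ arrival ω (n + 1) / arrival ω (n + (m + 1) + 1)) (by fun_prop)
  refine Measure.ext_of_Iic _ _ fun v ↦ ?_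
  have hn : StrictMono (fun k : ℕ ↦ n + k * (m + 1)) := fun i j hij ↦ by
    have : i * (m + 1) < j * (m + 1) := Nat.mul_lt_mul_of_pos_right hij (by omega)
    simpa using this
  have h := congrArg (fun ρ ↦ ρ univ) (map_arrival_restrict_ratio hn (fun _ ↦ v) 1)
  have := isProbabilityMeasure_gammaMeasure (a := ((n + 1 * (m + 1) : ℕ) : ℝ) + 1) (r := 1)
    (by positivity) one_pos
  rw [Measure.map_apply (by fun_prop) MeasurableSet.univ, preimage_univ,
    Measure.restrict_apply_univ, Measure.smul_apply, measure_univ, smul_eq_mul, mul_one] at h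
  rw [Measure.map_apply (by fun_prop) measurableSet_Iic]
  simpa [Iic, preimage] using h

/-- Moments of the ratios of the limit law. -/
lemma limitLaw_moment (hα : 0 < α) (ht : 0 < t) (n m : ℕ) {p : ℝ} (hm : 1 ≤ m) (hp : 0 < p) :
    ∫ x, (x (n + m) / x n) ^ p ∂(limitLaw α t : Measure (ℕ → ℝ)) =
      ∏ k ∈ Finset.Icc (n + 1) (n + m), ((k : ℝ) / (k + p / α)) := by
  obtain ⟨m, rfl⟩ := Nat.exists_eq_add_of_le' hm
  have hq : 0 < p / α := div_pos hp hα
  rw [← beta_add_div_beta_eq_prod n (m + 1) hq hm, coe_limitLaw,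
    integral_map (by fun_prop) (Measurable.aestronglyMeasurable (by fun_prop))]
  have h1 : ∫ ω, (limitSeq α t ω (n + (m + 1)) / limitSeq α t ω n) ^ p ∂expSeq =
      ∫ ω, (arrival ω (n + 1) / arrival ω (n + (m + 1) + 1)) ^ (p / α) ∂expSeq := by
    refine integral_congr_ae ?_
    filter_upwards [ae_pos_expSeq] with ω hω
    have h1 := arrival_succ_pos hω n
    have h2 := arrival_succ_pos hω (n + (m + 1))
    rw [limitSeq_div ht hω, ← Real.rpow_mul (by positivity), one_div_mul_eq_div]
  rw [h1, ← integral_map (φ := fun ω ↦ arrival ω (n + 1) / arrival ω (n + (m + 1) + 1))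
    (f := fun x : ℝ ↦ x ^ (p / α)) (by fun_prop) (Measurable.aestronglyMeasurable (by fun_prop)),
    limitLaw_map_ratio]
  have ha : 0 < (n : ℝ) + 1 := by positivity
  have hb : 0 < (m : ℝ) + 1 := by positivity
  have h0 : ∀ᵐ x ∂betaMeasure ((n : ℝ) + 1) ((m : ℝ) + 1), 0 ≤ x ^ (p / α) := by
    rw [← limitLaw_map_ratio, ae_map_iff (by fun_prop)
      (measurableSet_le (by fun_prop) (by fun_prop))]
    filter_upwards [ae_pos_expSeq] with ω hω
    have h1 := arrival_succ_pos hω n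
    have h2 := arrival_succ_pos hω (n + (m + 1))
    positivity
  rw [integral_eq_lintegral_of_nonneg_ae h0 (Measurable.aestronglyMeasurable (by fun_prop)),
    lintegral_rpow_betaMeasure ha hb hq.le, ENNReal.toReal_ofReal]
  · push_cast; rfl
  · exact (div_pos (beta_pos (by positivity) hb) (beta_pos ha hb)).le

/-- Renewal at the first arrival: after it the process starts afresh, independently of it. -/
lemma map_zero_shift_expSeq :
    expSeq.map (fun ω ↦ (ω 0, fun i ↦ ω (i + 1))) = (expMeasure 1).prod expSeq := by
  have hG : Measurable[coordSigma (Ici 1)] (fun (ω : ℕ → ℝ) (i : ℕ) ↦ ω (i + 1)) :=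
    @measurable_pi_lambda _ _ _ (coordSigma (Ici 1)) _ _ fun i ↦
      measurable_coord_coordSigma (by simp)
  have h := map_prod_restrict_of_indep (coordSigma_le _) (coordSigma_le _)
      (indep_coordSigma (disjoint_Iio_Ici_nat 1)) (@MeasurableSet.univ _ (coordSigma _))
      (measurable_coord_coordSigma (i := 0) (by simp)) hG
  rw [Measure.restrict_univ, map_coord_expSeq] at h
  rw [h]
  congr 1
  exact Measure.map_infinitePi_infinitePi_of_inj (P := fun _ : ℕ ↦ expMeasure 1)
    (f := fun i : ℕ ↦ i + 1) (add_left_injective 1)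

/-- The exponential density completes `exp (-((A - 1) * s))` to `exp (-(A * s))`, leaving Euler's
integral for the gamma function. It averages over the first arrival time in the proof of (iii). -/
lemma lintegral_pow_mul_exp_expMeasure (K : ℕ) {A : ℝ} (hA : 0 < A) :
    ∫⁻ s, ENNReal.ofReal (s ^ K * Real.exp (-((A - 1) * s))) ∂expMeasure 1 =
      ENNReal.ofReal (Real.Gamma (K + 1) / A ^ (K + 1)) := by
  have hm := measurable_gammaPDF 1 1
  have h := Real.integral_rpow_mul_exp_neg_mul_Ioi (a := (K : ℝ) + 1) (r := A) (by positivity) hA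
  rw [expMeasure, gammaMeasure, lintegral_withDensity_eq_lintegral_mul _ hm (by fun_prop)]
  have hint : IntegrableOn (fun s : ℝ ↦ s ^ ((K : ℝ) + 1 - 1) * Real.exp (-(A * s))) (Ioi 0) := by
    refine Integrable.of_integral_ne_zero ?_
    rw [h]
    have := Real.Gamma_pos_of_pos (s := (K : ℝ) + 1) (by positivity)
    positivity
  have hfin : Real.Gamma (K + 1) / A ^ (K + 1) = (1 / A) ^ ((K : ℝ) + 1) * Real.Gamma (K + 1) := by
    have : (1 / A) ^ ((K : ℝ) + 1) = (1 / A) ^ (K + 1) := by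
      rw [← Real.rpow_natCast]; push_cast; rfl
    rw [this, one_div, inv_pow, div_eq_inv_mul]
  rw [hfin, ← h, ofReal_integral_eq_lintegral_ofReal hint, ← lintegral_indicator measurableSet_Ioi]
  · have h0 : ∀ᵐ s : ℝ, s ≠ 0 := by simp [ae_iff]
    refine lintegral_congr_ae (h0.mono fun s hs0 ↦ ?_)
    rcases lt_or_gt_of_ne hs0 with hs | hs
    · rw [Pi.mul_apply, gammaPDF_of_neg hs, indicator_of_notMem (by simp [hs.le]), zero_mul]
    · rw [Pi.mul_apply, gammaPDF_of_nonneg hs.le, indicator_of_mem (by simpa using hs),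
        ← ENNReal.ofReal_mul (by positivity)]
      congr 1
      have e : Real.exp (-(A * s)) = Real.exp (-(1 * s)) * Real.exp (-((A - 1) * s)) := by
        rw [← Real.exp_add]; ring_nf
      rw [e, add_sub_cancel_right, Real.rpow_natCast]
      simp
      ring
  · refine (ae_restrict_iff' measurableSet_Ioi).2 (ae_of_all _ fun s hs ↦ ?_)
    have : (0 : ℝ) < s := hs
    simp only [Pi.zero_apply]
    positivity

/-- Joint law of the ratios to the largest entry under the limit law. -/
lemma limitLaw_ratio_first (hα : 0 < α) (ht : 0 < t) {K : ℕ} {a : ℕ → ℝ}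
    (hanti : ∀ k ≤ K, a (k + 1) < a k) (h1 : a 0 ≤ 1) (hlast : a (K + 1) = 0) :
    (limitLaw α t : Measure (ℕ → ℝ)).real
        {x | ∀ k < K + 1, a (k + 1) < x (k + 1) / x 0 ∧ x (k + 1) / x 0 < a k} =
      Real.Gamma (K + 1) * a K ^ (α * (K + 1)) *
        ∏ k ∈ Finset.range K, (1 / a (k + 1) ^ α - 1 / a k ^ α) := by
  have hpos : ∀ k ≤ K, 0 < a k := by
    exact fun k hk ↦ Nat.decreasingInduction (motive := fun k _ ↦ 0 < a k)
      (fun k hk ih ↦ ih.trans (hanti k hk.le)) (hlast ▸ hanti K le_rfl) hk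
  have hle1 : ∀ k ≤ K, a k ≤ 1 := by
    intro k hk
    induction k with
    | zero => exact h1
    | succ k ih => exact (hanti k (by omega)).le.trans (ih (by omega))
  set A : ℕ → ℝ := fun k ↦ 1 / a k ^ α with hAdef
  have hA1 : ∀ k ≤ K, 1 ≤ A k := fun k hk ↦
    one_le_one_div (Real.rpow_pos_of_pos (hpos k hk) _)
      (Real.rpow_le_one (hpos k hk).le (hle1 k hk) hα.le)
  have hAm : ∀ k < K, A k ≤ A (k + 1) := fun k hk ↦
    one_div_le_one_div_of_le (Real.rpow_pos_of_pos (hpos _ hk) _)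
      (Real.rpow_le_rpow (hpos _ hk).le (hanti k hk.le).le hα.le)
  have hms : MeasurableSet
      {x : ℕ → ℝ | ∀ k < K + 1, a (k + 1) < x (k + 1) / x 0 ∧ x (k + 1) / x 0 < a k} := by
    have : {x : ℕ → ℝ | ∀ k < K + 1, a (k + 1) < x (k + 1) / x 0 ∧ x (k + 1) / x 0 < a k} =
        ⋂ k ∈ Iio (K + 1), {x : ℕ → ℝ | x (k + 1) / x 0 ∈ Ioo (a (k + 1)) (a k)} := by
      ext; simp
    rw [this]
    exact MeasurableSet.biInter (to_countable _) fun k _ ↦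
      (by fun_prop : Measurable fun x : ℕ → ℝ ↦ x (k + 1) / x 0) measurableSet_Ioo
  -- Here `p.1` is the first arrival time and `p.2` the waiting times after it. A ratio to the
  -- largest entry between `a (j + 1)` and `a j` means that the total arrival time lies between `A j
  -- * p.1` and `A (j + 1) * p.1`; subtracting `p.1` gives the `- 1`. The last ratio has only an
  -- upper bound.
  set R : Set (ℝ × (ℕ → ℝ)) := {p | (∀ j < K, arrival p.2 (j + 1) ∈
    Ioo ((A j - 1) * p.1) ((A (j + 1) - 1) * p.1)) ∧ arrival p.2 (K + 1) ∈ Ioi ((A K - 1) * p.1)}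
    with hR
  have hRm : MeasurableSet R := by
    have : R = (⋂ j ∈ Iio K, {p | (A j - 1) * p.1 < arrival p.2 (j + 1)} ∩
        {p | arrival p.2 (j + 1) < (A (j + 1) - 1) * p.1}) ∩
        {p | (A K - 1) * p.1 < arrival p.2 (K + 1)} := by
      ext; simp [hR]
    rw [this]
    unfold arrival
    refine MeasurableSet.inter (MeasurableSet.biInter (to_countable _) fun k _ ↦ ?_) ?_
    · exact (measurableSet_lt (by fun_prop) (by fun_prop)).inter
        (measurableSet_lt (by fun_prop) (by fun_prop))
    · exact measurableSet_lt (by fun_prop) (by fun_prop)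
  rw [Measure.real, limitLaw_apply_eq hms
    (u := (fun ω : ℕ → ℝ ↦ (ω 0, fun i ↦ ω (i + 1))) ⁻¹' R)]
  · rw [← Measure.map_apply (by fun_prop) hRm, map_zero_shift_expSeq, Measure.prod_apply hRm]
    -- Given the first arrival `s`, the intervals are contiguous, with lengths `(A (k + 1) - A k) *
    -- s`, so the box formula for the fresh process applies.
    have hpt : ∀ᵐ s ∂expMeasure 1, expSeq (Prod.mk s ⁻¹' R) =
        ENNReal.ofReal (∏ k ∈ Finset.range K, (A (k + 1) - A k)) *
          ENNReal.ofReal (s ^ K * Real.exp (-((A K - 1) * s))) := by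
      filter_upwards [(ae_pos_gammaMeasure : ∀ᵐ s ∂expMeasure 1, 0 < s)] with s hs
      have := expSeq_arrival_boxes (l := fun j ↦ (A j - 1) * s) (r := fun j ↦ (A (j + 1) - 1) * s)
        (by have := hA1 0 (by omega); nlinarith) K (fun j _ ↦ le_rfl)
        measurableSet_Ioi Subset.rfl
      rw [lintegral_exp_neg_Ioi] at this
      refine Eq.trans (by rfl) (this.trans ?_)
      rw [ENNReal.ofReal_mul (by positivity), ← mul_assoc]
      congr 1
      rw [← ENNReal.ofReal_prod_of_nonneg, ← ENNReal.ofReal_mul]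
      · congr 1
        rw [← Finset.card_range K, ← Finset.prod_const, Finset.card_range,
          ← Finset.prod_mul_distrib]
        exact Finset.prod_congr rfl fun k _ ↦ by ring
      · exact Finset.prod_nonneg fun k hk ↦ sub_nonneg.2 (hAm k (Finset.mem_range.1 hk))
      · intro k hk
        have := hAm k (Finset.mem_range.1 hk)
        nlinarith
    have hAK := zero_lt_one.trans_le (hA1 K le_rfl)
    rw [lintegral_congr_ae hpt, lintegral_const_mul _ (by fun_prop),
      lintegral_pow_mul_exp_expMeasure K hAK, ENNReal.toReal_mul, ENNReal.toReal_ofReal,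
      ENNReal.toReal_ofReal, mul_comm]
    · congr 1
      have hp := hpos K le_rfl
      have : a K ^ (α * (K + 1)) = (a K ^ α) ^ (K + 1) := by
        rw [Real.rpow_mul hp.le, ← Real.rpow_natCast]; push_cast; rfl
      rw [this, hAdef]
      simp only [one_div, inv_pow, div_inv_eq_mul]
    · have := Real.Gamma_pos_of_pos (s := (K : ℝ) + 1) (by positivity)
      positivity
    · exact Finset.prod_nonneg fun k hk ↦ sub_nonneg.2 (hAm k (Finset.mem_range.1 hk))
  · intro ω hω
    have hs := hω 0
    have hsum : ∀ k, arrival ω (k + 1 + 1) = ω 0 + arrival (fun i ↦ ω (i + 1)) (k + 1) := by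
      intro k
      rw [arrival, Finset.sum_range_succ', add_comm]; rfl
    have hk2 : ∀ k ≤ K, (limitSeq α t ω (k + 1) / limitSeq α t ω 0 < a k ↔
        (A k - 1) * ω 0 < arrival (fun i ↦ ω (i + 1)) (k + 1)) := by
      intro k hk
      have h3 := arrival_succ_pos hω (k + 1)
      have h4 := hpos k hk
      have h5 : arrival ω (0 + 1) = ω 0 := by simp [arrival]
      rw [limitSeq_div ht hω, h5, ← Real.rpow_lt_rpow_iff (z := α) (by positivity) h4.le hα,
        ← Real.rpow_mul (by positivity), one_div_mul_cancel hα.ne', Real.rpow_one,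
        div_lt_iff₀ h3, hsum, hAdef]
      simp only
      rw [sub_mul, one_mul, sub_lt_iff_lt_add', one_div_mul_eq_div, div_lt_iff₀' (by positivity)]
    have hk1 : ∀ k ≤ K, (a k < limitSeq α t ω k / limitSeq α t ω 0 ↔
        arrival ω (k + 1) < A k * ω 0) := by
      intro k hk
      have h3 := arrival_succ_pos hω k
      have h4 := hpos k hk
      have h5 : arrival ω (0 + 1) = ω 0 := by simp [arrival]
      rw [limitSeq_div ht hω, h5, ← Real.rpow_lt_rpow_iff (z := α) h4.le (by positivity) hα,
        ← Real.rpow_mul (by positivity), one_div_mul_cancel hα.ne', Real.rpow_one,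
        lt_div_iff₀ h3, hAdef]
      simp only
      rw [one_div_mul_eq_div, lt_div_iff₀' (by positivity)]
    have hk3 : ∀ k < K, (a (k + 1) < limitSeq α t ω (k + 1) / limitSeq α t ω 0 ↔
        arrival (fun i ↦ ω (i + 1)) (k + 1) < (A (k + 1) - 1) * ω 0) := by
      intro k hk
      rw [hk1 (k + 1) hk, hsum, sub_mul, one_mul, lt_sub_iff_add_lt']
    simp only [mem_ofPred_eq, hR, mem_preimage, mem_Ioo, mem_Ioi, Nat.forall_lt_succ_right]
    refine and_congr (forall₂_congr fun k hk ↦ ?_) ?_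
    · rw [hk2 k hk.le, hk3 k hk, and_comm]
    · rw [hk2 K le_rfl, hlast, and_iff_right]
      exact div_pos (limitSeq_pos ht hω _) (limitSeq_pos ht hω _)

end

/-! ### Order boxes and weak convergence. -/

/-- The sequences whose first `K` entries lie in the intervals `(a k, b k)` and whose entry of
index `K` is below `b K`. -/
def orderBox (K : ℕ) (a b : ℕ → ℝ) : Set (ℕ → ℝ) :=
  {x | (∀ k < K, a k < x k ∧ x k < b k) ∧ x K < b K}

/-- The endpoints of `K + 1` separated intervals of positive reals, in decreasing order; the last
interval has no left endpoint. -/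
structure IsOrderBox (K : ℕ) (a b : ℕ → ℝ) : Prop where
  lt : ∀ k < K, a k < b k
  succ_lt : ∀ k < K, b (k + 1) < a k
  last_pos : 0 < b K

namespace IsOrderBox
variable {K : ℕ} {a b : ℕ → ℝ}

lemma lt_of_lt (h : IsOrderBox K a b) {j k : ℕ} (hjk : j < k) (hk : k ≤ K) : b k < a j := by
  induction k, hjk using Nat.le_induction with
  | base => exact h.succ_lt j hk
  | succ m hm ih => exact ((h.succ_lt m hk).trans (h.lt m hk)).trans (ih (by omega))

lemma le_of_le (h : IsOrderBox K a b) {j k : ℕ} (hjk : j ≤ k) (hk : k ≤ K) : b k ≤ b j := by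
  rcases hjk.eq_or_lt with rfl | hlt
  · exact le_rfl
  · exact ((h.lt_of_lt hlt hk).trans (h.lt j (by omega))).le

lemma pos (h : IsOrderBox K a b) {k : ℕ} (hk : k ≤ K) : 0 < b k :=
  h.last_pos.trans_le (h.le_of_le hk le_rfl)

lemma left_pos (h : IsOrderBox K a b) {k : ℕ} (hk : k < K) : 0 < a k :=
  (h.pos hk).trans (h.succ_lt k hk)

end IsOrderBox

lemma isOpen_orderBox (K : ℕ) (a b : ℕ → ℝ) : IsOpen (orderBox K a b) := by
  have : orderBox K a b = (⋂ k ∈ Iio K, {x : ℕ → ℝ | x k ∈ Ioo (a k) (b k)}) ∩ {x | x K < b K} := by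
    ext; simp [orderBox]
  rw [this]
  exact ((finite_Iio K).isOpen_biInter fun k _ ↦
    isOpen_Ioo.preimage (continuous_apply k)).inter (isOpen_Iio.preimage (continuous_apply K))

/-- The intersection takes the larger of the left endpoints and the smaller of the right ones. A
common point makes the resulting intervals nonempty, and separation is inherited. With `K ≤ K'`, the
longer box also bounds the entry of index `K` from below, where the shorter one does not. -/
lemma isPiSystem_orderBox :
    IsPiSystem {s | ∃ K a b, IsOrderBox K a b ∧ s = orderBox K a b} := by
  have key : ∀ (K K' : ℕ) (a b a' b' : ℕ → ℝ), K ≤ K' → IsOrderBox K a b → IsOrderBox K' a' b' →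
      (orderBox K a b ∩ orderBox K' a' b').Nonempty → orderBox K a b ∩ orderBox K' a' b' ∈
        {s | ∃ K a b, IsOrderBox K a b ∧ s = orderBox K a b} := by
    rintro K K' a b a' b' hK h h' ⟨x, ⟨hx1, hx2⟩, hx1', hx2'⟩
    refine ⟨K', fun k ↦ if k < K then max (a k) (a' k) else a' k,
      fun k ↦ if k ≤ K then min (b k) (b' k) else b' k, ⟨fun k hk ↦ ?_, fun k hk ↦ ?_, ?_⟩, ?_⟩
    · have h1 := hx1' k hk
      rcases lt_trichotomy k K with hkK | rfl | hkK
      · have h2 := hx1 k hkK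
        simp only [hkK, hkK.le, if_true, max_lt_iff, lt_min_iff]
        exact ⟨⟨h2.1.trans h2.2, h1.1.trans h2.2⟩, h2.1.trans h1.2, h1.1.trans h1.2⟩
      · simp only [lt_irrefl, le_refl, if_true, if_false, lt_min_iff]
        exact ⟨h1.1.trans hx2, h1.1.trans h1.2⟩
      · simp only [hkK.not_gt, hkK.not_ge, if_false]
        exact h1.1.trans h1.2
    · have h1 := h'.succ_lt k hk
      by_cases hkK : k < K
      · have h2 := h.succ_lt k hkK
        simp only [hkK, Nat.succ_le_of_lt hkK, if_true]
        exact lt_of_le_of_lt (min_le_left _ _) (h2.trans_le (le_max_left _ _))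
      · have : ¬ (k + 1 ≤ K) := by omega
        simp only [hkK, this, if_false]
        exact h1
    · rcases hK.eq_or_lt with rfl | hlt
      · simpa using ⟨h.last_pos, h'.last_pos⟩
      · simpa [hlt.not_ge] using h'.last_pos
    · ext y
      simp only [orderBox, mem_inter_iff, mem_ofPred_eq]
      constructor
      · rintro ⟨⟨h1, h2⟩, h1', h2'⟩
        refine ⟨fun k hk ↦ ?_, ?_⟩
        · have h3 := h1' k hk
          rcases lt_trichotomy k K with hkK | rfl | hkK
          · have h4 := h1 k hkK
            simp [hkK, hkK.le, h3, h4]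
          · simp [h2, h3]
          · simp [hkK.not_gt, hkK.not_ge, h3]
        · rcases hK.eq_or_lt with rfl | hlt
          · simp [h2, h2']
          · simp [hlt.not_ge, h2']
      · rintro ⟨h1, h2⟩
        refine ⟨⟨fun k hk ↦ ?_, ?_⟩, fun k hk ↦ ?_, ?_⟩
        · have := h1 k (by omega)
          simp only [hk, hk.le, if_true, max_lt_iff, lt_min_iff] at this
          exact ⟨this.1.1, this.2.1⟩
        · rcases hK.eq_or_lt with rfl | hlt
          · simp only [le_refl, if_true, lt_min_iff] at h2
            exact h2.1
          · have := h1 K hlt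
            simp only [le_refl, if_true, lt_min_iff] at this
            exact this.2.1
        · have := h1 k hk
          refine ⟨lt_of_le_of_lt ?_ this.1, this.2.trans_le ?_⟩
          · split_ifs
            · exact le_max_right _ _
            · exact le_rfl
          · split_ifs
            · exact min_le_right _ _
            · exact le_rfl
        · refine h2.trans_le ?_
          split_ifs
          · exact min_le_right _ _
          · exact le_rfl
  rintro _ ⟨K, a, b, h, rfl⟩ _ ⟨K', a', b', h', rfl⟩ hne
  rcases le_total K K' with hK | hK
  · exact key K K' a b a' b' hK h h' hne
  · rw [inter_comm] at hne ⊢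
    exact key K' K a' b' a b hK h' h hne

/-- A basic neighbourhood constrains finitely many entries. Consecutive entries have positive gaps,
so sufficiently narrow intervals around the first `K` of them are separated. -/
lemma exists_orderBox_subset {G : Set (ℕ → ℝ)} (hG : IsOpen G) {x : ℕ → ℝ} (hxG : x ∈ G)
    (hx : StrictAnti x) (hpos : ∀ i, 0 < x i) :
    ∃ K a b, IsOrderBox K a b ∧ x ∈ orderBox K a b ∧ orderBox K a b ⊆ G := by
  obtain ⟨I, u, hu, hIG⟩ := isOpen_pi_iff.1 hG x hxG
  obtain ⟨K, hK⟩ : ∃ K, ∀ i ∈ I, i < K := ⟨I.sup id + 1, fun i hi ↦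
    Nat.lt_succ_of_le (Finset.le_sup (f := id) hi)⟩
  have h1 : ∀ᶠ η in 𝓝[>] (0 : ℝ), ∀ i ∈ I, Ioo (x i - η) (x i + η) ⊆ u i := by
    refine (Filter.eventually_all_finset I).2 fun i hi ↦ ?_
    obtain ⟨ε, hε, hb⟩ := Metric.isOpen_iff.1 (hu i hi).1 _ (hu i hi).2
    filter_upwards [Ioo_mem_nhdsGT hε] with η hη
    rw [← Real.ball_eq_Ioo]
    exact (Metric.ball_subset_ball hη.2.le).trans hb
  have h2 : ∀ᶠ η in 𝓝[>] (0 : ℝ), ∀ k ∈ Finset.range K, 2 * η < x k - x (k + 1) := by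
    refine (Filter.eventually_all_finset _).2 fun k _ ↦ ?_
    have : 0 < x k - x (k + 1) := sub_pos.2 (hx k.lt_succ_self)
    filter_upwards [Ioo_mem_nhdsGT (half_pos this)] with η hη
    linarith [hη.2]
  obtain ⟨η, ⟨h1, h2⟩, hη⟩ := ((h1.and h2).and self_mem_nhdsWithin).exists
  have hη : 0 < η := hη
  refine ⟨K, fun k ↦ x k - η, fun k ↦ x k + η, ⟨fun k _ ↦ by linarith, fun k hk ↦ ?_, ?_⟩,
    ⟨fun k _ ↦ ⟨by linarith, by linarith⟩, by linarith⟩, fun y hy ↦ hIG fun i hi ↦ ?_⟩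
  · have := h2 k (Finset.mem_range.2 hk)
    linarith
  · have := hpos K
    linarith
  · exact h1 i hi (hy.1 i (hK i hi))

/-- Weak convergence of laws of sequences follows from the convergence of the probabilities of
order boxes, if the limit is carried by the strictly decreasing positive sequences. -/
lemma tendsto_of_tendsto_orderBox {ι : Type*} {l : Filter ι} [l.IsCountablyGenerated]
    {μs : ι → ProbabilityMeasure (ℕ → ℝ)} {μ : ProbabilityMeasure (ℕ → ℝ)}
    (hμ : ∀ᵐ x ∂(μ : Measure (ℕ → ℝ)), StrictAnti x ∧ ∀ i, 0 < x i)
    (h : ∀ K a b, IsOrderBox K a b → Tendsto (fun i ↦ μs i (orderBox K a b)) l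
      (𝓝 (μ (orderBox K a b)))) :
    Tendsto μs l (𝓝 μ) := by
  rcases l.eq_or_neBot with rfl | hl
  · simp
  apply tendsto_of_forall_isOpen_le_liminf
  intro G hG
  refine (le_liminf_iff (isCoboundedUnder_ge_of_le (x := 1) l (by simp)) (by isBoundedDefault)).2
    (fun r hr ↦ ?_)
  set B : Set (Set (ℕ → ℝ)) := {s | ∃ K a b, IsOrderBox K a b ∧ s = orderBox K a b} with hB
  have hBo : ∀ s ∈ B, IsOpen s := by
    rintro _ ⟨K, a, b, -, rfl⟩; exact isOpen_orderBox K a b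
  -- By the Lindelöf property, countably many boxes inside `G` fill it up to a null set of the
  -- limit. Finitely many of them already have mass above `r`, and on finite unions the π-system
  -- property gives convergence.
  obtain ⟨T, hTc, hTB, hTU⟩ := TopologicalSpace.isOpen_sUnion_countable {s | s ∈ B ∧ s ⊆ G}
    fun s hs ↦ hBo s hs.1
  have hTG : ⋃₀ T ⊆ G := sUnion_subset fun s hs ↦ (hTB hs).2
  have hle : (μ : Measure (ℕ → ℝ)) G ≤ (μ : Measure (ℕ → ℝ)) (⋃₀ T) := by
    refine measure_mono_ae ?_
    filter_upwards [hμ] with x hx hxG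
    obtain ⟨K, a, b, hb, hxb, hbG⟩ := exists_orderBox_subset hG hxG hx.1 hx.2
    rw [hTU]
    exact ⟨_, ⟨⟨K, a, b, hb, rfl⟩, hbG⟩, hxb⟩
  have hlt : (r : ℝ≥0∞) < (μ : Measure (ℕ → ℝ)) (⋃₀ T) := by
    refine lt_of_lt_of_le ?_ hle
    rw [← ProbabilityMeasure.ennreal_coeFn_eq_coeFn_toMeasure]
    exact_mod_cast hr
  have hne : T.Nonempty := by
    rw [nonempty_iff_ne_empty]
    rintro rfl
    simp at hlt
  obtain ⟨f, hf⟩ := hTc.exists_eq_range hne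
  rw [hf, sUnion_range] at hlt
  have hacc := (tendsto_measure_iUnion_accumulate (μ := (μ : Measure (ℕ → ℝ))) (f := f))
  obtain ⟨n, hn⟩ := ((tendsto_order.1 hacc).1 _ hlt).exists
  classical
  set F : Finset (Set (ℕ → ℝ)) := (Finset.range (n + 1)).image f with hF
  have hFU : ⋃ s ∈ F, s = accumulate f n := by
    simp [hF, accumulate_def]
  have hFT : ∀ s ∈ F, s ∈ T := by
    intro s hs
    obtain ⟨i, -, rfl⟩ := Finset.mem_image.1 hs
    exact hf ▸ mem_range_self i
  have ht := isPiSystem_orderBox.tendsto_probabilityMeasure_biUnion (t := F) (μ := μs) (ν := μ)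
    (l := l) (fun s hs ↦ (hTB (hFT s hs)).1) (fun s hs ↦ (hBo s hs).measurableSet)
    (by rintro _ ⟨K, a, b, hb, rfl⟩; exact h K a b hb)
  rw [hFU] at ht
  have hn' : r < μ (accumulate f n) := by
    rw [← ProbabilityMeasure.ennreal_coeFn_eq_coeFn_toMeasure] at hn
    exact_mod_cast hn
  filter_upwards [(tendsto_order.1 ht).1 r hn'] with i hi
  refine hi.trans_le (ProbabilityMeasure.apply_mono _ ?_)
  rw [← hFU]
  exact iUnion₂_subset fun s hs ↦ (hTB (hFT s hs)).2

/-! ### Independent variables distributed over disjoint cells. -/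

/-- The probability that, among `n` independent variables with law `ρ`, exactly one falls in each
of the disjoint sets `J k` and all others in the set `C`. -/
lemma measure_exists_embedding {Ω : Type*} [MeasurableSpace Ω] {P : Measure Ω}
    {n K : ℕ} {D : Fin n → Ω → ℝ} (hD : ∀ i, Measurable (D i)) (hI : iIndepFun D P) {ρ : Measure ℝ}
    (hρ : ∀ i, P.map (D i) = ρ) {J : Fin K → Set ℝ} (hJ : ∀ k, MeasurableSet (J k))
    (hJd : Pairwise (Function.onFun Disjoint J)) {C : Set ℝ} (hC : MeasurableSet C)
    (hJC : ∀ k, Disjoint (J k) C) :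
    P {ω | ∃ σ : Fin K ↪ Fin n, (∀ k, D (σ k) ω ∈ J k) ∧ ∀ i ∉ range σ, D i ω ∈ C} =
      n.descFactorial K * (∏ k, ρ (J k)) * ρ C ^ (n - K) := by
  classical
  set s : (Fin K ↪ Fin n) → Fin n → Set ℝ := fun σ ↦ Function.extend σ J (fun _ ↦ C) with hs
  have hσ1 : ∀ (σ : Fin K ↪ Fin n) k, s σ (σ k) = J k := fun σ k ↦ σ.injective.extend_apply _ _ _
  have hσ2 : ∀ (σ : Fin K ↪ Fin n), ∀ i ∉ range σ, s σ i = C := fun σ i hi ↦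
    Function.extend_apply' _ _ _ (by simpa using hi)
  have hsm : ∀ σ i, MeasurableSet (s σ i) := by
    intro σ i
    by_cases hi : i ∈ range σ
    · obtain ⟨k, rfl⟩ := hi
      rw [hσ1]; exact hJ k
    · rw [hσ2 σ i hi]; exact hC
  have hE : {ω | ∃ σ : Fin K ↪ Fin n, (∀ k, D (σ k) ω ∈ J k) ∧ ∀ i ∉ range σ, D i ω ∈ C} =
      ⋃ σ : Fin K ↪ Fin n, ⋂ i ∈ Finset.univ, D i ⁻¹' s σ i := by
    ext ω
    simp only [mem_ofPred_eq, mem_iUnion, Finset.mem_univ, iInter_true, mem_iInter, mem_preimage]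
    refine exists_congr fun σ ↦ ⟨fun h i ↦ ?_, fun h ↦ ⟨fun k ↦ ?_, fun i hi ↦ ?_⟩⟩
    · by_cases hi : i ∈ range σ
      · obtain ⟨k, rfl⟩ := hi
        rw [hσ1]; exact h.1 k
      · rw [hσ2 σ i hi]; exact h.2 i hi
    · have := h (σ k); rwa [hσ1] at this
    · have := h i; rwa [hσ2 σ i hi] at this
  -- The cells and `C` are disjoint, so the values determine which variable occupies each cell, and
  -- `σ` can be recovered.
  have hdisj : Pairwise (Function.onFun Disjoint
      fun σ : Fin K ↪ Fin n ↦ ⋂ i ∈ Finset.univ, D i ⁻¹' s σ i) := by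
    intro σ τ hne
    refine disjoint_left.2 fun ω hωσ hωτ ↦ hne ?_
    simp only [Finset.mem_univ, iInter_true, mem_iInter, mem_preimage] at hωσ hωτ
    ext k
    have h1 := hωσ (σ k)
    have h2 := hωτ (σ k)
    rw [hσ1] at h1
    by_cases hi : σ k ∈ range τ
    · obtain ⟨j, hj⟩ := hi
      rw [← hj, hσ1, hj] at h2
      have : k = j := by
        by_contra hkj
        exact disjoint_left.1 (hJd hkj) h1 h2
      rw [this] at hj ⊢
      rw [hj]
    · rw [hσ2 τ _ hi] at h2
      exact absurd h2 (disjoint_left.1 (hJC k) h1)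
  rw [hE, measure_iUnion hdisj fun σ ↦ Finset.univ.measurableSet_biInter fun i _ ↦ hD i (hsm σ i)]
  have hP : ∀ σ : Fin K ↪ Fin n, P (⋂ i ∈ Finset.univ, D i ⁻¹' s σ i) =
      (∏ k, ρ (J k)) * ρ C ^ (n - K) := by
    intro σ
    rw [hI.measure_inter_preimage_eq_mul Finset.univ fun i _ ↦ hsm σ i]
    have : ∀ i, P (D i ⁻¹' s σ i) = ρ (s σ i) := fun i ↦ by
      rw [← hρ i, Measure.map_apply (hD i) (hsm σ i)]
    simp_rw [this]
    rw [← Finset.prod_mul_prod_compl (Finset.univ.map σ)]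
    congr 1
    · rw [Finset.prod_map]
      exact Finset.prod_congr rfl fun k _ ↦ by rw [hσ1]
    · rw [Finset.prod_congr rfl (g := fun _ ↦ ρ C), Finset.prod_const, Finset.card_compl,
        Finset.card_map, Finset.card_univ, Fintype.card_fin, Fintype.card_fin]
      intro i hi
      rw [hσ2]
      simpa using hi
  simp_rw [hP]
  rw [tsum_fintype, Finset.sum_const, Finset.card_univ, Fintype.card_embedding_eq,
    Fintype.card_fin, Fintype.card_fin, nsmul_eq_mul, mul_assoc]

/-- Bridge between the two descriptions of a box: occupied cells, whose probability is computable,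
and counts above levels, which can be compared with flights. -/
lemma IsOrderBox.exists_embedding_iff {K : ℕ} {a b : ℕ → ℝ} (h : IsOrderBox K a b) {n : ℕ}
    (d : Fin n → ℝ) :
    (∃ σ : Fin K ↪ Fin n, (∀ k : Fin K, d (σ k) ∈ Ioo (a k) (b k)) ∧ ∀ i ∉ range σ, d i ∈ Iio (b K)) ↔
      (∀ k < K, k + 1 ≤ {i | a k < d i}.ncard) ∧ ∀ k ≤ K, {i | b k ≤ d i}.ncard ≤ k := by
  classical
  constructor
  · rintro ⟨σ, h1, h2⟩
    have hcard : ∀ (s : Finset (Fin K)), (σ '' s).ncard = s.card := fun s ↦ by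
      rw [ncard_image_of_injective _ σ.injective, ncard_coe_finset]
    refine ⟨fun k hk ↦ ?_, fun k hk ↦ ?_⟩
    · have hsub : σ '' (Finset.Iic (⟨k, hk⟩ : Fin K)) ⊆ {i | a k < d i} := by
        rintro _ ⟨j, hj, rfl⟩
        simp only [Finset.coe_Iic, mem_Iic] at hj
        refine lt_of_le_of_lt ?_ (h1 j).1
        rcases hj.eq_or_lt with rfl | hlt
        · exact le_rfl
        · exact ((h.lt k hk).trans (h.lt_of_lt hlt hk.le)).le
      refine le_trans ?_ (ncard_le_ncard hsub)
      rw [hcard, Fin.card_Iic]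
    · have hsub : {i | b k ≤ d i} ⊆ σ '' (Finset.univ.filter fun j : Fin K ↦ (j : ℕ) < k) := by
        intro i hi
        have hi : b k ≤ d i := hi
        by_cases hir : i ∈ range σ
        · obtain ⟨j, rfl⟩ := hir
          refine ⟨j, ?_, rfl⟩
          simp only [Finset.coe_filter, Finset.mem_univ, true_and, mem_ofPred_eq]
          by_contra hjk
          exact absurd ((h1 j).2.trans_le (h.le_of_le (not_lt.1 hjk) j.2.le)) (not_lt.2 hi)
        · exact absurd ((h2 i hir).trans_le (h.le_of_le hk le_rfl)) (not_lt.2 hi)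
      refine (ncard_le_ncard hsub).trans ?_
      rw [hcard]
      have : (Finset.univ.filter fun j : Fin K ↦ (j : ℕ) < k).map Fin.valEmbedding ⊆
          Finset.range k := by
        intro j
        simp only [Finset.mem_map, Finset.mem_filter, Finset.mem_univ, true_and, Finset.mem_range]
        rintro ⟨i, hi, rfl⟩
        exact hi
      simpa using Finset.card_le_card this
  · rintro ⟨h1, h2⟩
    -- More than `k` values exceed `a k`, but at most `k` reach `b k`.
    have hex : ∀ k : Fin K, ∃ i, d i ∈ Ioo (a k) (b k) := by
      intro k
      have hlt : {i | b k ≤ d i}.ncard < {i | a k < d i}.ncard :=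
        (h2 k k.2.le).trans_lt (h1 k k.2)
      obtain ⟨i, hi1, hi2⟩ := exists_mem_notMem_of_ncard_lt_ncard hlt
      exact ⟨i, hi1, not_le.1 hi2⟩
    choose f hf using hex
    have hlt : ∀ j k : Fin K, j < k → d (f k) < d (f j) := fun j k hjk ↦
      ((hf k).2.trans (h.lt_of_lt (j := j) (k := k) hjk k.2.le)).trans (hf j).1
    have hinj : Function.Injective f := by
      intro j k hjk
      rcases lt_trichotomy j k with hl | rfl | hl
      · exact absurd (hjk ▸ hlt j k hl) (lt_irrefl _)
      · rfl
      · exact absurd (hjk ▸ hlt k j hl) (lt_irrefl _)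
    refine ⟨⟨f, hinj⟩, hf, fun i hi ↦ ?_⟩
    by_contra hbi
    have hbi : b K ≤ d i := not_lt.1 hbi
    have hi : i ∉ range f := hi
    -- A further value reaching `b K` would make `K + 1` of them.
    have hsub : insert i (range f) ⊆ {i | b K ≤ d i} := by
      rintro _ (rfl | ⟨k, rfl⟩)
      · exact hbi
      · exact ((h.lt_of_lt k.2 le_rfl).trans (hf k).1).le
    have := ncard_le_ncard hsub
    rw [ncard_insert_of_notMem hi, ← image_univ, ncard_image_of_injective _ hinj, ncard_univ,
      Nat.card_fin] at this
    have := h2 K le_rfl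
    omega

/-! ### Flights of a monotone path seen through grid increments. -/

/-- The `i`-th increment of `f` over the regular partition of `[0, T]` into `n` intervals. -/
noncomputable def gridIncrement (f : ℝ≥0 → ℝ) (T : ℝ≥0) (n : ℕ) (i : Fin n) : ℝ :=
  f (T * (i + 1) / n) - f (T * i / n)

section Path
variable {f : ℝ≥0 → ℝ} {T : ℝ≥0}

lemma flight_zero : flight f 0 = 0 := by
  rw [flight, leftLim_eq_of_isBot fun _ ↦ zero_le, sub_self]

lemma flight_le_sub (hf : Monotone f) {u s v : ℝ≥0} (hus : u < s) (hsv : s ≤ v) :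
    flight f s ≤ f v - f u :=
  sub_le_sub (hf hsv) (hf.le_leftLim hus)

lemma exists_grid_interval {n : ℕ} (hn : 0 < n) {s : ℝ≥0} (hs : 0 < s) (hsT : s ≤ T) :
    ∃ i : Fin n, T * i / n < s ∧ s ≤ T * (i + 1) / n := by
  have hT : 0 < T := hs.trans_le hsT
  have hn' : (0 : ℝ≥0) < n := by exact_mod_cast hn
  have hpos : 0 < n * s / T := by positivity
  -- The interval is half-open on the left, so its number is `⌈n s / T⌉ - 1`.
  have hc : 0 < ⌈n * s / T⌉₊ := Nat.ceil_pos.2 hpos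
  obtain ⟨i, hi⟩ := Nat.exists_eq_succ_of_ne_zero hc.ne'
  have hle : ⌈n * s / T⌉₊ ≤ n := Nat.ceil_le.2 (by
    rw [div_le_iff₀ hT]; gcongr)
  refine ⟨⟨i, by omega⟩, ?_, ?_⟩
  · have : (i : ℝ≥0) < n * s / T := Nat.lt_ceil.1 (by omega)
    rw [lt_div_iff₀ hT] at this
    rw [div_lt_iff₀ hn', mul_comm T, mul_comm s]
    exact this
  · have := Nat.le_ceil (n * s / T)
    rw [hi, div_le_iff₀ hT] at this
    rw [le_div_iff₀ hn', mul_comm T, mul_comm s]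
    push_cast at this
    exact this

lemma tendsto_div_natCast_nnreal (T : ℝ≥0) : Tendsto (fun n : ℕ ↦ T / n) atTop (𝓝 0) := by
  have := (tendsto_inv_atTop_nhds_zero_nat (𝕜 := ℝ≥0)).const_mul T
  simpa [div_eq_mul_inv] using this

/-- Every flight is eventually seen by its own grid increment. -/
lemma eventually_card_le_ncard_gridIncrement (hf : Monotone f) {x : ℝ} (hx : 0 ≤ x)
    {F : Finset ℝ≥0} (hF : ∀ s ∈ F, s ≤ T ∧ x < flight f s) :
    ∀ᶠ n : ℕ in atTop, F.card ≤ {i : Fin n | x < gridIncrement f T n i}.ncard := by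
  -- Once the mesh is below all the gaps in `F`, distinct flights fall in distinct intervals.
  have hsep : ∀ᶠ n : ℕ in atTop, ∀ s ∈ F, ∀ r ∈ F, s < r → T / n < r - s := by
    refine (Filter.eventually_all_finset F).2 fun s _ ↦ (Filter.eventually_all_finset F).2
      fun r _ ↦ ?_
    by_cases hsr : s < r
    · filter_upwards [(tendsto_order.1 (tendsto_div_natCast_nnreal T)).2 _
        (tsub_pos_of_lt hsr)] with n hn _ using hn
    · exact Eventually.of_forall fun n h ↦ absurd h hsr
  filter_upwards [hsep, eventually_gt_atTop 0] with n hn hn0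
  have hex : ∀ s ∈ F, ∃ i : Fin n, T * i / n < s ∧ s ≤ T * (i + 1) / n := fun s hs ↦ by
    refine exists_grid_interval hn0 (pos_iff_ne_zero.2 ?_) (hF s hs).1
    rintro rfl
    have := (hF 0 hs).2
    rw [flight_zero] at this
    exact absurd this (not_lt.2 hx)
  have : Nonempty (Fin n) := ⟨⟨0, hn0⟩⟩
  choose! g hg using hex
  have hinj : ∀ s ∈ F, ∀ r ∈ F, s < r → g s ≠ g r := by
    intro s hs r hr hsr heq
    have h1 := (hg s hs).1
    have h2 := (hg r hr).2
    rw [← heq] at h2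
    have h3 := hn s hs r hr hsr
    rw [lt_tsub_iff_left] at h3
    have : T * (g s + 1) / n = T * g s / n + T / n := by ring
    rw [this] at h2
    exact absurd (h3.trans_le h2) (not_lt.2 (by gcongr))
  have hinj' : InjOn g F := by
    intro s hs r hr heq
    by_contra hne
    rcases lt_or_gt_of_ne hne with hl | hl
    · exact hinj s hs r hr hl heq
    · exact hinj r hr s hs hl heq.symm
  rw [← ncard_coe_finset, ← hinj'.ncard_image]
  refine ncard_le_ncard ?_
  rintro _ ⟨s, hs, rfl⟩
  exact (hF s hs).2.trans_le (flight_le_sub hf (hg s hs).1 (hg s hs).2)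

lemma sum_gridIncrement (f : ℝ≥0 → ℝ) (T : ℝ≥0) {n : ℕ} (hn : 0 < n) :
    ∑ i, gridIncrement f T n i = f T - f 0 := by
  have h := Finset.sum_range_sub (fun i : ℕ ↦ f (T * i / n)) n
  have hn' : (n : ℝ≥0) ≠ 0 := by exact_mod_cast hn.ne'
  rw [Nat.cast_zero, mul_zero, zero_div, mul_div_assoc, div_self hn', mul_one] at h
  rw [← h, Finset.sum_range]
  simp [gridIncrement]

lemma gridIncrement_nonneg (hf : Monotone f) (n : ℕ) (i : Fin n) : 0 ≤ gridIncrement f T n i := by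
  refine sub_nonneg.2 (hf ?_)
  gcongr
  simp

/-- Infinitely many flights of size `x` would force arbitrarily many grid increments above `x / 2`,
whereas the nonnegative increments sum to `f T - f 0`. -/
lemma finite_flight_ge (hf : Monotone f) {x : ℝ} (hx : 0 < x) :
    {s : ℝ≥0 | s ≤ T ∧ x ≤ flight f s}.Finite := by
  by_contra hinf
  obtain ⟨N, hN⟩ := exists_nat_gt ((f T - f 0) / (x / 2))
  obtain ⟨F, hFs, hFc⟩ := Set.Infinite.exists_subset_card_eq hinf N
  obtain ⟨n, hn, hn0⟩ := ((eventually_card_le_ncard_gridIncrement (T := T) hf (half_pos hx).le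
    (F := F) fun s hs ↦ ⟨(hFs hs).1, (half_lt_self hx).trans_le (hFs hs).2⟩).and
    (eventually_gt_atTop 0)).exists
  classical
  rw [hFc, ncard_eq_toFinset_card'] at hn
  have h1 : ({i : Fin n | x / 2 < gridIncrement f T n i}.toFinset.card : ℝ) * (x / 2) ≤
      f T - f 0 := by
    rw [← sum_gridIncrement f T hn0, ← nsmul_eq_mul]
    refine (Finset.card_nsmul_le_sum _ (gridIncrement f T n) _ fun i hi ↦ ?_).trans
      (Finset.sum_le_univ_sum_of_nonneg (gridIncrement_nonneg hf n))
    simp only [mem_toFinset, mem_ofPred_eq] at hi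
    exact hi.le
  rw [div_lt_iff₀ (half_pos hx)] at hN
  have h2 : (N : ℝ) * (x / 2) ≤ ({i : Fin n | x / 2 < gridIncrement f T n i}.toFinset.card : ℝ) *
    (x / 2) := by gcongr
  linarith

/-- Near `s` the path is close to its left limit on one side and to `f s` on the other. A large
increment over a short interval there must therefore straddle `s` and come from its flight. -/
lemma exists_nhds_increment (hf : Monotone f) (hr : ∀ s, ContinuousWithinAt f (Ici s) s) {x : ℝ}
    (hx : 0 < x) (s : ℝ≥0) : ∃ U : Set ℝ≥0, IsOpen U ∧ s ∈ U ∧ ∀ u ∈ U, ∀ v ∈ U, u < v →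
      x ≤ f v - f u → u < s ∧ s ≤ v ∧ x ≤ flight f s := by
  -- `ε ≤ x` rules out increments on one side of `s`. If the flight is below `x`, half of the
  -- deficit keeps an increment across `s` below `x` as well.
  obtain ⟨ε, hε, hεx, hε2⟩ : ∃ ε > 0, ε ≤ x ∧ (flight f s < x → flight f s + 2 * ε ≤ x) := by
    have h0 : 0 ≤ flight f s := sub_nonneg.2 (hf.leftLim_le le_rfl)
    by_cases h : flight f s < x
    · exact ⟨(x - flight f s) / 2, by linarith, by linarith, fun _ ↦ by linarith⟩
    · exact ⟨x, hx, le_rfl, fun h' ↦ absurd h' h⟩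
  have h1 : ∀ᶠ v in 𝓝 s, v ∈ Ici s → f v < f s + ε :=
    eventually_nhdsWithin_iff.1 ((tendsto_order.1 (hr s)).2 _ (by linarith))
  have h2 : ∀ᶠ v in 𝓝 s, v ∈ Iio s → Function.leftLim f s - ε < f v :=
    eventually_nhdsWithin_iff.1 ((tendsto_order.1 (hf.tendsto_leftLim s)).1 _ (by linarith))
  obtain ⟨U, hU, hUo, hsU⟩ := eventually_nhds_iff.1 (h1.and h2)
  refine ⟨U, hUo, hsU, fun u hu v hv huv hxuv ↦ ?_⟩
  have hu1 : u < s := by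
    by_contra h
    have h3 := (hU v hv).1 ((not_lt.1 h).trans huv.le)
    have h4 := hf (not_lt.1 h)
    linarith
  have hu2 := (hU u hu).2 hu1
  have hv1 : s ≤ v := by
    by_contra h
    have h4 := hf.le_leftLim (not_le.1 h)
    linarith
  have hv2 := (hU v hv).1 hv1
  refine ⟨hu1, hv1, ?_⟩
  by_contra h
  have := hε2 (not_le.1 h)
  rw [flight] at this
  linarith

/-- Eventually, every large grid increment is due to a large flight. -/
lemma eventually_ncard_gridIncrement_le (hf : Monotone f)
    (hr : ∀ s, ContinuousWithinAt f (Ici s) s) {x : ℝ} (hx : 0 < x) :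
    ∀ᶠ n : ℕ in atTop, {i : Fin n | x ≤ gridIncrement f T n i}.ncard ≤
      {s : ℝ≥0 | s ≤ T ∧ x ≤ flight f s}.ncard := by
  choose U hUo hsU hU using fun s ↦ exists_nhds_increment hf hr hx s
  -- A mesh below the Lebesgue number puts each grid interval inside one of the neighbourhoods. The
  -- flight found there lies in the half-open grid interval, so different intervals give different
  -- flights.
  obtain ⟨δ, hδ, hball⟩ := lebesgue_number_lemma_of_metric (isCompact_Icc (a := (0 : ℝ≥0)) (b := T))
    hUo (fun s _ ↦ mem_iUnion.2 ⟨s, hsU s⟩)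
  have hδ' : ∀ᶠ n : ℕ in atTop, T / n < ⟨δ, hδ.le⟩ :=
    (tendsto_order.1 (tendsto_div_natCast_nnreal T)).2 _ (by exact_mod_cast hδ)
  filter_upwards [hδ', eventually_gt_atTop 0] with n hn hn0
  have hn' : (0 : ℝ≥0) < n := by exact_mod_cast hn0
  have hstep : ∀ i : Fin n, T * (i + 1) / n = T * i / n + T / n := fun i ↦ by ring
  have hex : ∀ i ∈ {i : Fin n | x ≤ gridIncrement f T n i}, ∃ s,
      T * i / n < s ∧ s ≤ T * (i + 1) / n ∧ x ≤ flight f s := by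
    intro i hi
    have hi : x ≤ gridIncrement f T n i := hi
    have huT : T * i / n ≤ T := by
      rw [div_le_iff₀ hn']
      gcongr
      exact_mod_cast i.2.le
    obtain ⟨s, hs⟩ := hball _ ⟨zero_le, huT⟩
    have hT : 0 < T := by
      rw [pos_iff_ne_zero]
      rintro rfl
      simp [gridIncrement] at hi
      linarith
    have hv : T * (i + 1) / n ∈ Metric.ball (T * i / n) δ := by
      rw [Metric.mem_ball, hstep, NNReal.dist_eq]
      push_cast
      rw [add_sub_cancel_left, abs_of_nonneg (by positivity)]
      exact_mod_cast hn
    refine ⟨s, hU s _ (hs (Metric.mem_ball_self hδ)) _ (hs hv) ?_ hi⟩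
    rw [hstep]
    exact lt_add_of_pos_right _ (by positivity)
  choose! g hg using hex
  have hinj : ∀ i ∈ {i : Fin n | x ≤ gridIncrement f T n i},
      ∀ j ∈ {i : Fin n | x ≤ gridIncrement f T n i}, i < j → g i ≠ g j := by
    intro i hi j hj hij heq
    have h1 := (hg i hi).2.1
    have h2 := (hg j hj).1
    rw [← heq] at h2
    have h3 : T * (i + 1) / n ≤ T * j / n := by
      gcongr
      exact_mod_cast hij
    exact absurd (h2.trans_le (h1.trans h3)) (lt_irrefl _)
  refine ncard_le_ncard_of_injOn g (fun i hi ↦ ⟨(hg i hi).2.1.trans ?_, (hg i hi).2.2⟩) ?_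
    (finite_flight_ge hf hx)
  · rw [div_le_iff₀ hn']
    gcongr
    exact_mod_cast i.2
  · intro i hi j hj heq
    by_contra hne
    rcases lt_or_gt_of_ne hne with hl | hl
    · exact hinj i hi j hj hl heq
    · exact hinj j hj i hi hl heq.symm

lemma bddAbove_orderFlight (hf : Monotone f) {m : ℕ} (hm : 1 ≤ m) :
    BddAbove {x : ℝ | 0 < x ∧ (m : ℕ∞) ≤ {s : ℝ≥0 | s ≤ T ∧ x ≤ flight f s}.encard} := by
  refine ⟨f T - f 0, fun x hx ↦ ?_⟩
  have hne : {s : ℝ≥0 | s ≤ T ∧ x ≤ flight f s}.Nonempty := by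
    rw [← one_le_encard_iff_nonempty]
    exact le_trans (by exact_mod_cast hm) hx.2
  obtain ⟨s, hsT, hs⟩ := hne
  have hs0 : 0 < s := by
    rw [pos_iff_ne_zero]
    rintro rfl
    rw [flight_zero] at hs
    exact absurd hx.1 (not_lt.2 hs)
  exact hs.trans (flight_le_sub hf hs0 hsT)

lemma orderFlight_nonneg (m : ℕ) : 0 ≤ orderFlight f m T :=
  Real.sSup_nonneg fun _ hx ↦ hx.1.le

/-- A level strictly between `y` and the supremum is exceeded by `m` flights. Choosing it rational
reduces the later measurability argument to a countable union. -/
lemma lt_orderFlight_iff (hf : Monotone f) {m : ℕ} (hm : 1 ≤ m) {y : ℝ} (hy : 0 ≤ y) :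
    y < orderFlight f m T ↔
      ∃ F : Finset ℝ≥0, F.card = m ∧ ∃ q : ℚ, y < q ∧ ∀ s ∈ F, s ≤ T ∧ q < flight f s := by
  constructor
  · intro h
    have hne : {x : ℝ | 0 < x ∧ (m : ℕ∞) ≤ {s : ℝ≥0 | s ≤ T ∧ x ≤ flight f s}.encard}.Nonempty := by
      rw [nonempty_iff_ne_empty]
      intro he
      rw [orderFlight, he, Real.sSup_empty] at h
      exact absurd h (not_lt.2 hy)
    obtain ⟨x, ⟨hx0, hx⟩, hyx⟩ := exists_lt_of_lt_csSup hne h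
    obtain ⟨F, hFs, hF⟩ := exists_subset_encard_eq hx
    have hfin : F.Finite := finite_of_encard_eq_coe hF
    obtain ⟨q, hq1, hq2⟩ := exists_rat_btwn hyx
    refine ⟨hfin.toFinset, ?_, q, hq1, fun s hs ↦ ?_⟩
    · rw [hfin.encard_eq_coe_toFinset_card] at hF
      exact_mod_cast hF
    · have := hFs (hfin.mem_toFinset.1 hs)
      exact ⟨this.1, hq2.trans_le this.2⟩
  · rintro ⟨F, hF, q, hq, h⟩
    refine hq.trans_le (le_csSup (bddAbove_orderFlight hf hm) ⟨hy.trans_lt hq, ?_⟩)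
    rw [← hF, ← encard_coe_eq_coe_finsetCard]
    exact encard_le_encard fun s hs ↦ ⟨(h s hs).1, (h s hs).2.le⟩

lemma le_orderFlight (hf : Monotone f) {m : ℕ} (hm : 1 ≤ m) {y : ℝ} (hy : 0 < y)
    (h : m ≤ {s : ℝ≥0 | s ≤ T ∧ y ≤ flight f s}.ncard) : y ≤ orderFlight f m T := by
  refine le_csSup (bddAbove_orderFlight hf hm) ⟨hy, ?_⟩
  rw [← (finite_flight_ge hf hy).cast_ncard_eq]
  exact_mod_cast h

/-- The order flights exceed a level if and only if sufficiently many grid increments do. -/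
lemma lt_orderFlight_iff_gridIncrement (hf : Monotone f)
    (hr : ∀ s, ContinuousWithinAt f (Ici s) s) {m : ℕ} (hm : 1 ≤ m) {y : ℝ} (hy : 0 ≤ y) :
    y < orderFlight f m T ↔ ∃ q : ℚ, y < q ∧ ∀ᶠ n : ℕ in atTop,
      m ≤ {i : Fin n | q < gridIncrement f T n i}.ncard := by
  constructor
  · intro h
    obtain ⟨F, hF, q, hq, h⟩ := (lt_orderFlight_iff hf hm hy).1 h
    exact ⟨q, hq, hF ▸ eventually_card_le_ncard_gridIncrement hf (hy.trans hq.le) h⟩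
  · rintro ⟨q, hq, h⟩
    have hq0 := hy.trans_lt hq
    obtain ⟨n, h1, h2⟩ := (h.and (eventually_ncard_gridIncrement_le (T := T) hf hr hq0)).exists
    refine hq.trans_le (le_orderFlight hf hm hq0 (h1.trans ((ncard_le_ncard ?_).trans h2)))
    intro i hi
    simp only [mem_ofPred_eq] at hi ⊢
    exact hi.le

/-- If the order flights lie in an order box, then eventually so do the ordered grid increments. -/
lemma eventually_gridIncrement_of_mem_orderBox (hf : Monotone f)
    (hr : ∀ s, ContinuousWithinAt f (Ici s) s) {K : ℕ} {a b : ℕ → ℝ} (hb : IsOrderBox K a b)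
    (h : (fun i ↦ orderFlight f (i + 1) T) ∈ orderBox K a b) :
    ∀ᶠ n : ℕ in atTop, (∀ k < K, k + 1 ≤ {i : Fin n | a k < gridIncrement f T n i}.ncard) ∧
      ∀ k ≤ K, {i : Fin n | b k ≤ gridIncrement f T n i}.ncard ≤ k := by
  refine Filter.Eventually.and ?_ ?_
  · refine (Filter.eventually_all_finite (finite_Iio K)).2 fun k hk ↦ ?_
    obtain ⟨F, hF, q, hq, hFq⟩ := (lt_orderFlight_iff hf (by omega) (hb.left_pos hk).le).1
      (h.1 k hk).1
    exact hF ▸ eventually_card_le_ncard_gridIncrement hf (hb.left_pos hk).le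
      fun s hs ↦ ⟨(hFq s hs).1, hq.trans (hFq s hs).2⟩
  · refine (Filter.eventually_all_finite (finite_Iic K)).2 fun k hk ↦ ?_
    filter_upwards [eventually_ncard_gridIncrement_le (T := T) hf hr (hb.pos hk)] with n hn
    refine hn.trans ?_
    by_contra hlt
    have h1 := le_orderFlight hf (m := k + 1) (by omega) (hb.pos hk) (not_le.1 hlt)
    have h2 : orderFlight f (k + 1) T < b k := by
      rcases (show k ≤ K from hk).eq_or_lt with rfl | hkK
      · exact h.2
      · exact (h.1 k hkK).2
    linarith

/-- If the ordered grid increments frequently lie in an order box, then the order flights lie in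
the interior of every larger box. -/
lemma mem_orderBox_of_frequently_gridIncrement (hf : Monotone f)
    (hr : ∀ s, ContinuousWithinAt f (Ici s) s) {K : ℕ} {a b a' b' : ℕ → ℝ}
    (hb' : IsOrderBox K a' b') (ha : ∀ k < K, a k < a' k) (hbb : ∀ k ≤ K, b' k < b k)
    (h : ∃ᶠ n : ℕ in atTop, (∀ k < K, k + 1 ≤ {i : Fin n | a' k < gridIncrement f T n i}.ncard) ∧
      ∀ k ≤ K, {i : Fin n | b' k ≤ gridIncrement f T n i}.ncard ≤ k) :
    (fun i ↦ orderFlight f (i + 1) T) ∈ orderBox K a b := by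
  have hup : ∀ k ≤ K, orderFlight f (k + 1) T < b k := by
    intro k hk
    refine lt_of_not_ge fun hle ↦ ?_
    obtain ⟨F, hF, q, hq, hFq⟩ := (lt_orderFlight_iff hf (m := k + 1) (by omega) (hb'.pos hk).le).1
      ((hbb k hk).trans_le hle)
    obtain ⟨n, hn, hn'⟩ := (h.and_eventually (eventually_card_le_ncard_gridIncrement (T := T) hf
      ((hb'.pos hk).le.trans hq.le) hFq)).exists
    have h1 := hn.2 k hk
    have h2 : {i : Fin n | q < gridIncrement f T n i}.ncard ≤
        {i : Fin n | b' k ≤ gridIncrement f T n i}.ncard :=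
      ncard_le_ncard fun i hi ↦ (hq.trans hi).le
    omega
  refine ⟨fun k hk ↦ ⟨(ha k hk).trans_le ?_, hup k hk.le⟩, hup K le_rfl⟩
  obtain ⟨n, hn, hn'⟩ := (h.and_eventually (eventually_ncard_gridIncrement_le (T := T) hf hr
    (hb'.left_pos hk))).exists
  refine le_orderFlight hf (by omega) (hb'.left_pos hk) ((hn.1 k hk).trans (le_trans ?_ hn'))
  refine ncard_le_ncard fun i hi ↦ ?_
  simp only [mem_ofPred_eq] at hi ⊢
  exact hi.le

end Path

/-! ### From Laplace exponents to tails. -/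

/-- A measure on `[0, ∞)` that integrates `1 - exp (-x)`. -/
structure IsLevyLike (m : Measure ℝ) : Prop where
  ae_nonneg : ∀ᵐ x ∂m, 0 ≤ x
  integrable : Integrable (fun x ↦ 1 - Real.exp (-x)) m

namespace IsLevyLike
variable {m : Measure ℝ}

lemma integrable_mul (h : IsLevyLike m) {g : ℝ → ℝ} (hg : Continuous g) :
    Integrable (fun x ↦ g (Real.exp (-x)) * (1 - Real.exp (-x))) m := by
  obtain ⟨C, hC⟩ := (isCompact_Icc (a := (0 : ℝ)) (b := 1)).exists_bound_of_continuousOn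
    hg.continuousOn
  refine h.integrable.bdd_mul (c := C) (Continuous.aestronglyMeasurable (by fun_prop)) ?_
  filter_upwards [h.ae_nonneg] with x hx
  exact hC _ ⟨(Real.exp_pos _).le, Real.exp_le_one_iff.2 (by linarith)⟩

lemma abs_integral_mul_sub_le (h : IsLevyLike m) {g p : ℝ → ℝ} (hg : Continuous g)
    (hp : Continuous p) {ε : ℝ} (hgp : ∀ s ∈ Icc (0 : ℝ) 1, |p s - g s| ≤ ε) :
    |∫ x, p (Real.exp (-x)) * (1 - Real.exp (-x)) ∂m -
      ∫ x, g (Real.exp (-x)) * (1 - Real.exp (-x)) ∂m| ≤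
      ε * ∫ x, (1 - Real.exp (-x)) ∂m := by
  rw [← integral_sub (h.integrable_mul hp) (h.integrable_mul hg), ← integral_const_mul,
    ← Real.norm_eq_abs]
  refine norm_integral_le_of_norm_le (h.integrable.const_mul ε) ?_
  filter_upwards [h.ae_nonneg] with x hx
  have h1 : Real.exp (-x) ≤ 1 := Real.exp_le_one_iff.2 (by linarith)
  rw [← sub_mul, norm_mul, Real.norm_eq_abs, Real.norm_of_nonneg (sub_nonneg.2 h1)]
  exact mul_le_mul_of_nonneg_right (hgp _ ⟨(Real.exp_pos _).le, h1⟩) (sub_nonneg.2 h1)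

lemma integrable_one_sub_exp (h : IsLevyLike m) (j : ℕ) :
    Integrable (fun x ↦ 1 - Real.exp (-(j * x))) m := by
  refine (h.integrable_mul (g := fun s ↦ ∑ i ∈ Finset.range j, s ^ i) (by fun_prop)).congr
    (ae_of_all _ fun x ↦ ?_)
  simp only
  rw [geom_sum_mul_neg, ← Real.exp_nat_mul, mul_neg]

/-- The weight `1 - exp (-x)` makes `m` finite, and the moments of `exp (-x)` under it are
differences of Laplace exponents at consecutive integers. -/
lemma integral_pow_mul (h : IsLevyLike m) (j : ℕ) :
    ∫ x, Real.exp (-x) ^ j * (1 - Real.exp (-x)) ∂m =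
      ∫ x, (1 - Real.exp (-(((j + 1 : ℕ) : ℝ) * x))) ∂m - ∫ x, (1 - Real.exp (-(j * x))) ∂m := by
  rw [← integral_sub (h.integrable_one_sub_exp _) (h.integrable_one_sub_exp _)]
  refine integral_congr_ae (ae_of_all _ fun x ↦ ?_)
  simp only
  rw [← mul_neg, ← mul_neg, Real.exp_nat_mul, Real.exp_nat_mul]
  ring

end IsLevyLike

section Vague
variable {κs : ℕ → Measure ℝ} {κ : Measure ℝ} {D : ℝ}

/-- Each monomial is a difference of two exponents. The linear term contributes `D * (j + 1) - D * j
= D`, so the drift acts like a point mass at `exp (-x) = 1`. -/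
lemma tendsto_integral_eval_of_laplace (hs : ∀ᶠ n in atTop, IsLevyLike (κs n)) (hκ : IsLevyLike κ)
    (hlim : ∀ j : ℕ, Tendsto (fun n ↦ ∫ x, (1 - Real.exp (-(j * x))) ∂κs n) atTop
      (𝓝 (D * j + ∫ x, (1 - Real.exp (-(j * x))) ∂κ))) (p : Polynomial ℝ) :
    Tendsto (fun n ↦ ∫ x, p.eval (Real.exp (-x)) * (1 - Real.exp (-x)) ∂κs n) atTop
      (𝓝 (D * p.eval 1 + ∫ x, p.eval (Real.exp (-x)) * (1 - Real.exp (-x)) ∂κ)) := by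
  induction p using Polynomial.induction_on' with
  | add p q hp hq =>
    have hadd : ∀ m : Measure ℝ, IsLevyLike m →
        ∫ x, (p + q).eval (Real.exp (-x)) * (1 - Real.exp (-x)) ∂m =
        ∫ x, p.eval (Real.exp (-x)) * (1 - Real.exp (-x)) ∂m +
          ∫ x, q.eval (Real.exp (-x)) * (1 - Real.exp (-x)) ∂m := fun m hm ↦ by
      rw [← integral_add (hm.integrable_mul p.continuous) (hm.integrable_mul q.continuous)]
      simp only [Polynomial.eval_add, add_mul]
    rw [hadd κ hκ]
    have := hp.add hq
    refine Tendsto.congr' (hs.mono fun n hn ↦ (hadd _ hn).symm) ?_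
    convert this using 2
    rw [Polynomial.eval_add]; ring
  | monomial j c =>
    have hmon : ∀ m : Measure ℝ, IsLevyLike m →
        ∫ x, (Polynomial.monomial j c).eval (Real.exp (-x)) * (1 - Real.exp (-x)) ∂m =
        c * (∫ x, (1 - Real.exp (-(((j + 1 : ℕ) : ℝ) * x))) ∂m -
          ∫ x, (1 - Real.exp (-(j * x))) ∂m) := fun m hm ↦ by
      rw [← hm.integral_pow_mul, ← integral_const_mul]
      simp only [Polynomial.eval_monomial, mul_assoc]
    rw [hmon κ hκ]
    have := ((hlim (j + 1)).sub (hlim j)).const_mul c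
    refine Tendsto.congr' (hs.mono fun n hn ↦ (hmon _ hn).symm) ?_
    convert this using 2
    rw [Polynomial.eval_monomial]; push_cast; ring

/-- Weierstrass approximation on `[0, 1]`, with weighted masses eventually bounded because the
exponents at `1` converge. -/
lemma tendsto_integral_comp_exp_of_laplace (hs : ∀ᶠ n in atTop, IsLevyLike (κs n))
    (hκ : IsLevyLike κ)
    (hlim : ∀ j : ℕ, Tendsto (fun n ↦ ∫ x, (1 - Real.exp (-(j * x))) ∂κs n) atTop
      (𝓝 (D * j + ∫ x, (1 - Real.exp (-(j * x))) ∂κ))) {g : ℝ → ℝ} (hg : Continuous g) :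
    Tendsto (fun n ↦ ∫ x, g (Real.exp (-x)) * (1 - Real.exp (-x)) ∂κs n) atTop
      (𝓝 (D * g 1 + ∫ x, g (Real.exp (-x)) * (1 - Real.exp (-x)) ∂κ)) := by
  set M := |D + ∫ x, (1 - Real.exp (-x)) ∂κ| + 1 with hM
  have hMpos : 0 < M := by positivity
  have hint0 : ∀ m : Measure ℝ, IsLevyLike m → 0 ≤ ∫ x, (1 - Real.exp (-x)) ∂m := fun m hm ↦
    integral_nonneg_of_ae (hm.ae_nonneg.mono fun x hx ↦
      sub_nonneg.2 (Real.exp_le_one_iff.2 (by linarith)))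
  have h1 := hlim 1
  simp only [Nat.cast_one, one_mul, mul_one] at h1
  have hbd : ∀ᶠ n in atTop, ∫ x, (1 - Real.exp (-x)) ∂κs n ≤ M :=
    ((tendsto_order.1 h1).2 M (by rw [hM]; linarith [le_abs_self (D + ∫ x, (1 - Real.exp (-x)) ∂κ)])
      ).mono fun n hn ↦ hn.le
  rw [Metric.tendsto_nhds]
  intro ε hε
  -- The approximation error enters three times: through the approximating measure, the drift and
  -- the limit measure. `N` adds up the corresponding masses.
  set N := M + |D| + ∫ x, (1 - Real.exp (-x)) ∂κ with hN
  have hNpos : 0 < N := by have := hint0 κ hκ; positivity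
  obtain ⟨p, hp⟩ := exists_polynomial_near_of_continuousOn 0 1 g hg.continuousOn (ε / (2 * N))
    (by positivity)
  have hp' : ∀ s ∈ Icc (0 : ℝ) 1, |p.eval s - g s| ≤ ε / (2 * N) := fun s hs ↦ (hp s hs).le
  have hpt := tendsto_integral_eval_of_laplace hs hκ hlim p
  rw [Metric.tendsto_nhds] at hpt
  filter_upwards [hpt (ε / 2) (half_pos hε), hbd, hs] with n hn1 hn2 hn3
  have e1 := hn3.abs_integral_mul_sub_le hg p.continuous hp'
  have e2 := hκ.abs_integral_mul_sub_le hg p.continuous hp'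
  have e3 := mul_le_mul_of_nonneg_left (hp' 1 (by simp)) (abs_nonneg D)
  rw [← abs_mul, mul_sub] at e3
  have e4 : ε / (2 * N) * ∫ x, (1 - Real.exp (-x)) ∂κs n ≤ ε / (2 * N) * M := by gcongr
  have e5 : ε / (2 * N) * M + |D| * (ε / (2 * N)) + ε / (2 * N) * ∫ x, (1 - Real.exp (-x)) ∂κ =
      ε / 2 := by
    rw [hN] at hNpos ⊢
    field_simp
  rw [Real.dist_eq, abs_lt] at hn1 ⊢
  rw [abs_le] at e1 e2 e3
  constructor <;> linarith [hn1.1, hn1.2, e1.1, e1.2, e2.1, e2.2, e3.1, e3.2]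

/-- Convergence of Laplace exponents controls the tails. -/
lemma eventually_real_Ici_le_and_le_real_Ioi (hs : ∀ᶠ n in atTop, IsLevyLike (κs n))
    (hκ : IsLevyLike κ) (hsf : ∀ n x, 0 < x → κs n (Ioi x) ≠ ∞) (hκf : ∀ x, 0 < x → κ (Ioi x) ≠ ∞)
    (hlim : ∀ j : ℕ, Tendsto (fun n ↦ ∫ x, (1 - Real.exp (-(j * x))) ∂κs n) atTop
      (𝓝 (D * j + ∫ x, (1 - Real.exp (-(j * x))) ∂κ))) {x y : ℝ} (hx : 0 < x) (hxy : x < y)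
    {δ : ℝ} (hδ : 0 < δ) :
    ∀ᶠ n in atTop, (κs n).real (Ici y) ≤ κ.real (Ioi x) + δ ∧
      κ.real (Ici y) - δ ≤ (κs n).real (Ioi x) := by
  have hexy : Real.exp (-y) < Real.exp (-x) := Real.exp_lt_exp.2 (by linarith)
  have hex1 : Real.exp (-x) < 1 := Real.exp_lt_one_iff.2 (by linarith)
  -- In the variable `s = exp (-z)`, `w` is a ramp equal to `0` for `z ≤ x` and to `1` for `z ≥ y`.
  -- The function `g` removes the weight `1 - s`; the maximum keeps the denominator positive and
  -- changes nothing where `w ≠ 0`. As `g 1 = 0`, the drift drops out.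
  set w : ℝ → ℝ := fun s ↦ max 0 (min 1 ((Real.exp (-x) - s) / (Real.exp (-x) - Real.exp (-y))))
    with hw
  set g : ℝ → ℝ := fun s ↦ w s / max (1 - s) (1 - Real.exp (-x)) with hg
  have hgc : Continuous g := by
    have hwc : Continuous w := by fun_prop
    refine hwc.div (by fun_prop) fun s ↦ ?_
    exact (lt_max_of_lt_right (by linarith)).ne'
  have hw0 : ∀ z, z ≤ x → w (Real.exp (-z)) = 0 := fun z hz ↦ by
    have h1 : Real.exp (-x) ≤ Real.exp (-z) := Real.exp_le_exp.2 (by linarith)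
    exact max_eq_left (min_le_of_right_le (div_nonpos_of_nonpos_of_nonneg (by linarith)
      (by linarith)))
  have hw1 : ∀ z, y ≤ z → w (Real.exp (-z)) = 1 := fun z hz ↦ by
    have h1 : Real.exp (-z) ≤ Real.exp (-y) := Real.exp_le_exp.2 (by linarith)
    have h2 : 1 ≤ (Real.exp (-x) - Real.exp (-z)) / (Real.exp (-x) - Real.exp (-y)) := by
      rw [one_le_div (by linarith)]; linarith
    simp only [hw, min_eq_left h2, max_eq_right zero_le_one]
  have hgw : ∀ z, g (Real.exp (-z)) * (1 - Real.exp (-z)) = w (Real.exp (-z)) := fun z ↦ by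
    rcases le_or_gt z x with hz | hz
    · rw [hg]; simp only [hw0 z hz, zero_div, zero_mul]
    · have h1 : Real.exp (-z) < Real.exp (-x) := Real.exp_lt_exp.2 (by linarith)
      rw [hg]
      simp only
      rw [max_eq_left (by linarith), div_mul_cancel₀ _ (by linarith)]
  have hg1 : g 1 = 0 := by
    have := hw0 0 hx.le
    simp only [neg_zero, Real.exp_zero] at this
    simp only [hg, this, zero_div]
  have hlimg := tendsto_integral_comp_exp_of_laplace hs hκ hlim hgc
  simp only [hgw, hg1, mul_zero, zero_add] at hlimg
  have hsub : Ici y ⊆ Ioi x := fun z hz ↦ hxy.trans_le hz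
  have hbounds : ∀ m : Measure ℝ, IsLevyLike m → m (Ioi x) ≠ ∞ →
      m.real (Ici y) ≤ ∫ z, w (Real.exp (-z)) ∂m ∧ ∫ z, w (Real.exp (-z)) ∂m ≤ m.real (Ioi x) := by
    intro m hm hmf
    have hint : Integrable (fun z ↦ w (Real.exp (-z))) m := by
      simpa only [hgw] using hm.integrable_mul hgc
    constructor
    · rw [← integral_indicator_one measurableSet_Ici]
      refine integral_mono ((integrable_indicator_iff measurableSet_Ici).2
        (integrableOn_const (measure_ne_top_of_subset hsub hmf))) hint fun z ↦ ?_
      by_cases hz : z ∈ Ici y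
      · rw [indicator_of_mem hz, hw1 z hz]; rfl
      · rw [indicator_of_notMem hz]; exact le_max_left _ _
    · rw [← integral_indicator_one measurableSet_Ioi]
      refine integral_mono hint ((integrable_indicator_iff measurableSet_Ioi).2
        (integrableOn_const hmf)) fun z ↦ ?_
      by_cases hz : z ∈ Ioi x
      · rw [indicator_of_mem hz]; exact max_le zero_le_one (min_le_left _ _)
      · rw [indicator_of_notMem hz]; exact (hw0 z (not_lt.1 hz)).le
  obtain ⟨b1, b2⟩ := hbounds κ hκ (hκf x hx)
  filter_upwards [hs, (tendsto_order.1 hlimg).2 (κ.real (Ioi x) + δ) (by linarith),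
    (tendsto_order.1 hlimg).1 (κ.real (Ici y) - δ) (by linarith)] with n hn h1 h2
  obtain ⟨b3, b4⟩ := hbounds (κs n) hn (hsf n x hx)
  exact ⟨by linarith, by linarith⟩

end Vague

/-! ### Paths, measurability and increment laws of a subordinator. -/

lemma measurableSet_le_ncard {Ω ι : Type*} [MeasurableSpace Ω] [Finite ι] {E : ι → Set Ω}
    (hE : ∀ i, MeasurableSet (E i)) (m : ℕ) : MeasurableSet {ω | m ≤ {i | ω ∈ E i}.ncard} := by
  have : {ω | m ≤ {i | ω ∈ E i}.ncard} = ⋃ F ∈ {F : Set ι | m ≤ F.ncard}, ⋂ i ∈ F, E i := by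
    ext ω
    simp only [mem_ofPred_eq, mem_iUnion, mem_iInter, exists_prop]
    exact ⟨fun h ↦ ⟨_, h, fun i hi ↦ hi⟩, fun ⟨F, hF, h⟩ ↦ hF.trans (ncard_le_ncard h)⟩
  rw [this]
  exact MeasurableSet.biUnion (to_countable _) fun F _ ↦
    MeasurableSet.biInter (to_countable _) fun i _ ↦ hE i

/-- Almost surely, the increments are controlled only for countably many pairs of times. A decrease
from `s` to `t` would persist at points of `S` just to the right of each, by right-continuity. -/
lemma monotone_of_forall_mem_dense {f : ℝ≥0 → ℝ} {S : Set ℝ≥0} (hS : Dense S)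
    (hf : ∀ s ∈ S, ∀ t ∈ S, s ≤ t → f s ≤ f t) (hr : ∀ s, ContinuousWithinAt f (Ici s) s) :
    Monotone f := by
  intro s t hst
  rcases hst.eq_or_lt with rfl | hlt
  · exact le_rfl
  by_contra! h
  obtain ⟨c, hc1, hc2⟩ := exists_between h
  have h1 : ∀ᶠ v in 𝓝[>] s, c < f v ∧ v < t :=
    (((tendsto_order.1 (hr s)).1 c hc2).filter_mono (nhdsWithin_mono s Ioi_subset_Ici_self)).and
      (eventually_nhdsWithin_of_eventually_nhds (eventually_lt_nhds hlt))
  have h2 : ∀ᶠ v in 𝓝[>] t, f v < c :=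
    ((tendsto_order.1 (hr t)).2 c hc1).filter_mono (nhdsWithin_mono t Ioi_subset_Ici_self)
  obtain ⟨s', hs', hs⟩ := (mem_nhdsGT_iff_exists_Ioo_subset).1 h1
  obtain ⟨t', ht', ht⟩ := (mem_nhdsGT_iff_exists_Ioo_subset).1 h2
  obtain ⟨p, hpS, hp⟩ := hS.exists_mem_open isOpen_Ioo (nonempty_Ioo.2 (mem_Ioi.1 hs'))
  obtain ⟨q, hqS, hq⟩ := hS.exists_mem_open isOpen_Ioo (nonempty_Ioo.2 (mem_Ioi.1 ht'))
  have hp1 := hs hp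
  have hq1 := ht hq
  have := hf p hpS q hqS (hp1.2.le.trans hq.1.le)
  have hp2 : c < f p := hp1.1
  have hq2 : f q < c := hq1
  linarith

section
variable {Ω : Type*} [MeasurableSpace Ω] {P : Measure Ω} {L : ℝ≥0 → Ω → ℝ}

/-- Almost surely, the paths of a subordinator are monotone and right-continuous. -/
lemma IsSubordinator.ae_monotone (hL : IsSubordinator P L) :
    ∀ᵐ ω ∂P, Monotone (fun s ↦ L s ω) ∧
      ∀ s, ContinuousWithinAt (fun s ↦ L s ω) (Ici s) s := by
  obtain ⟨S, hSc, hS⟩ := TopologicalSpace.exists_countable_dense ℝ≥0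
  have h : ∀ᵐ ω ∂P, ∀ s ∈ S, ∀ t ∈ S, s ≤ t → L s ω ≤ L t ω := by
    refine (ae_ball_iff hSc).2 fun s _ ↦ (ae_ball_iff hSc).2 fun t _ ↦ ?_
    by_cases hst : s ≤ t
    · filter_upwards [hL.nonneg_increments s t hst] with ω hω _ using sub_nonneg.1 hω
    · exact ae_of_all _ fun ω h ↦ absurd h hst
  filter_upwards [h, hL.cadlag] with ω hω hc
  exact ⟨monotone_of_forall_mem_dense hS hω fun s ↦ (hc s).1, fun s ↦ (hc s).1⟩

lemma IsSubordinator.measurable_gridIncrement (hL : IsSubordinator P L) (T : ℝ≥0) (n : ℕ)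
    (i : Fin n) : Measurable (fun ω ↦ gridIncrement (fun s ↦ L s ω) T n i) :=
  (hL.measurable _).sub (hL.measurable _)

/-- The set of flights is an uncountable construction, but on the almost sure event of good paths
each level event is a countable combination of events on grid increments. -/
lemma IsSubordinator.aemeasurable_orderFlight (hL : IsSubordinator P L) (T : ℝ≥0) {m : ℕ}
    (hm : 1 ≤ m) : AEMeasurable (fun ω ↦ orderFlight (fun s ↦ L s ω) m T) P := by
  have hmeas : Measurable
      (fun ω : NullMeasurableSpace Ω P ↦ orderFlight (fun s ↦ L s ω) m T) := by
    refine measurable_of_Ioi fun y ↦ ?_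
    change NullMeasurableSet {ω | y < orderFlight (fun s ↦ L s ω) m T} P
    rcases lt_or_ge y 0 with hy | hy
    · have : {ω | y < orderFlight (fun s ↦ L s ω) m T} = univ :=
        eq_univ_of_forall fun ω ↦ hy.trans_le (orderFlight_nonneg m)
      rw [this]; exact MeasurableSet.univ.nullMeasurableSet
    · have hA : MeasurableSet (⋃ q ∈ {q : ℚ | y < q}, {ω | ∀ᶠ n : ℕ in atTop,
          m ≤ {i : Fin n | (q : ℝ) < gridIncrement (fun s ↦ L s ω) T n i}.ncard}) := by
        refine MeasurableSet.biUnion (to_countable _) fun q _ ↦ ?_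
        have : {ω | ∀ᶠ n : ℕ in atTop,
            m ≤ {i : Fin n | (q : ℝ) < gridIncrement (fun s ↦ L s ω) T n i}.ncard} =
            ⋃ N, ⋂ n ∈ Ici N,
              {ω | m ≤ {i : Fin n | (q : ℝ) < gridIncrement (fun s ↦ L s ω) T n i}.ncard} := by
          ext ω; simp [eventually_atTop]
        rw [this]
        refine MeasurableSet.iUnion fun N ↦ MeasurableSet.biInter (to_countable _) fun n _ ↦ ?_
        exact measurableSet_le_ncard (E := fun i : Fin n ↦
          {ω | (q : ℝ) < gridIncrement (fun s ↦ L s ω) T n i})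
          (fun i ↦ measurableSet_lt measurable_const (hL.measurable_gridIncrement T n i)) m
      refine hA.nullMeasurableSet.congr ?_
      filter_upwards [hL.ae_monotone] with ω hω
      refine propext ?_
      change (ω ∈ ⋃ q ∈ {q : ℚ | y < q}, _) ↔ y < _
      rw [lt_orderFlight_iff_gridIncrement hω.1 hω.2 hm hy]
      simp
  exact NullMeasurable.aemeasurable fun s hs ↦ hmeas hs

lemma IsSubordinator.aemeasurable_scaledOrderSeq (hL : IsSubordinator P L) (α : ℝ) (t c : ℝ≥0) :
    AEMeasurable (scaledOrderSeq L α t c) P :=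
  aemeasurable_pi_iff.2 fun i ↦ (hL.aemeasurable_orderFlight _ (by omega)).const_mul _

/-- The law of an increment of `L` over a time interval of length `h`. -/
noncomputable def incrementLaw (P : Measure Ω) (L : ℝ≥0 → Ω → ℝ) (h : ℝ≥0) : Measure ℝ :=
  P.map (fun ω ↦ L h ω - L 0 ω)

lemma IsSubordinator.map_gridIncrement (hL : IsSubordinator P L) (T : ℝ≥0) (n : ℕ) (i : Fin n) :
    P.map (fun ω ↦ gridIncrement (fun s ↦ L s ω) T n i) = incrementLaw P L (T / n) := by
  have h := (hL.stationary_increments (T * i / n) (T / n)).map_eq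
  have e : T * i / n + T / n = T * (i + 1) / n := by ring
  rwa [e] at h

lemma IsSubordinator.iIndepFun_gridIncrement (hL : IsSubordinator P L) (T : ℝ≥0) (n : ℕ) :
    iIndepFun (fun (i : Fin n) ω ↦ gridIncrement (fun s ↦ L s ω) T n i) P := by
  have h := hL.indep_increments n (fun i ↦ T * (i : ℕ) / n) fun i j hij ↦ by
    simp only
    gcongr
    exact hij
  simpa [gridIncrement] using h

variable {ν : Measure ℝ}

lemma IsLevyMeasureOf.isLevyLike (hν : IsLevyMeasureOf ν P L) : IsLevyLike ν := by
  have h0 : ∀ᵐ x ∂ν, 0 < x := by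
    rw [ae_iff]; simpa [Iic] using hν.1
  refine ⟨h0.mono fun x hx ↦ hx.le, ?_⟩
  have hint : Integrable (fun x : ℝ ↦ min x 1) ν := by
    refine ⟨Continuous.aestronglyMeasurable (by fun_prop), ?_⟩
    rw [hasFiniteIntegral_iff_ofReal (h0.mono fun x hx ↦ le_min hx.le zero_le_one)]
    exact hν.2.1
  refine hint.mono' (Continuous.aestronglyMeasurable (by fun_prop)) (h0.mono fun x hx ↦ ?_)
  have h1 : Real.exp (-x) ≤ 1 := Real.exp_le_one_iff.2 (by linarith)
  rw [Real.norm_of_nonneg (sub_nonneg.2 h1)]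
  exact le_min (by linarith [Real.one_sub_le_exp_neg x]) (by linarith [Real.exp_pos (-x)])

lemma IsLevyMeasureOf.measure_Ioi_ne_top (hν : IsLevyMeasureOf ν P L) {x : ℝ} (hx : 0 < x) :
    ν (Ioi x) ≠ ∞ := by
  have hpos : 0 < min x 1 := lt_min hx one_pos
  have h := mul_meas_ge_le_lintegral (μ := ν) (f := fun x : ℝ ↦ ENNReal.ofReal (min x 1))
    (by fun_prop) (ENNReal.ofReal (min x 1))
  have hsub : Ioi x ⊆ {z | ENNReal.ofReal (min x 1) ≤ ENNReal.ofReal (min z 1)} := fun z hz ↦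
    ENNReal.ofReal_le_ofReal (min_le_min_right 1 (le_of_lt hz))
  refine measure_ne_top_of_subset hsub ?_
  intro htop
  rw [htop, ENNReal.mul_top (by simpa using hpos)] at h
  exact absurd (h.trans_lt hν.2.1) (lt_irrefl _)

variable [IsProbabilityMeasure P]

lemma IsSubordinator.isProbabilityMeasure_incrementLaw (hL : IsSubordinator P L) (h : ℝ≥0) :
    IsProbabilityMeasure (incrementLaw P L h) :=
  Measure.isProbabilityMeasure_map ((hL.measurable _).sub (hL.measurable _)).aemeasurable

lemma IsSubordinator.isLevyLike_incrementLaw (hL : IsSubordinator P L) (h : ℝ≥0) :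
    IsLevyLike (incrementLaw P L h) := by
  have := hL.isProbabilityMeasure_incrementLaw h
  have h0 : ∀ᵐ x ∂incrementLaw P L h, 0 ≤ x :=
    (ae_map_iff ((hL.measurable _).sub (hL.measurable _)).aemeasurable measurableSet_Ici).2
      (hL.nonneg_increments 0 h zero_le)
  refine ⟨h0, Integrable.of_bound (C := 1) (Continuous.aestronglyMeasurable (by fun_prop)) ?_⟩
  filter_upwards [h0] with x hx
  have h1 : Real.exp (-x) ≤ 1 := Real.exp_le_one_iff.2 (by linarith)
  rw [Real.norm_of_nonneg (sub_nonneg.2 h1)]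
  linarith [Real.exp_pos (-x)]

lemma IsLevyLike.smul {m : Measure ℝ} (h : IsLevyLike m) {c : ℝ≥0∞} (hc : c ≠ ∞) :
    IsLevyLike (c • m) :=
  ⟨Measure.ae_smul_measure h.ae_nonneg c, h.integrable.smul_measure hc⟩

lemma tendsto_nat_mul_one_sub_exp (a : ℝ) :
    Tendsto (fun n : ℕ ↦ (n : ℝ) * (1 - Real.exp (-(a / n)))) atTop (𝓝 a) := by
  have hd : HasDerivAt (fun x : ℝ ↦ 1 - Real.exp (-(a * x))) a 0 := by
    have := (((hasDerivAt_id (0 : ℝ)).const_mul a).neg.exp).const_sub 1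
    simpa using this
  have h1 := hd.tendsto_slope_zero
  have h2 : Tendsto (fun n : ℕ ↦ ((n : ℝ))⁻¹) atTop (𝓝[≠] 0) :=
    tendsto_nhdsWithin_iff.2 ⟨tendsto_inv_atTop_nhds_zero_nat,
      (eventually_gt_atTop 0).mono fun n hn ↦ by simp; omega⟩
  refine (h1.comp h2).congr fun n ↦ ?_
  simp [div_eq_mul_inv]

/-- The tails of the rescaled increment laws are asymptotically sandwiched by the tails of the
Lévy measure. -/
lemma IsSubordinator.eventually_incrementLaw_tail (hL : IsSubordinator P L)
    (hν : IsLevyMeasureOf ν P L) (T : ℝ≥0) {x y : ℝ} (hx : 0 < x) (hxy : x < y) {δ : ℝ}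
    (hδ : 0 < δ) :
    ∀ᶠ n : ℕ in atTop,
      n * (incrementLaw P L (T / n)).real (Ici y) ≤ T * ν.real (Ioi x) + δ ∧
      T * ν.real (Ioi y) - δ ≤ n * (incrementLaw P L (T / n)).real (Ioi x) := by
  obtain ⟨d, hd, hψ⟩ := hν.2.2
  -- The Lévy–Khinchin formula at time `T / n`; the right-hand side has the form `n * (1 - exp (-a /
  -- n))`, which tends to `a`.
  have hlap : ∀ (n j : ℕ), ∫ x, (1 - Real.exp (-(j * x))) ∂((n : ℝ≥0∞) • incrementLaw P L (T / n)) =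
      n * (1 - Real.exp (-(T * (d * j + ∫ x, (1 - Real.exp (-(j * x))) ∂ν) / n))) := by
    intro n j
    have hprob := hL.isProbabilityMeasure_incrementLaw (T / n)
    have hLL := hL.isLevyLike_incrementLaw (T / n)
    have hi : Integrable (fun x ↦ Real.exp (-(j * x))) (incrementLaw P L (T / n)) := by
      refine ((integrable_const (1 : ℝ)).sub (hLL.integrable_one_sub_exp j)).congr
        (ae_of_all _ fun x ↦ ?_)
      simp
    have hm : AEMeasurable (fun ω ↦ L (T / n) ω - L 0 ω) P :=
      ((hL.measurable _).sub (hL.measurable _)).aemeasurable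
    rw [integral_smul_measure, integral_sub (integrable_const _) hi, incrementLaw,
      integral_map hm (Continuous.aestronglyMeasurable (by fun_prop)),
      integral_map hm (Continuous.aestronglyMeasurable (by fun_prop)),
      ENNReal.toReal_natCast, smul_eq_mul]
    have : ∫ ω, Real.exp (-(j * (L (T / n) ω - L 0 ω))) ∂P =
        ∫ ω, Real.exp (-(j * L (T / n) ω)) ∂P := by
      refine integral_congr_ae ?_
      filter_upwards [hL.start_zero] with ω hω
      rw [hω, sub_zero]
    rw [this, hψ (T / n) j (by positivity)]
    push_cast
    simp only [integral_const, probReal_univ, smul_eq_mul, mul_one]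
    congr 3
    ring_nf
  have hκ : IsLevyLike ((T : ℝ≥0∞) • ν) := hν.isLevyLike.smul (by simp)
  have key := eventually_real_Ici_le_and_le_real_Ioi
    (κs := fun n : ℕ ↦ (n : ℝ≥0∞) • incrementLaw P L (T / n)) (κ := (T : ℝ≥0∞) • ν) (D := T * d)
    (Eventually.of_forall fun n ↦ (hL.isLevyLike_incrementLaw (T / n)).smul (by simp)) hκ
    (fun n x _ ↦ by
      have := hL.isProbabilityMeasure_incrementLaw (T / n)
      rw [Measure.smul_apply, smul_eq_mul]
      exact ENNReal.mul_ne_top (by simp) (measure_ne_top _ _))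
    (fun x hx ↦ by
      rw [Measure.smul_apply, smul_eq_mul]
      exact ENNReal.mul_ne_top (by simp) (hν.measure_Ioi_ne_top hx))
    (fun j ↦ by
      simp_rw [hlap]
      convert tendsto_nat_mul_one_sub_exp _ using 2
      rw [integral_smul_measure, ENNReal.coe_toReal, smul_eq_mul]
      ring) hx hxy hδ
  filter_upwards [key] with n hn
  simp only [measureReal_ennreal_smul_apply, ENNReal.coe_toReal, ENNReal.toReal_natCast] at hn
  refine ⟨hn.1, le_trans ?_ hn.2⟩
  have hfin : ν (Ici y) ≠ ∞ := measure_ne_top_of_subset (fun z hz ↦ hxy.trans_le hz)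
    (hν.measure_Ioi_ne_top hx)
  have := measureReal_mono (μ := ν) (Ioi_subset_Ici_self (a := y)) hfin
  gcongr

end

/-! ### Limits and bounds for the probabilities of grid boxes. -/

lemma tendsto_descFactorial_div_pow (K : ℕ) :
    Tendsto (fun n : ℕ ↦ (n.descFactorial K : ℝ) / (n : ℝ) ^ K) atTop (𝓝 1) := by
  induction K with
  | zero => simp
  | succ K ih =>
    have h1 : Tendsto (fun n : ℕ ↦ ((n - K : ℕ) : ℝ) / n) atTop (𝓝 1) := by
      have h2 : Tendsto (fun n : ℕ ↦ 1 - (K : ℝ) / n) atTop (𝓝 (1 - 0)) :=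
        (tendsto_const_div_atTop_nhds_zero_nat (K : ℝ)).const_sub 1
      rw [sub_zero] at h2
      refine h2.congr' ?_
      filter_upwards [eventually_ge_atTop K, eventually_gt_atTop 0] with n hn hn0
      have : (n : ℝ) ≠ 0 := by exact_mod_cast hn0.ne'
      rw [Nat.cast_sub hn]
      field_simp
    have := h1.mul ih
    rw [one_mul] at this
    refine this.congr fun n ↦ ?_
    rw [Nat.descFactorial_succ, pow_succ', Nat.cast_mul, mul_div_mul_comm]

lemma exp_neg_div_one_sub_le {q : ℝ} (hq : q < 1) : Real.exp (-(q / (1 - q))) ≤ 1 - q := by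
  have h1 : 0 < 1 - q := by linarith
  have h2 := Real.add_one_le_exp (q / (1 - q))
  have h3 : q / (1 - q) + 1 = (1 - q)⁻¹ := by field_simp; ring
  rw [h3] at h2
  rw [Real.exp_neg]
  exact inv_le_of_inv_le₀ h1 h2

/-- With `q = W n / n`, the base is squeezed by `exp (-(q / (1 - q))) ≤ 1 - q ≤ exp (-q)`, and `(n -
K) * q` tends to `w`. -/
lemma tendsto_one_sub_div_pow_sub {l : Filter ℕ} (hl : l ≤ atTop) {W : ℕ → ℝ} {w : ℝ}
    (hW : Tendsto W l (𝓝 w)) (K : ℕ) :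
    Tendsto (fun n ↦ (1 - W n / n) ^ (n - K)) l (𝓝 (Real.exp (-w))) := by
  have hinv : Tendsto (fun n : ℕ ↦ (n : ℝ)⁻¹) l (𝓝 0) :=
    tendsto_inv_atTop_nhds_zero_nat.mono_left hl
  have hq : Tendsto (fun n : ℕ ↦ W n / n) l (𝓝 0) := by
    simpa [div_eq_mul_inv] using hW.mul hinv
  have hqn : Tendsto (fun n : ℕ ↦ ((n - K : ℕ) : ℝ) * (W n / n)) l (𝓝 w) := by
    have h1 : Tendsto (fun n : ℕ ↦ W n - K * (W n / n)) l (𝓝 (w - K * 0)) :=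
      hW.sub (hq.const_mul _)
    rw [mul_zero, sub_zero] at h1
    refine h1.congr' ?_
    filter_upwards [hl (eventually_ge_atTop K), hl (eventually_gt_atTop 0)] with n hn hn0
    have : (n : ℝ) ≠ 0 := by exact_mod_cast (show 0 < n from hn0).ne'
    rw [Nat.cast_sub hn]
    field_simp
  have hup : Tendsto (fun n : ℕ ↦ Real.exp (-(((n - K : ℕ) : ℝ) * (W n / n)))) l
      (𝓝 (Real.exp (-w))) := (Real.continuous_exp.tendsto _).comp hqn.neg
  have hlo : Tendsto (fun n : ℕ ↦ Real.exp (-(((n - K : ℕ) : ℝ) * (W n / n) / (1 - W n / n)))) l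
      (𝓝 (Real.exp (-w))) := by
    have := hqn.div (hq.const_sub 1) (by norm_num)
    rw [sub_zero, div_one] at this
    exact (Real.continuous_exp.tendsto _).comp this.neg
  have hq1 : ∀ᶠ n in l, W n / n < 1 := (tendsto_order.1 hq).2 1 one_pos
  refine tendsto_of_tendsto_of_tendsto_of_le_of_le' hlo hup (hq1.mono fun n hn ↦ ?_)
    (hq1.mono fun n hn ↦ ?_)
  · have := pow_le_pow_left₀ (Real.exp_pos _).le (exp_neg_div_one_sub_le hn) (n - K)
    rw [← Real.exp_nat_mul] at this
    convert this using 2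
    ring
  · have := pow_le_pow_left₀ (by linarith) (Real.one_sub_le_exp_neg (W n / n)) (n - K)
    rw [← Real.exp_nat_mul] at this
    convert this using 2
    ring

/-- By dominated convergence the part of `A` outside `E n` loses all its mass, so `P(A)` is at most
`P(E n)` plus a vanishing error. Convergence of `P(E n)` is needed only along `l`. -/
lemma measureReal_le_of_ae_eventually_mem {Ω : Type*} [MeasurableSpace Ω] {P : Measure Ω}
    [IsProbabilityMeasure P] {A : Set Ω} (hA : NullMeasurableSet A P) {E : ℕ → Set Ω}
    (hE : ∀ n, MeasurableSet (E n)) (h : ∀ᵐ ω ∂P, ω ∈ A → ∀ᶠ n in atTop, ω ∈ E n)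
    {l : Filter ℕ} [l.NeBot] (hl : l ≤ atTop) {e : ℝ} (he : Tendsto (fun n ↦ P.real (E n)) l (𝓝 e)) :
    P.real A ≤ e := by
  obtain ⟨A', -, hA'm, hA'⟩ := hA.exists_measurable_superset_ae_eq
  have h0 : Tendsto (fun n ↦ P (A' \ E n)) atTop (𝓝 (P ∅)) := by
    refine tendsto_measure_of_ae_tendsto_indicator_of_isFiniteMeasure _ MeasurableSet.empty
      (fun n ↦ hA'm.diff (hE n)) ?_
    filter_upwards [h, hA'.mem_iff] with ω hω hA
    by_cases hωA : ω ∈ A'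
    · filter_upwards [hω (hA.1 hωA)] with n hn
      simp [hn]
    · exact Eventually.of_forall fun n ↦ by simp [hωA]
  have h1 : Tendsto (fun n ↦ P.real (A' \ E n)) l (𝓝 0) := by
    have := (ENNReal.tendsto_toReal (by simp)).comp h0
    rw [measure_empty, ENNReal.toReal_zero] at this
    exact this.mono_left hl
  have h2 := he.add h1
  rw [add_zero] at h2
  refine ge_of_tendsto' h2 fun n ↦ ?_
  rw [← measureReal_congr hA']
  refine (measureReal_mono ?_).trans (measureReal_union_le (E n) (A' \ E n))
  intro ω hω
  by_cases hωE : ω ∈ E n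
  · exact Or.inl hωE
  · exact Or.inr ⟨hω, hωE⟩

/-- The previous bound applied to complements. -/
lemma le_measureReal_of_ae_frequently_mem {Ω : Type*} [MeasurableSpace Ω] {P : Measure Ω}
    [IsProbabilityMeasure P] {A : Set Ω} (hA : NullMeasurableSet A P) {E : ℕ → Set Ω}
    (hE : ∀ n, MeasurableSet (E n)) (h : ∀ᵐ ω ∂P, (∃ᶠ n in atTop, ω ∈ E n) → ω ∈ A)
    {l : Filter ℕ} [l.NeBot] (hl : l ≤ atTop) {e : ℝ} (he : Tendsto (fun n ↦ P.real (E n)) l (𝓝 e)) :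
    e ≤ P.real A := by
  have h1 := measureReal_le_of_ae_eventually_mem hA.compl (fun n ↦ (hE n).compl) (h.mono fun ω hω
    hωA ↦ by
      by_contra hne
      exact hωA (hω fun hev ↦ hne hev)) hl (e := 1 - e) (by
      refine (he.const_sub 1).congr fun n ↦ ?_
      rw [probReal_compl_eq_one_sub (hE n)])
  rw [probReal_compl_eq_one_sub₀ hA] at h1
  linarith

section
variable {Ω : Type*} [MeasurableSpace Ω] {P : Measure Ω} {L : ℝ≥0 → Ω → ℝ}

/-- The event that the ordered increments of `L` over the regular partition of `[0, T]` into `n`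
intervals lie in an order box. -/
def gridBox (L : ℝ≥0 → Ω → ℝ) (T : ℝ≥0) (K : ℕ) (a b : ℕ → ℝ) (n : ℕ) : Set Ω :=
  {ω | (∀ k < K, k + 1 ≤ {i : Fin n | a k < gridIncrement (fun s ↦ L s ω) T n i}.ncard) ∧
    ∀ k ≤ K, {i : Fin n | b k ≤ gridIncrement (fun s ↦ L s ω) T n i}.ncard ≤ k}

lemma IsSubordinator.measurableSet_gridBox (hL : IsSubordinator P L) (T : ℝ≥0) (K : ℕ)
    (a b : ℕ → ℝ) (n : ℕ) : MeasurableSet (gridBox L T K a b n) := by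
  have : gridBox L T K a b n =
      (⋂ k ∈ Iio K, {ω | k + 1 ≤ {i : Fin n | a k < gridIncrement (fun s ↦ L s ω) T n i}.ncard}) ∩
      ⋂ k ∈ Iic K, {ω | k + 1 ≤ {i : Fin n | b k ≤ gridIncrement (fun s ↦ L s ω) T n i}.ncard}ᶜ := by
    ext ω
    simp [gridBox]
  rw [this]
  refine (MeasurableSet.biInter (to_countable _) fun k _ ↦ ?_).inter
    (MeasurableSet.biInter (to_countable _) fun k _ ↦ MeasurableSet.compl ?_)
  · exact measurableSet_le_ncard (E := fun i : Fin n ↦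
      {ω | a k < gridIncrement (fun s ↦ L s ω) T n i})
      (fun i ↦ measurableSet_lt measurable_const (hL.measurable_gridIncrement T n i)) _
  · exact measurableSet_le_ncard (E := fun i : Fin n ↦
      {ω | b k ≤ gridIncrement (fun s ↦ L s ω) T n i})
      (fun i ↦ measurableSet_le measurable_const (hL.measurable_gridIncrement T n i)) _

lemma IsSubordinator.measureReal_gridBox (hL : IsSubordinator P L) (T : ℝ≥0) {K : ℕ}
    {a b : ℕ → ℝ} (hb : IsOrderBox K a b) (n : ℕ) :
    P.real (gridBox L T K a b n) = n.descFactorial K *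
      (∏ k ∈ Finset.range K, (incrementLaw P L (T / n)).real (Ioo (a k) (b k))) *
      (incrementLaw P L (T / n)).real (Iio (b K)) ^ (n - K) := by
  have hJ : ∀ j k : Fin K, j < k → Disjoint (Ioo (a j) (b j)) (Ioo (a k) (b k)) := fun j k hjk ↦
    disjoint_left.2 fun x hx hx' ↦ by
      have := hb.lt_of_lt (j := j) (k := k) hjk k.2.le
      linarith [hx.1, hx'.2]
  have h := measure_exists_embedding (P := P) (K := K) (hL.measurable_gridIncrement T n)
    (hL.iIndepFun_gridIncrement T n) (hL.map_gridIncrement T n)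
    (J := fun k ↦ Ioo (a k) (b k)) (fun k ↦ measurableSet_Ioo)
    (fun j k hjk ↦ (lt_or_gt_of_ne hjk).elim (hJ j k) fun h ↦ (hJ k j h).symm)
    (C := Iio (b K)) measurableSet_Iio
    (fun k ↦ disjoint_left.2 fun x hx hx' ↦ by
      have := hb.lt_of_lt k.2 le_rfl
      have hx'' : x < b K := hx'
      linarith [hx.1])
  simp only [hb.exists_embedding_iff] at h
  rw [Measure.real, gridBox, h, ENNReal.toReal_mul, ENNReal.toReal_mul, ENNReal.toReal_pow,
    ENNReal.toReal_prod, ENNReal.toReal_natCast, Finset.prod_range]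
  rfl

lemma IsSubordinator.nullMeasurableSet_orderBox (hL : IsSubordinator P L) (T : ℝ≥0) (K : ℕ)
    (a b : ℕ → ℝ) :
    NullMeasurableSet {ω | (fun i ↦ orderFlight (fun s ↦ L s ω) (i + 1) T) ∈ orderBox K a b} P :=
  (aemeasurable_pi_iff.2 fun i ↦ hL.aemeasurable_orderFlight T (by omega)).nullMeasurable
    (isOpen_orderBox K a b).measurableSet

variable [IsProbabilityMeasure P] {ν : Measure ℝ}

/-- Along an ultrafilter, the tails of the rescaled increment laws converge, to limits which are
close to the tail of the Lévy measure. -/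
lemma IsSubordinator.exists_tail_limits (hL : IsSubordinator P L) (hν : IsLevyMeasureOf ν P L)
    (T : ℝ≥0) : ∃ U V : ℝ → ℝ,
      (∀ x, 0 < x → Tendsto (fun n : ℕ ↦ n * (incrementLaw P L (T / n)).real (Ioi x))
        (hyperfilter ℕ) (𝓝 (U x))) ∧
      (∀ x, 0 < x → Tendsto (fun n : ℕ ↦ n * (incrementLaw P L (T / n)).real (Ici x))
        (hyperfilter ℕ) (𝓝 (V x))) ∧
      (∀ x y, 0 < x → x < y → T * ν.real (Ioi y) ≤ U x ∧ V y ≤ T * ν.real (Ioi x)) ∧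
      ∀ x, 0 < x → U x ≤ V x := by
  have hUV : ∀ (n : ℕ) (x : ℝ), n * (incrementLaw P L (T / n)).real (Ioi x) ≤
      n * (incrementLaw P L (T / n)).real (Ici x) := fun n x ↦ by
    have := hL.isProbabilityMeasure_incrementLaw (T / n)
    have h := measureReal_mono (μ := incrementLaw P L (T / n)) (Ioi_subset_Ici_self (a := x))
    gcongr
  have hbd : ∀ x, 0 < x → ∀ᶠ n : ℕ in hyperfilter ℕ,
      n * (incrementLaw P L (T / n)).real (Ici x) ≤ T * ν.real (Ioi (x / 2)) + 1 := fun x hx ↦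
    Nat.hyperfilter_le_atTop ((hL.eventually_incrementLaw_tail hν T (half_pos hx)
      (half_lt_self hx) one_pos).mono fun n hn ↦ hn.1)
  have hex : ∀ (g : ℕ → ℝ) (C : ℝ), (∀ᶠ n in hyperfilter ℕ, g n ∈ Icc 0 C) →
      ∃ z, Tendsto g (hyperfilter ℕ) (𝓝 z) := fun g C hg ↦ by
    obtain ⟨z, -, hz⟩ := isCompact_Icc.ultrafilter_le_nhds (s := Icc (0 : ℝ) C)
      ((hyperfilter ℕ).map g) (le_principal_iff.2 hg)
    exact ⟨z, hz⟩
  have hU : ∀ x, 0 < x → ∃ z, Tendsto (fun n : ℕ ↦ n * (incrementLaw P L (T / n)).real (Ioi x))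
      (hyperfilter ℕ) (𝓝 z) := fun x hx ↦ hex _ _ ((hbd x hx).mono fun n hn ↦
    ⟨by positivity, (hUV n x).trans hn⟩)
  have hV : ∀ x, 0 < x → ∃ z, Tendsto (fun n : ℕ ↦ n * (incrementLaw P L (T / n)).real (Ici x))
      (hyperfilter ℕ) (𝓝 z) := fun x hx ↦ hex _ _ ((hbd x hx).mono fun n hn ↦
    ⟨by positivity, hn⟩)
  choose! U hU using hU
  choose! V hV using hV
  refine ⟨U, V, hU, hV, fun x y hx hxy ↦ ⟨?_, ?_⟩, fun x hx ↦
    le_of_tendsto_of_tendsto' (hU x hx) (hV x hx) fun n ↦ hUV n x⟩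
  · refine le_of_forall_pos_sub_le fun δ hδ ↦ ge_of_tendsto (hU x hx) ?_
    exact Nat.hyperfilter_le_atTop
      ((hL.eventually_incrementLaw_tail hν T hx hxy hδ).mono fun n hn ↦ hn.2)
  · refine le_of_forall_pos_le_add fun δ hδ ↦ le_of_tendsto (hV y (hx.trans hxy)) ?_
    exact Nat.hyperfilter_le_atTop
      ((hL.eventually_incrementLaw_tail hν T hx hxy hδ).mono fun n hn ↦ hn.1)

lemma IsSubordinator.tendsto_measureReal_gridBox (hL : IsSubordinator P L) (T : ℝ≥0) {K : ℕ}
    {a b : ℕ → ℝ} (hb : IsOrderBox K a b) {U V : ℝ → ℝ} {l : Filter ℕ} (hl : l ≤ atTop)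
    (hU : ∀ x, 0 < x → Tendsto (fun n : ℕ ↦ n * (incrementLaw P L (T / n)).real (Ioi x)) l
      (𝓝 (U x)))
    (hV : ∀ x, 0 < x → Tendsto (fun n : ℕ ↦ n * (incrementLaw P L (T / n)).real (Ici x)) l
      (𝓝 (V x))) :
    Tendsto (fun n ↦ P.real (gridBox L T K a b n)) l
      (𝓝 ((∏ k ∈ Finset.range K, (U (a k) - V (b k))) * Real.exp (-V (b K)))) := by
  have h1 := (tendsto_descFactorial_div_pow K).mono_left hl
  have h2 : Tendsto (fun n : ℕ ↦ ∏ k ∈ Finset.range K,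
      (n * (incrementLaw P L (T / n)).real (Ioi (a k)) -
        n * (incrementLaw P L (T / n)).real (Ici (b k)))) l
      (𝓝 (∏ k ∈ Finset.range K, (U (a k) - V (b k)))) :=
    tendsto_finsetProd _ fun k hk ↦ (hU _ (hb.left_pos (Finset.mem_range.1 hk))).sub
      (hV _ (hb.pos (Finset.mem_range.1 hk).le))
  have h3 := tendsto_one_sub_div_pow_sub hl (hV _ hb.last_pos) K
  have h4 := (h1.mul h2).mul h3
  rw [one_mul] at h4
  refine h4.congr' ?_
  filter_upwards [hl (eventually_gt_atTop 0)] with n hn0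
  have hn : (n : ℝ) ≠ 0 := by exact_mod_cast (show 0 < n from hn0).ne'
  have := hL.isProbabilityMeasure_incrementLaw (T / n)
  rw [hL.measureReal_gridBox T hb]
  congr 1
  -- The powers of `n` are balanced: one factor `n` goes to each of the `K` cell masses, and `n ^ K`
  -- divides the falling factorial.
  · have : ∀ k ∈ Finset.range K, (n * (incrementLaw P L (T / n)).real (Ioi (a k)) -
        n * (incrementLaw P L (T / n)).real (Ici (b k))) =
        n * (incrementLaw P L (T / n)).real (Ioo (a k) (b k)) := fun k hk ↦ by
      rw [← mul_sub, ← measureReal_sdiff (Ici_subset_Ioi.2 (hb.lt k (Finset.mem_range.1 hk)))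
        measurableSet_Ici]
      congr 2
      ext x; simp
    rw [Finset.prod_congr rfl this, Finset.prod_mul_distrib, Finset.prod_const, Finset.card_range]
    field_simp
  · congr 1
    rw [mul_div_cancel_left₀ _ hn, ← compl_Ici, probReal_compl_eq_one_sub measurableSet_Ici]

lemma IsSubordinator.measureReal_orderBox_le (hL : IsSubordinator P L)
    (hν : IsLevyMeasureOf ν P L) (T : ℝ≥0) {K : ℕ} {a b a' b' : ℕ → ℝ} (hb : IsOrderBox K a b)
    (ha0 : ∀ k < K, 0 < a' k) (ha : ∀ k < K, a' k < a k) (hbb : ∀ k ≤ K, b k < b' k) :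
    P.real {ω | (fun i ↦ orderFlight (fun s ↦ L s ω) (i + 1) T) ∈ orderBox K a b} ≤
      (∏ k ∈ Finset.range K, (T * ν.real (Ioi (a' k)) - T * ν.real (Ioi (b' k)))) *
        Real.exp (-(T * ν.real (Ioi (b' K)))) := by
  obtain ⟨U, V, hU, hV, hbd, hUV⟩ := hL.exists_tail_limits hν T
  have hlim := hL.tendsto_measureReal_gridBox T hb Nat.hyperfilter_le_atTop hU hV
  refine (measureReal_le_of_ae_eventually_mem (hL.nullMeasurableSet_orderBox T K a b)
    (hL.measurableSet_gridBox T K a b) (hL.ae_monotone.mono fun ω hω h ↦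
      eventually_gridIncrement_of_mem_orderBox hω.1 hω.2 hb h) Nat.hyperfilter_le_atTop hlim).trans ?_
  have hVb : ∀ k ≤ K, T * ν.real (Ioi (b' k)) ≤ V (b k) := fun k hk ↦
    (hbd _ _ (hb.pos hk) (hbb k hk)).1.trans (hUV _ (hb.pos hk))
  refine mul_le_mul (Finset.prod_le_prod (fun k hk ↦ ?_) fun k hk ↦ ?_)
    (Real.exp_le_exp.2 (neg_le_neg (hVb K le_rfl))) (Real.exp_pos _).le
    (Finset.prod_nonneg fun k hk ↦ ?_)
  · have hk := Finset.mem_range.1 hk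
    -- Both limits are compared with the Lévy tail at an intermediate `c`, which shows that the
    -- factor `U (a k) - V (b k)` is nonnegative.
    obtain ⟨c, hc1, hc2⟩ := exists_between (hb.lt k hk)
    have hc0 := (hb.left_pos hk).trans hc1
    have h1 := (hbd _ _ (hb.left_pos hk) hc1).1
    have h2 := (hbd _ _ hc0 hc2).2
    linarith
  · have hk := Finset.mem_range.1 hk
    have h1 := (hbd _ _ (ha0 k hk) (ha k hk)).2
    have h2 := hUV _ (hb.left_pos hk)
    have h3 := hVb k hk.le
    linarith
  · have hk := Finset.mem_range.1 hk
    rw [sub_nonneg]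
    gcongr
    · exact hν.measure_Ioi_ne_top (ha0 k hk)
    · exact ((ha k hk).trans (hb.lt k hk)).le.trans (hbb k hk.le).le

/-- Two margins are needed: from `(a, b)` to `(a₁, b₁)` to pass from grid increments to flights, and
from `(a₁, b₁)` to `(a₂, b₂)` to pass from the limits `U`, `V` to the tail of `ν`. -/
lemma IsSubordinator.le_measureReal_orderBox (hL : IsSubordinator P L)
    (hν : IsLevyMeasureOf ν P L) (T : ℝ≥0) {K : ℕ} {a b a₁ b₁ a₂ b₂ : ℕ → ℝ}
    (hb : IsOrderBox K a₁ b₁) (ha₁ : ∀ k < K, a k < a₁ k) (ha₂ : ∀ k < K, a₁ k < a₂ k)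
    (hab : ∀ k < K, a₂ k ≤ b₂ k) (hb₂ : ∀ k ≤ K, b₂ k < b₁ k) (hb₁ : ∀ k ≤ K, b₁ k < b k)
    (hpos : 0 < b₂ K) :
    (∏ k ∈ Finset.range K, (T * ν.real (Ioi (a₂ k)) - T * ν.real (Ioi (b₂ k)))) *
        Real.exp (-(T * ν.real (Ioi (b₂ K)))) ≤
      P.real {ω | (fun i ↦ orderFlight (fun s ↦ L s ω) (i + 1) T) ∈ orderBox K a b} := by
  obtain ⟨U, V, hU, hV, hbd, hUV⟩ := hL.exists_tail_limits hν T
  have hlim := hL.tendsto_measureReal_gridBox T hb Nat.hyperfilter_le_atTop hU hV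
  refine le_trans ?_ (le_measureReal_of_ae_frequently_mem (hL.nullMeasurableSet_orderBox T K a b)
    (hL.measurableSet_gridBox T K a₁ b₁) (hL.ae_monotone.mono fun ω hω h ↦
      mem_orderBox_of_frequently_gridIncrement hω.1 hω.2 hb ha₁ hb₁ h)
    Nat.hyperfilter_le_atTop hlim)
  have ha₂0 : ∀ k < K, 0 < a₂ k := fun k hk ↦ (hb.left_pos hk).trans (ha₂ k hk)
  have hfac : ∀ k < K, T * ν.real (Ioi (a₂ k)) - T * ν.real (Ioi (b₂ k)) ≤ U (a₁ k) - V (b₁ k) ∧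
      0 ≤ T * ν.real (Ioi (a₂ k)) - T * ν.real (Ioi (b₂ k)) := fun k hk ↦ by
    have h1 := (hbd _ _ (hb.left_pos hk) (ha₂ k hk)).1
    have h2 := (hbd _ _ ((ha₂0 k hk).trans_le (hab k hk)) (hb₂ k hk.le)).2
    refine ⟨by linarith, ?_⟩
    rw [sub_nonneg]
    gcongr
    · exact hν.measure_Ioi_ne_top (ha₂0 k hk)
    · exact hab k hk
  refine mul_le_mul (Finset.prod_le_prod (fun k hk ↦ (hfac k (Finset.mem_range.1 hk)).2)
    fun k hk ↦ (hfac k (Finset.mem_range.1 hk)).1) ?_ (Real.exp_pos _).le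
    (Finset.prod_nonneg fun k hk ↦ ?_)
  · exact Real.exp_le_exp.2 (neg_le_neg (hbd _ _ hpos (hb₂ K le_rfl)).2)
  · have := hfac k (Finset.mem_range.1 hk)
    linarith
end

/-! ### The scaling limit. -/

/-- Probability that a Poisson point process has exactly one point in each of `K` cells and none in
the others, in terms of the masses `A`, `B` of the half-lines that delimit the cells. -/
noncomputable def boxMass (K : ℕ) (A B : ℕ → ℝ) : ℝ :=
  (∏ k ∈ Finset.range K, (A k - B k)) * Real.exp (-B K)

lemma tendsto_boxMass {ι : Type*} {l : Filter ι} {K : ℕ} {A B : ι → ℕ → ℝ} {A' B' : ℕ → ℝ}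
    (hA : ∀ k < K, Tendsto (fun i ↦ A i k) l (𝓝 (A' k)))
    (hB : ∀ k ≤ K, Tendsto (fun i ↦ B i k) l (𝓝 (B' k))) :
    Tendsto (fun i ↦ boxMass K (A i) (B i)) l (𝓝 (boxMass K A' B')) := by
  refine Tendsto.mul (tendsto_finsetProd _ fun k hk ↦ ?_)
    ((Real.continuous_exp.tendsto _).comp (hB K le_rfl).neg)
  have hk := Finset.mem_range.1 hk
  exact (hA k hk).sub (hB k hk.le)

lemma tendsto_div_add_mul_rpow (t α m : ℝ) {x : ℝ} (hx : 0 < x) :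
    Tendsto (fun η ↦ t / (x + m * η) ^ α) (𝓝[>] 0) (𝓝 (t / x ^ α)) := by
  have h : Tendsto (fun η ↦ x + m * η) (𝓝[>] 0) (𝓝 x) := by
    have : Tendsto (fun η ↦ x + m * η) (𝓝 0) (𝓝 (x + m * 0)) :=
      Continuous.tendsto (by fun_prop) 0
    rw [mul_zero, add_zero] at this
    exact this.mono_left nhdsWithin_le_nhds
  exact tendsto_const_nhds.div (h.rpow_const (Or.inl hx.ne')) (Real.rpow_pos_of_pos hx α).ne'

/-- The rescaled tails of the Lévy measure converge. -/
lemma tendsto_scaled_tail {ν : Measure ℝ} {α : ℝ}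
    (htail : Asymptotics.IsEquivalent atTop (flightTail ν) (fun x : ℝ ↦ 1 / x ^ α)) (t : ℝ≥0)
    {x : ℝ} (hx : 0 < x) :
    Tendsto (fun c : ℝ≥0 ↦ ((c ^ α * t : ℝ≥0) : ℝ) * ν.real (Ioi (c * x))) atTop
      (𝓝 ((t : ℝ) / x ^ α)) := by
  have h1 := (Asymptotics.isEquivalent_iff_tendsto_one (by
    filter_upwards [eventually_gt_atTop 0] with y hy
    have := Real.rpow_pos_of_pos hy α
    positivity)).1 htail
  have h2 : Tendsto (fun c : ℝ≥0 ↦ (c : ℝ) * x) atTop atTop :=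
    (NNReal.tendsto_coe_atTop.2 tendsto_id).atTop_mul_const hx
  have h3 := (h1.comp h2).const_mul ((t : ℝ) / x ^ α)
  rw [mul_one] at h3
  refine h3.congr' ?_
  filter_upwards [eventually_gt_atTop 0] with c hc
  have hc' : (0 : ℝ) < c := hc
  have hcp := Real.rpow_pos_of_pos hc' α
  have hxp := Real.rpow_pos_of_pos hx α
  simp only [Function.comp, Pi.div_apply, flightTail, NNReal.coe_mul, NNReal.coe_rpow]
  rw [Real.mul_rpow hc'.le hx.le]
  field_simp

lemma scaledOrderSeq_mem_orderBox_iff {Ω : Type*} {L : ℝ≥0 → Ω → ℝ} {α : ℝ} {t c : ℝ≥0} (hc : 0 < c) {K : ℕ} {a b : ℕ → ℝ}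
    (ω : Ω) : scaledOrderSeq L α t c ω ∈ orderBox K a b ↔
      (fun i ↦ orderFlight (fun s ↦ L s ω) (i + 1) (c ^ α * t)) ∈
        orderBox K (fun k ↦ c * a k) (fun k ↦ c * b k) := by
  have hc' : (0 : ℝ) < c := hc
  simp only [scaledOrderSeq, orderBox, mem_ofPred_eq, inv_mul_lt_iff₀ hc', lt_inv_mul_iff₀ hc']

lemma IsOrderBox.const_mul {K : ℕ} {a b : ℕ → ℝ} (h : IsOrderBox K a b) {c : ℝ} (hc : 0 < c) :
    IsOrderBox K (fun k ↦ c * a k) (fun k ↦ c * b k) :=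
  ⟨fun k hk ↦ mul_lt_mul_of_pos_left (h.lt k hk) hc,
    fun k hk ↦ mul_lt_mul_of_pos_left (h.succ_lt k hk) hc, mul_pos hc h.last_pos⟩

section
variable {Ω : Type*} [MeasurableSpace Ω] {P : Measure Ω} {L : ℝ≥0 → Ω → ℝ}

variable [IsProbabilityMeasure P] {ν : Measure ℝ}

/-- Convergence of the order box probabilities of the rescaled order flights. -/
lemma IsSubordinator.tendsto_measureReal_scaledOrderSeq (hL : IsSubordinator P L)
    (hν : IsLevyMeasureOf ν P L) {α : ℝ}
    (htail : Asymptotics.IsEquivalent atTop (flightTail ν) (fun x : ℝ ↦ 1 / x ^ α)) (t : ℝ≥0)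
    {K : ℕ} {a b : ℕ → ℝ} (hb : IsOrderBox K a b) :
    Tendsto (fun c : ℝ≥0 ↦ P.real {ω | scaledOrderSeq L α t c ω ∈ orderBox K a b}) atTop
      (𝓝 (boxMass K (fun k ↦ (t : ℝ) / a k ^ α) (fun k ↦ (t : ℝ) / b k ^ α))) := by
  -- The lower bound shrinks each interval by `2 * η` at both ends, which needs `4 * η < b k - a k`
  -- and `2 * η < b K`. The upper bound moves left endpoints down by `η`, which needs `η < a k`.
  have hsmall : ∀ᶠ η in 𝓝[>] (0 : ℝ), (∀ k ∈ Finset.range K, η < a k ∧ 4 * η < b k - a k) ∧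
      2 * η < b K ∧ 0 < η := by
    have hlt : ∀ C : ℝ, 0 < C → ∀ m : ℝ, 0 < m → ∀ᶠ η in 𝓝[>] (0 : ℝ), m * η < C := by
      intro C hC m hm
      filter_upwards [Ioo_mem_nhdsGT (div_pos hC hm)] with η hη
      rw [← lt_div_iff₀' hm]
      exact hη.2
    refine Filter.Eventually.and ((Filter.eventually_all_finset _).2 fun k hk ↦ ?_)
      ((hlt _ hb.last_pos 2 two_pos).and self_mem_nhdsWithin)
    have hk := Finset.mem_range.1 hk
    filter_upwards [hlt _ (hb.left_pos hk) 1 one_pos,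
      hlt _ (sub_pos.2 (hb.lt k hk)) 4 four_pos] with η h1 h2
    exact ⟨by linarith, h2⟩
  have hη : ∀ p q : ℝ, Tendsto (fun η ↦ boxMass K (fun k ↦ (t : ℝ) / (a k + p * η) ^ α)
      (fun k ↦ (t : ℝ) / (b k + q * η) ^ α)) (𝓝[>] 0)
      (𝓝 (boxMass K (fun k ↦ (t : ℝ) / a k ^ α) (fun k ↦ (t : ℝ) / b k ^ α))) := fun p q ↦
    tendsto_boxMass (fun k hk ↦ tendsto_div_add_mul_rpow _ _ _ (hb.left_pos hk))
      (fun k hk ↦ tendsto_div_add_mul_rpow _ _ _ (hb.pos hk))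
  have hc : ∀ a' b' : ℕ → ℝ, (∀ k < K, 0 < a' k) → (∀ k ≤ K, 0 < b' k) →
      Tendsto (fun c : ℝ≥0 ↦ boxMass K
        (fun k ↦ ((c ^ α * t : ℝ≥0) : ℝ) * ν.real (Ioi (c * a' k)))
        (fun k ↦ ((c ^ α * t : ℝ≥0) : ℝ) * ν.real (Ioi (c * b' k)))) atTop
        (𝓝 (boxMass K (fun k ↦ (t : ℝ) / a' k ^ α) (fun k ↦ (t : ℝ) / b' k ^ α))) :=
    fun a' b' ha' hb' ↦ tendsto_boxMass (fun k hk ↦ tendsto_scaled_tail htail t (ha' k hk))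
      (fun k hk ↦ tendsto_scaled_tail htail t (hb' k hk))
  -- `η` is fixed first, so that the perturbed limit is still on the right side of `v`; only then is
  -- `c` taken large.
  refine tendsto_order.2 ⟨fun v hv ↦ ?_, fun v hv ↦ ?_⟩
  · obtain ⟨η, hηv, hη1, hη2, hη0⟩ :=
      (((tendsto_order.1 (hη 2 (-2))).1 v hv).and hsmall).exists
    replace hη1 := fun k hk ↦ hη1 k (Finset.mem_range.2 hk)
    have hpos : ∀ k ≤ K, 0 < b k + -2 * η := fun k hk ↦ by
      have := hb.le_of_le hk le_rfl
      linarith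
    have hbox : IsOrderBox K (fun k ↦ a k + η) (fun k ↦ b k - η) :=
      ⟨fun k hk ↦ by have := (hη1 k hk).2; linarith,
        fun k hk ↦ by have := hb.succ_lt k hk; linarith, by linarith⟩
    filter_upwards [(tendsto_order.1 (hc (fun k ↦ a k + 2 * η) (fun k ↦ b k + -2 * η)
      (fun k hk ↦ by have := hb.left_pos hk; linarith) hpos)).1 v hηv,
      eventually_gt_atTop 0] with c hcv hc0
    have hc0' : (0 : ℝ) < c := hc0
    simp only [scaledOrderSeq_mem_orderBox_iff hc0]
    refine hcv.trans_le (hL.le_measureReal_orderBox hν _ (hbox.const_mul hc0')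
      (a₂ := fun k ↦ c * (a k + 2 * η)) (b₂ := fun k ↦ c * (b k + -2 * η)) ?_ ?_ ?_ ?_ ?_ ?_)
    · exact fun k _ ↦ mul_lt_mul_of_pos_left (by linarith) hc0'
    · exact fun k _ ↦ mul_lt_mul_of_pos_left (by linarith) hc0'
    · exact fun k hk ↦ mul_le_mul_of_nonneg_left (by have := (hη1 k hk).2; linarith) hc0'.le
    · exact fun k _ ↦ mul_lt_mul_of_pos_left (by linarith) hc0'
    · exact fun k _ ↦ mul_lt_mul_of_pos_left (by linarith) hc0'
    · exact mul_pos hc0' (hpos K le_rfl)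
  · obtain ⟨η, hηv, hη1, hη2, hη0⟩ :=
      (((tendsto_order.1 (hη (-1) 1)).2 v hv).and hsmall).exists
    replace hη1 := fun k hk ↦ hη1 k (Finset.mem_range.2 hk)
    have hapos : ∀ k < K, 0 < a k + -1 * η := fun k hk ↦ by have := (hη1 k hk).1; linarith
    filter_upwards [(tendsto_order.1 (hc (fun k ↦ a k + -1 * η) (fun k ↦ b k + 1 * η)
      hapos (fun k hk ↦ by have := hb.pos hk; linarith))).2 v hηv,
      eventually_gt_atTop 0] with c hcv hc0
    have hc0' : (0 : ℝ) < c := hc0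
    simp only [scaledOrderSeq_mem_orderBox_iff hc0]
    refine (hL.measureReal_orderBox_le hν _ (hb.const_mul hc0')
      (a' := fun k ↦ c * (a k + -1 * η)) (b' := fun k ↦ c * (b k + 1 * η)) ?_ ?_ ?_).trans_lt hcv
    · exact fun k hk ↦ mul_pos hc0' (hapos k hk)
    · exact fun k _ ↦ mul_lt_mul_of_pos_left (by linarith) hc0'
    · exact fun k _ ↦ mul_lt_mul_of_pos_left (by linarith) hc0'

lemma limitLaw_orderBox {α : ℝ} (hα : 0 < α) {t : ℝ≥0} (ht : 0 < t) {K : ℕ} {a b : ℕ → ℝ}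
    (hb : IsOrderBox K a b) : (limitLaw α t : Measure (ℕ → ℝ)).real (orderBox K a b) =
      boxMass K (fun k ↦ (t : ℝ) / a k ^ α) (fun k ↦ (t : ℝ) / b k ^ α) := by
  rw [orderBox, limitLaw_box hα ht hb.lt hb.succ_lt fun k hk ↦ hb.pos hk, boxMass, mul_assoc,
    mul_comm, neg_div]
  congr 1
  rw [← Finset.card_range K, ← Finset.prod_const, Finset.card_range, ← Finset.prod_mul_distrib]
  exact Finset.prod_congr rfl fun k _ ↦ by ring

/-- Convergence in law of the rescaled order flights. -/
lemma IsSubordinator.tendstoInDistribution_scaledOrderSeq (hL : IsSubordinator P L)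
    (hν : IsLevyMeasureOf ν P L) {α : ℝ} (hα : 0 < α)
    (htail : Asymptotics.IsEquivalent atTop (flightTail ν) (fun x : ℝ ↦ 1 / x ^ α)) {t : ℝ≥0}
    (ht : 0 < t) :
    TendstoInDistribution (fun c : ℝ≥0 ↦ scaledOrderSeq L α t c) atTop (fun x : ℕ → ℝ ↦ x)
      (fun _ ↦ P) (limitLaw α t : Measure (ℕ → ℝ)) := by
  refine ⟨hL.aemeasurable_scaledOrderSeq α t, aemeasurable_id, ?_⟩
  have hid : (⟨(limitLaw α t : Measure (ℕ → ℝ)).map (fun x ↦ x),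
      Measure.isProbabilityMeasure_map aemeasurable_id⟩ : ProbabilityMeasure (ℕ → ℝ)) =
      limitLaw α t := Subtype.ext Measure.map_id
  rw [hid]
  refine tendsto_of_tendsto_orderBox (ae_limitLaw hα ht) fun K a b hb ↦ ?_
  rw [← NNReal.tendsto_coe]
  have h := hL.tendsto_measureReal_scaledOrderSeq hν htail t hb
  rw [← limitLaw_orderBox hα ht hb] at h
  refine h.congr fun c ↦ ?_
  change _ = (P.map (scaledOrderSeq L α t c)).real (orderBox K a b)
  rw [map_measureReal_apply_of_aemeasurable (hL.aemeasurable_scaledOrderSeq α t c)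
    (isOpen_orderBox K a b).measurableSet]
  rfl

end

/-! ### Finite families of indices and the main theorem. -/

/-- Box probabilities of the limit law, for finite families of intervals. -/
lemma limitLaw_box_fin {α : ℝ} (hα : 0 < α) {t : ℝ≥0} (ht : 0 < t) (K : ℕ) (a b : Fin (K + 1) → ℝ)
    (ha : a (Fin.last K) = 0) (hab : ∀ k, a k < b k) (hba : ∀ k : Fin K, b k.succ < a k.castSucc) :
    (limitLaw α t : Measure (ℕ → ℝ)).real {x | ∀ k : Fin (K + 1), a k < x k ∧ x k < b k} =
      Real.exp (-(t : ℝ) / b (Fin.last K) ^ α) * (t : ℝ) ^ K *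
        ∏ k : Fin K, (1 / a k.castSucc ^ α - 1 / b k.castSucc ^ α) := by
  set a' : ℕ → ℝ := fun k ↦ if h : k < K + 1 then a ⟨k, h⟩ else 0 with ha'
  set b' : ℕ → ℝ := fun k ↦ if h : k < K + 1 then b ⟨k, h⟩ else 0 with hb'
  have hae : ∀ (k) (h : k < K + 1), a' k = a ⟨k, h⟩ := fun k h ↦ dif_pos h
  have hbe : ∀ (k) (h : k < K + 1), b' k = b ⟨k, h⟩ := fun k h ↦ dif_pos h
  have hbox : IsOrderBox K a' b' := by
    refine ⟨fun k hk ↦ ?_, fun k hk ↦ ?_, ?_⟩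
    · rw [hae k (by omega), hbe k (by omega)]; exact hab _
    · rw [hae k (by omega), hbe (k + 1) (by omega)]; exact hba ⟨k, hk⟩
    · rw [hbe K (by omega)]; exact ha ▸ hab (Fin.last K)
  have h := limitLaw_box hα ht hbox.lt hbox.succ_lt fun k hk ↦ hbox.pos hk
  rw [hbe K (by omega), Finset.prod_range] at h
  have hprod : ∏ k : Fin K, (1 / a' k ^ α - 1 / b' k ^ α) =
      ∏ k : Fin K, (1 / a k.castSucc ^ α - 1 / b k.castSucc ^ α) :=
    Finset.prod_congr rfl fun k _ ↦ by rw [hae k (by omega), hbe k (by omega)]; rfl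
  rw [hprod] at h
  refine Eq.trans (measureReal_congr ?_) h
  -- The sets differ only in the requirement `0 < x K`, which comes from the last left endpoint `0`
  -- and holds almost surely.
  filter_upwards [ae_limitLaw hα ht] with x hx
  refine propext ?_
  change (∀ k : Fin (K + 1), a k < x k ∧ x k < b k) ↔
    (∀ k < K, a' k < x k ∧ x k < b' k) ∧ x K < b (Fin.last K)
  constructor
  · intro h
    refine ⟨fun k hk ↦ ?_, (h (Fin.last K)).2⟩
    rw [hae k (by omega), hbe k (by omega)]
    exact h ⟨k, by omega⟩
  · rintro ⟨h1, h2⟩ k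
    induction k using Fin.lastCases with
    | last => exact ⟨ha ▸ hx.2 K, h2⟩
    | cast k =>
      have := h1 k k.2
      rw [hae k (by omega), hbe k (by omega)] at this
      exact this

lemma limitLaw_ratio_fin {α : ℝ} (hα : 0 < α) {t : ℝ≥0} (ht : 0 < t) (K : ℕ) (n : Fin (K + 1) → ℕ)
    (hn : StrictMono n) (u : Fin K → ℝ) (hu : ∀ k, 0 ≤ u k) :
    (limitLaw α t : Measure (ℕ → ℝ)).real
        {x | ∀ k : Fin K, x (n k.succ) / x (n k.castSucc) ≤ u k} =
      ∏ k : Fin K, betaCDF ((n k.castSucc : ℝ) + 1) ((n k.succ : ℝ) - (n k.castSucc : ℝ))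
        (u k ^ α) := by
  -- The extension must remain strictly increasing on all of `ℕ`, hence the continuation beyond the
  -- last index; its values there do not enter the formula.
  set n' : ℕ → ℕ := fun k ↦ if h : k < K + 1 then n ⟨k, h⟩ else n (Fin.last K) + k with hn'
  set u' : ℕ → ℝ := fun k ↦ if h : k < K then u ⟨k, h⟩ else 0 with hu'
  have hne : ∀ (k) (h : k < K + 1), n' k = n ⟨k, h⟩ := fun k h ↦ dif_pos h
  have hue : ∀ (k) (h : k < K), u' k = u ⟨k, h⟩ := fun k h ↦ dif_pos h
  have hn'm : StrictMono n' := by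
    refine strictMono_nat_of_lt_succ fun k ↦ ?_
    rcases lt_trichotomy k K with hk | rfl | hk
    · rw [hne k (by omega), hne (k + 1) (by omega)]
      exact hn (Fin.mk_lt_mk.2 k.lt_succ_self)
    · rw [hne k (by omega), hn']
      simp only [lt_irrefl, dif_neg, not_false_eq_true]
      change n (Fin.last k) < _
      omega
    · have h1 : ¬ k < K + 1 := by omega
      have h2 : ¬ k + 1 < K + 1 := by omega
      simp only [hn', h1, h2, dif_neg, not_false_eq_true]
      omega
  have h := limitLaw_ratio hα ht hn'm K (u := u') fun k hk ↦ by rw [hue k hk]; exact hu _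
  rw [Finset.prod_range] at h
  convert h using 1
  · congr 1
    ext x
    simp only [mem_ofPred_eq, Fin.forall_iff]
    refine forall₂_congr fun k hk ↦ ?_
    rw [hne k (by omega), hne (k + 1) (by omega), hue k hk]
    rfl
  · refine Finset.prod_congr rfl fun k _ ↦ ?_
    rw [hne k (by omega), hne (k + 1) (by omega), hue k k.2]
    rfl

lemma limitLaw_ratio_first_fin {α : ℝ} (hα : 0 < α) {t : ℝ≥0} (ht : 0 < t) (K : ℕ)
    (a : Fin (K + 2) → ℝ) (ha : StrictAnti a) (h0 : a 0 ≤ 1) (hlast : a (Fin.last (K + 1)) = 0) :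
    (limitLaw α t : Measure (ℕ → ℝ)).real {x | ∀ k : Fin (K + 1),
        a k.succ < x (k + 1) / x 0 ∧ x (k + 1) / x 0 < a k.castSucc} =
      Real.Gamma (K + 1) * a (Fin.last K).castSucc ^ (α * (K + 1)) *
        ∏ k : Fin K, (1 / a k.succ.castSucc ^ α - 1 / a k.castSucc.castSucc ^ α) := by
  set a' : ℕ → ℝ := fun k ↦ if h : k < K + 2 then a ⟨k, h⟩ else 0 with ha'
  have hae : ∀ (k) (h : k < K + 2), a' k = a ⟨k, h⟩ := fun k h ↦ dif_pos h
  have h := limitLaw_ratio_first hα ht (K := K) (a := a')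
    (fun k hk ↦ by
      rw [hae k (by omega), hae (k + 1) (by omega)]
      exact ha (Fin.mk_lt_mk.2 k.lt_succ_self))
    (by rw [hae 0 (by omega)]; exact h0) (by rw [hae (K + 1) (by omega)]; exact hlast)
  rw [Finset.prod_range, hae K (by omega)] at h
  convert h using 1
  · congr 1
    ext x
    simp only [mem_ofPred_eq, Fin.forall_iff]
    refine forall₂_congr fun k hk ↦ ?_
    rw [hae k (by omega), hae (k + 1) (by omega)]
    rfl
  · congr 1
    refine Finset.prod_congr rfl fun k _ ↦ ?_
    rw [hae k (by omega), hae (k + 1) (by omega)]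
    rfl

/-- Scaling limit of the order sequence. Entry `i : ℕ` of a sequence `x` is the one of order
`i + 1`, so `x 0` is the largest flight. The second half of the conclusion is the hierarchy of the
limit sequence. -/
theorem mainTheorem7 {Ω : Type*} [MeasurableSpace Ω] (P : Measure Ω) [IsProbabilityMeasure P]
    (L : ℝ≥0 → Ω → ℝ) (hL : IsSubordinator P L)
    (ν : Measure ℝ) (hν : IsLevyMeasureOf ν P L)
    (α : ℝ) (hα : 0 < α)
    (htail : Asymptotics.IsEquivalent atTop (flightTail ν) (fun x : ℝ ↦ 1 / x ^ α))
    (t : ℝ≥0) (ht : 0 < t) :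
    ∃ μ : ProbabilityMeasure (ℕ → ℝ),
      -- convergence in law of the whole sequence
      TendstoInDistribution (fun c : ℝ≥0 ↦ scaledOrderSeq L α t c) atTop
        (fun x : ℕ → ℝ ↦ x) (fun _ ↦ P) (μ : Measure (ℕ → ℝ)) ∧
      -- the limit is almost surely positive and strictly decreasing
      (∀ᵐ x ∂(μ : Measure (ℕ → ℝ)), StrictAnti x ∧ ∀ i, 0 < x i) ∧
      -- joint box probabilities; the number of boxes is `K + 1`
      (∀ (K : ℕ) (a b : Fin (K + 1) → ℝ), a (Fin.last K) = 0 → (∀ k, a k < b k) →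
        (∀ k : Fin K, b k.succ < a k.castSucc) →
        (μ : Measure (ℕ → ℝ)).real {x | ∀ k : Fin (K + 1), a k < x k ∧ x k < b k} =
          Real.exp (-(t : ℝ) / b (Fin.last K) ^ α) * (t : ℝ) ^ K *
            ∏ k : Fin K, (1 / a k.castSucc ^ α - 1 / b k.castSucc ^ α)) ∧
      -- joint law of the ratios of the entries of orders `n 0 + 1 < n 1 + 1 < ⋯ < n K + 1`
      (∀ (K : ℕ) (n : Fin (K + 1) → ℕ), StrictMono n → ∀ u : Fin K → ℝ,
        (∀ k, 0 ≤ u k ∧ u k ≤ 1) →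
        (μ : Measure (ℕ → ℝ)).real {x | ∀ k : Fin K, x (n k.succ) / x (n k.castSucc) ≤ u k} =
          ∏ k : Fin K, betaCDF ((n k.castSucc : ℝ) + 1)
            ((n k.succ : ℝ) - (n k.castSucc : ℝ)) (u k ^ α)) ∧
      -- moments of the pairwise ratios, orders `n + 1` and `n + m + 1`
      (∀ (n m : ℕ) (p : ℝ), 1 ≤ m → 0 < p →
        ∫ x, (x (n + m) / x n) ^ p ∂(μ : Measure (ℕ → ℝ)) =
          ∏ k ∈ Finset.Icc (n + 1) (n + m), ((k : ℝ) / (k + p / α))) ∧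
      -- joint law of the ratios to the largest entry; the number of ratios is `K + 1`
      (∀ (K : ℕ) (a : Fin (K + 2) → ℝ), StrictAnti a → a 0 ≤ 1 → a (Fin.last (K + 1)) = 0 →
        (μ : Measure (ℕ → ℝ)).real {x | ∀ k : Fin (K + 1),
            a k.succ < x (k + 1) / x 0 ∧ x (k + 1) / x 0 < a k.castSucc} =
          Real.Gamma (K + 1) * a (Fin.last K).castSucc ^ (α * (K + 1)) *
            ∏ k : Fin K, (1 / a k.succ.castSucc ^ α - 1 / a k.castSucc.castSucc ^ α)) := by
  refine ⟨limitLaw α t, hL.tendstoInDistribution_scaledOrderSeq hν hα htail ht, ae_limitLaw hα ht,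
    limitLaw_box_fin hα ht, fun K n hn u hu ↦ limitLaw_ratio_fin hα ht K n hn u fun k ↦ (hu k).1,
    fun n m p hm hp ↦ limitLaw_moment hα ht n m hm hp, limitLaw_ratio_first_fin hα ht⟩
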